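/- **Setting.** For $\phi\in\mathbb R$ let $A^{\mathsf T}(\phi)$ be the rotation of $\mathbb R^3$ by the angle $\phi$ about the $e_3$-axis, and $A(\phi)=A^{\mathsf T}(-\phi)$. A surface of revolution is a set $\{A^{\mathsf T}(\phi)\gamma(t):\phi\in[0,2\pi],\,t\in I\}$, where $I=[a,b]$ is a compact nondegenerate interval and $\gamma=(x,0,z):I\to\mathbb R^3$ is a $C^1$ curve with $x\ge 0$ and $\dot\gamma\neq 0$ on $I$, injective except possibly for $\gamma(a)=\gamma(b)$, which meets the $e_3$-axis only perpendicularly and at most at two distinct points (which are then end points of $\gamma$, with $\gamma(a)\ne\gamma(b)$). Let $S$ be the surface of revolution generated by $\gamma$, let $\xi(\phi,t)=A^{\mathsf T}(\phi)\gamma(t)$, $\mathfrak h_1(t)=|x(t)|$, let $T$ be another surface of revolution, and let $H^1(S,T)$ be the set of $m\in H^1(S,\mathbb R^3)$ with values in $T$. For $\xi\in S$ let $S_\xi$ be the circle of latitude through $\xi$ and $\langle m\rangle_{S_\xi}$ the average of $m$ over $S_\xi$. A map $u:S\to\mathbb R^3$ is axially symmetric if $u(A^{\mathsf T}(\phi)\xi)=A^{\mathsf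 T}(\phi)u(\xi)$, and axially antisymmetric if $u(A^{\mathsf T}(\phi)\xi)=A(\phi)u(\xi)$, for all $\phi\in\mathbb R$ and $\xi\in S$. **Theorem.** Let $g:\mathbb R\to[0,\infty)$ be Lipschitz, $\mathbf a:S\to\mathbb R^3$ Lipschitz, and $\omega:S\to[0,\infty)$ measurable; put $W(t)=\big(\int_0^{2\pi}\omega^2(\xi(\phi,t))\,d\phi\big)^{1/2}$ and suppose that $\sup_{t\in I}\mathfrak h_1(t)W(t)<\infty$. For $m\in H^1(S,T)$ let $$\mathcal E_\omega(m)=\int_S|\nabla m|^2\,d\xi+\int_S g(m\cdot\mathbf a)\,d\xi+\int_S|\langle m\rangle_{S_\xi}\times e_3|^2\,\omega^2(\xi)\,d\xi\in[0,\infty];$$ a minimizer is an $m\in H^1(S,T)$ with $\mathcal E_\omega(m)=\min_{H^1(S,T)}\mathcal E_\omega<\infty$. Suppose that $\mathfrak h_1(t)W(t)>\sqrt{2\pi}$ for every $t\in I$ with $\mathfrak h_1(t)>0$. (i) If $\mathbf a$ is axially symmetric, then for every minimizer $m$ there is an axially symmetric $u\in H^1(S,T)$ with $\mathcal E_\omega(u)=\mathcal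 E_\omega(m)$, built from $m$ in the sense that for some $\phi_*\in[0,2\pi]$ one has $u(\xi(\phi,t))=A^{\mathsf T}(\phi)A(\phi_*)\,m(\xi(\phi_*,t))$ for all $\phi\in\mathbb R$ and all $t\in I$ with $\mathfrak h_1(t)>0$. (ii) If $\mathbf a$ is axially antisymmetric, then for every minimizer $m$ there is an axially antisymmetric $u\in H^1(S,T)$ with $\mathcal E_\omega(u)=\mathcal E_\omega(m)$, built from $m$ in the sense that for some $\phi_*\in[0,2\pi]$ one has $u(\xi(\phi,t))=A(\phi)A^{\mathsf T}(\phi_*)\,m(\xi(\phi_*,t))$ for all $\phi\in\mathbb R$ and all $t\in I$ with $\mathfrak h_1(t)>0$. (iii) If $\mathbf a$ is axially symmetric or axially antisymmetric, then every minimizer $m$ has, for almost every $(\phi,t)\in[0,2\pi]\times I$, the form $$m(\xi(\phi,t))=\alpha_\perp(t)\cos\phi+\beta_\perp(t)\sin\phi+\eta(t)e_3$$ with some $\alpha_\perp,\beta_\perp\in H^1(I,\mathbb R^2)$ (where $\mathbb R^2=\mathbb R^2\times\{0\}$) and $\eta\in H^1(I,\mathbb R)$ such that, for almost every $t\in I$,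 the right-hand side lies in $T$ for all $\phi\in\mathbb R$. In particular $m$ is axially null-average: $\langle m\rangle_{S_\xi}\times e_3=0$ on almost every circle of latitude. -/

import Mathlib

open Set MeasureTheory
open scoped ENNReal

noncomputable section

/-- Euclidean three-space. -/
abbrev E3 : Type := EuclideanSpace ℝ (Fin 3)

/-- Euclidean two-space. -/
abbrev E2 : Type := EuclideanSpace ℝ (Fin 2)

/-- The third vector of the standard basis. -/
def e3 : E3 := !₂[(0 : ℝ), 0, 1]

/-- The inclusion `ℝ² ≅ ℝ² × {0} ⊆ ℝ³`. -/
def horiz (v : E2) : E3 := !₂[v 0, v 1, 0]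

/-- The vector product of `ℝ³`. -/
def cross (v w : E3) : E3 := WithLp.toLp 2 (crossProduct v.ofLp w.ofLp)

/-- `rot φ` is the rotation by the angle `φ` about the third axis (the matrix `Aᵀ(φ)`);
its inverse `A(φ)` is `rot (-φ)`. -/
def rot (φ : ℝ) (v : E3) : E3 :=
  !₂[Real.cos φ * v 0 - Real.sin φ * v 1, Real.sin φ * v 0 + Real.cos φ * v 1, v 2]

/-- A regular simple `C¹` curve `γ : [a, b] → ℝ³`, lying in the half-plane `y = 0`, `x ≥ 0`
(injective, except that it may close into a loop), which generates a regular surface of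
revolution: it meets the third axis only perpendicularly, and a loop does not meet it at its
base point. (Since `x ≥ 0` and `γ' ≠ 0`, a perpendicular contact is possible at `a` and at `b`
only, so there are at most two contacts, at distinct points.) -/
structure RevolutionProfile where
  a : ℝ
  b : ℝ
  γ : ℝ → E3
  a_lt_b : a < b
  contDiffOn : ContDiffOn ℝ 1 γ (Icc a b)
  in_plane : ∀ t ∈ Icc a b, γ t 1 = 0
  x_nonneg : ∀ t ∈ Icc a b, 0 ≤ γ t 0
  regular : ∀ t ∈ Icc a b, derivWithin γ (Icc a b) t ≠ 0
  simple : ∀ s ∈ Icc a b, ∀ t ∈ Icc a b, γ s = γ t →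
    s = t ∨ (s = a ∧ t = b) ∨ (s = b ∧ t = a)
  perp_axis : ∀ t ∈ Icc a b, γ t 0 = 0 → derivWithin γ (Icc a b) t 2 = 0
  loop_off_axis : γ a = γ b → 0 < γ a 0

namespace RevolutionProfile

variable (P : RevolutionProfile)

/-- The parameter interval `I = [a, b]`. -/
def I : Set ℝ := Icc P.a P.b

/-- The parametrization `ξ(φ, t) = Aᵀ(φ) γ(t)`. -/
def ξ (p : ℝ × ℝ) : E3 := rot p.1 (P.γ p.2)

/-- The parameter domain `[0, 2π] × I`. -/
def rect : Set (ℝ × ℝ) := Icc 0 (2 * Real.pi) ×ˢ P.I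

/-- The surface of revolution generated by the profile. -/
def surface : Set E3 := P.ξ '' P.rect

/-- The coordinate tangent vector `∂_φ ξ`. -/
def tauφ (p : ℝ × ℝ) : E3 := deriv (fun s => P.ξ (s, p.2)) p.1

/-- The coordinate tangent vector `∂_t ξ`. -/
def tauT (p : ℝ × ℝ) : E3 := derivWithin (fun s => P.ξ (p.1, s)) P.I p.2

/-- The metric coefficient `h₁(t) = |x(t)|`. -/
def h₁ (t : ℝ) : ℝ := |P.γ t 0|

/-- The metric coefficient `h₂(t) = |γ'(t)|`. -/
def h₂ (t : ℝ) : ℝ := ‖derivWithin P.γ P.I t‖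

/-- The surface integral of a nonnegative integrand given as a function of the parameters;
the area element is `h₁ h₂ dφ dt`. -/
def surfInt (f : ℝ × ℝ → ℝ≥0∞) : ℝ≥0∞ :=
  ∫⁻ p in P.rect, f p * ENNReal.ofReal (P.h₁ p.2 * P.h₂ p.2)

/-- Smooth test functions on the surface, in the coordinates `(φ, t)`: periodic in `φ`, and
either compactly supported in the open interval `(a, b)` with respect to `t`, or, if the profile
is a loop, so that `t = a` and `t = b` describe the same circle, compatible there. -/
structure IsTest (ψ : ℝ × ℝ → ℝ) : Prop where
  smooth : ContDiff ℝ ((⊤ : ℕ∞) : WithTop ℕ∞) ψ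
  periodic : ∀ φ t, ψ (φ + 2 * Real.pi, t) = ψ (φ, t)
  boundary : (P.γ P.a = P.γ P.b ∧ ∀ φ, ψ (φ, P.a) = ψ (φ, P.b)) ∨
    ∃ c d, P.a < c ∧ d < P.b ∧ ∀ φ t, ψ (φ, t) ≠ 0 → t ∈ Icc c d

/-- `|∇m|²` at the point with parameters `p`, where `G p` is a linear map whose restriction to
the tangent plane is the differential of `m`: the sum of the squared derivatives along the
orthonormal tangent frame `∂_φ ξ / |∂_φ ξ|`, `∂_t ξ / |∂_t ξ|`. -/
def gradNormSq (G : ℝ × ℝ → (E3 →L[ℝ] E3)) (p : ℝ × ℝ) : ℝ :=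
  ‖G p (‖P.tauφ p‖⁻¹ • P.tauφ p)‖ ^ 2 + ‖G p (‖P.tauT p‖⁻¹ • P.tauT p)‖ ^ 2

/-- `∫_S |∇m|²` for the gradient `G`. -/
def gradEnergy (G : ℝ × ℝ → (E3 →L[ℝ] E3)) : ℝ≥0∞ :=
  P.surfInt fun p => ENNReal.ofReal (P.gradNormSq G p)

/-- `G`, as a function of the parameters, is a square-integrable weak tangential gradient
of `m`: the weak partial derivatives of `m ∘ ξ` are `G ∂_φ ξ` and `G ∂_t ξ`.
(Poles of the surface have zero capacity and need not be tested.) -/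
structure IsWeakGrad (m : E3 → E3) (G : ℝ × ℝ → (E3 →L[ℝ] E3)) : Prop where
  measurable : AEStronglyMeasurable G (volume.restrict P.rect)
  energy_lt_top : P.gradEnergy G < ∞
  weak_φ : ∀ ψ, P.IsTest ψ →
    ∫ p in P.rect, (fderiv ℝ ψ p (1, 0)) • m (P.ξ p) = -∫ p in P.rect, ψ p • G p (P.tauφ p)
  weak_t : ∀ ψ, P.IsTest ψ →
    ∫ p in P.rect, (fderiv ℝ ψ p (0, 1)) • m (P.ξ p) = -∫ p in P.rect, ψ p • G p (P.tauT p)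

/-- `m ∈ H¹(S, ℝ³)` (only the values of `m` on `S` matter). -/
structure MemH1 (m : E3 → E3) : Prop where
  measurable : AEStronglyMeasurable (fun p => m (P.ξ p)) (volume.restrict P.rect)
  sq_lt_top : P.surfInt (fun p => ENNReal.ofReal (‖m (P.ξ p)‖ ^ 2)) < ∞
  exists_grad : ∃ G, P.IsWeakGrad m G

/-- `m ∈ H¹(S, T)`. -/
def MemH1To (T : Set E3) (m : E3 → E3) : Prop :=
  P.MemH1 m ∧ ∀ ξ ∈ P.surface, m ξ ∈ T

/-- The Dirichlet energy `∫_S |∇m|²`. The weak gradient is unique (almost everywhere, on tangent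
vectors), so the infimum is over a single value for `m ∈ H¹(S, ℝ³)`. -/
def dirichlet (m : E3 → E3) : ℝ≥0∞ :=
  ⨅ (G : ℝ × ℝ → (E3 →L[ℝ] E3)) (_ : P.IsWeakGrad m G), P.gradEnergy G

end RevolutionProfile

/-- The average of `m` along the circle of latitude through `ξ`. -/
def circleAvg (m : E3 → E3) (ξ : E3) : E3 :=
  (2 * Real.pi)⁻¹ • ∫ θ in (0 : ℝ)..(2 * Real.pi), m (rot θ ξ)

namespace RevolutionProfile

variable (P : RevolutionProfile)

/-- The anisotropy energy `∫_S g(m · a)`. -/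
def anisotropy (g : ℝ → ℝ) (a m : E3 → E3) : ℝ≥0∞ :=
  P.surfInt fun p => ENNReal.ofReal (g (inner ℝ (m (P.ξ p)) (a (P.ξ p))))

/-- The penalization `∫_S |⟨m⟩_{S_ξ} × e₃|² ω²`. -/
def penalty (ω : E3 → ℝ) (m : E3 → E3) : ℝ≥0∞ :=
  P.surfInt fun p =>
    ENNReal.ofReal (‖cross (circleAvg m (P.ξ p)) e3‖ ^ 2 * ω (P.ξ p) ^ 2)

/-- The energy `E_ω`. -/
def energy (ω : E3 → ℝ) (g : ℝ → ℝ) (a m : E3 → E3) : ℝ≥0∞ :=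
  P.dirichlet m + P.anisotropy g a m + P.penalty ω m

/-- `m` minimizes `E_ω` over `H¹(S, T)`, with a finite minimum. -/
def IsMinimizer (T : Set E3) (ω : E3 → ℝ) (g : ℝ → ℝ) (a m : E3 → E3) : Prop :=
  P.MemH1To T m ∧ P.energy ω g a m < ∞ ∧
    ∀ m', P.MemH1To T m' → P.energy ω g a m ≤ P.energy ω g a m'

/-- The circular integral weight `W(t) = (∫₀^{2π} ω²(φ, t) dφ)^{1/2}`. -/
def circWeight (ω : E3 → ℝ) (t : ℝ) : ℝ≥0∞ :=
  (∫⁻ φ in Icc 0 (2 * Real.pi), ENNReal.ofReal (ω (P.ξ (φ, t)) ^ 2)) ^ (1 / 2 : ℝ)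

/-- The field is axially null-average: its average along almost every circle of latitude is
parallel to the axis. -/
def AxiallyNullAverage (m : E3 → E3) : Prop :=
  ∀ᵐ t ∂(volume.restrict P.I), cross (circleAvg m (P.γ t)) e3 = 0

end RevolutionProfile

/-- Axial symmetry on `S`. -/
def AxiallySymmetric (S : Set E3) (u : E3 → E3) : Prop :=
  ∀ φ : ℝ, ∀ ξ ∈ S, u (rot φ ξ) = rot φ (u ξ)

/-- Axial antisymmetry on `S`. -/
def AxiallyAntisymmetric (S : Set E3) (u : E3 → E3) : Prop :=
  ∀ φ : ℝ, ∀ ξ ∈ S, u (rot φ ξ) = rot (-φ) (u ξ)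

/-- `f ∈ H¹([a, b], F)`: `f` and its weak derivative are square-integrable. -/
def MemH1Interval {F : Type*} [NormedAddCommGroup F] [NormedSpace ℝ F]
    (a b : ℝ) (f : ℝ → F) : Prop :=
  MemLp f 2 (volume.restrict (Icc a b)) ∧
    ∃ f' : ℝ → F, MemLp f' 2 (volume.restrict (Icc a b)) ∧
      ∀ χ : ℝ → ℝ, ContDiff ℝ ((⊤ : ℕ∞) : WithTop ℕ∞) χ → HasCompactSupport χ → tsupport χ ⊆ Ioo a b →
        ∫ t in Icc a b, deriv χ t • f t = -∫ t in Icc a b, χ t • f' t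

end

/-! Write M(φ, t) = m(ξ(φ, t)), let M_⊥ be its horizontal part, and let σ = 1 or σ = -1 according to
whether `a` is symmetric or antisymmetric. A single meridian of m, turned back by the angle σφ,
generates an equivariant map u(ξ(θ, t)) = rot(σθ) rot(-σφ) M(φ, t). Its derivative in θ has length
|M_⊥(φ, t)|, the symmetry of `a` makes its anisotropy density independent of θ, and its mean over
each circle of latitude is vertical, so that it pays no penalty. Hence its energy is at most 2π
J(φ), where J(φ) is the integral over I of h₂/h₁ |M_⊥|² + h₁/h₂ |∂_t M|² + h₁ h₂ g(M · a) along the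
meridian φ (`exists_revolve`, `curveEnergy_rot`).

The integral of J over φ is compared with the energy of m. Only the term h₂/h₁ |M_⊥|² has to be
bounded, by h₂/h₁ |∂_φ M|² plus the penalty. On one circle put N = |∫ M_⊥ dφ|². Wirtinger's
inequality gives ∫ |M_⊥|² ≤ ∫ |∂_φ M|² + N/(2π), and h₁ W > √(2π) says that the penalty on that
circle exceeds h₂/h₁ · N/(2π) unless N = 0 (`ofReal_add_mul_compare`). So ∫ J ≤ E(m)
(`lintegral_slice_le`). If m is a minimizer, then E(m) ≤ 2π J(φ) for almost every φ, and integration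
shows that equality holds throughout. Thus almost every meridian generates an equivariant minimizer.
Moreover N = 0 and Wirtinger's inequality is an equality on almost every circle, which leaves only
the modes cos φ and sin φ in M_⊥ and makes the vertical part constant in φ
(`IsMinimizer.exists_slices`).

Two points need care at a pole, where h₁ = 0. First, a competitor needs a value in T there that is
fixed by all rotations: h₂/h₁ is not integrable at a pole, so a curve of finite energy cannot stay
away from the axis, and the compact set T meets the axis (`exists_axis_point`). Second, the weight
h₁/h₂ degenerates, so finite energy does not give coefficients in H¹(I) up to the pole. Here
minimality is used again: the curve generated by almost every meridian is minimal among all curves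
in T, and comparison with a meridian arc of T running to the axis bounds its energy near the pole by
about its squared distance to the axis. A Hardy-type argument (`integral_div_le_of_energy_le`) turns
this into finiteness of the unweighted Dirichlet integral. The coefficients are finally recovered
from two meridians by solving a linear system. -/

/-! ### Absolutely continuous functions on an interval -/

/-- `f` is a primitive of the integrable function `f'` on `[a, b]`. -/
def IsPrimitiveOn (f f' : ℝ → ℝ) (a b : ℝ) : Prop :=
  IntervalIntegrable f' volume a b ∧ ∀ t ∈ Icc a b, f t = f a + ∫ s in a..t, f' s

namespace IsPrimitiveOn

variable {f f' g g' : ℝ → ℝ} {a b c d : ℝ}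

theorem integral_eq (hab : a ≤ b) (hf : IsPrimitiveOn f f' a b) :
    ∫ s in a..b, f' s = f b - f a := by
  rw [hf.2 b ⟨hab, le_rfl⟩]; ring

theorem of_hasDerivAt (hab : a ≤ b) (hc : ContinuousOn f (Icc a b))
    (hd : ∀ t ∈ Ioo a b, HasDerivAt f (f' t) t) (hi : IntervalIntegrable f' volume a b) :
    IsPrimitiveOn f f' a b := by
  refine ⟨hi, fun t ht => ?_⟩
  rw [intervalIntegral.integral_eq_sub_of_hasDerivAt_of_le ht.1 (hc.mono (Icc_subset_Icc_right ht.2))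
    (fun s hs => hd s ⟨hs.1, hs.2.trans_le ht.2⟩)
    (hi.mono_set (by rw [uIcc_of_le ht.1, uIcc_of_le hab]; exact Icc_subset_Icc_right ht.2))]
  ring

theorem mono (hf : IsPrimitiveOn f f' a b) (hac : a ≤ c) (hcd : c ≤ d) (hdb : d ≤ b) :
    IsPrimitiveOn f f' c d := by
  have hsub : ∀ {u v : ℝ}, u ∈ Icc a b → v ∈ Icc a b → IntervalIntegrable f' volume u v := by
    intro u v hu hv
    refine hf.1.mono_set ?_
    rw [uIcc_of_le (hac.trans (hcd.trans hdb))]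
    exact ordConnected_Icc.uIcc_subset hu hv
  have hab := hac.trans (hcd.trans hdb)
  refine ⟨hsub ⟨hac, hcd.trans hdb⟩ ⟨hac.trans hcd, hdb⟩, fun t ht => ?_⟩
  rw [hf.2 t ⟨hac.trans ht.1, ht.2.trans hdb⟩, hf.2 c ⟨hac, hcd.trans hdb⟩, add_assoc,
    intervalIntegral.integral_add_adjacent_intervals (hsub ⟨le_rfl, hab⟩ ⟨hac, hcd.trans hdb⟩)
      (hsub ⟨hac, hcd.trans hdb⟩ ⟨hac.trans ht.1, ht.2.trans hdb⟩)]

theorem continuousOn (hab : a ≤ b) (hf : IsPrimitiveOn f f' a b) : ContinuousOn f (Icc a b) := by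
  have h : ContinuousOn (fun t => f a + ∫ s in a..t, f' s) (Icc a b) := by
    refine continuousOn_const.add ?_
    have := intervalIntegral.continuousOn_primitive_interval' hf.1 (left_mem_uIcc)
    rwa [uIcc_of_le hab] at this
  exact h.congr fun t ht => hf.2 t ht

theorem add (hf : IsPrimitiveOn f f' a b) (hg : IsPrimitiveOn g g' a b) :
    IsPrimitiveOn (fun t => f t + g t) (fun t => f' t + g' t) a b := by
  refine ⟨hf.1.add hg.1, fun t ht => ?_⟩
  have hm : uIcc a t ⊆ uIcc a b := by
    rw [uIcc_of_le ht.1, uIcc_of_le (ht.1.trans ht.2)]; exact Icc_subset_Icc_right ht.2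
  simp only
  rw [hf.2 t ht, hg.2 t ht, intervalIntegral.integral_add (hf.1.mono_set hm) (hg.1.mono_set hm)]
  ring

/-- Integration by parts for merely integrable derivatives: primitives are absolutely continuous,
and by Lebesgue's theorem they have the prescribed derivative almost everywhere. -/
theorem mul (hab : a ≤ b) (hf : IsPrimitiveOn f f' a b) (hg : IsPrimitiveOn g g' a b) :
    IsPrimitiveOn (fun t => f t * g t) (fun t => f' t * g t + f t * g' t) a b := by
  have hcf := hf.continuousOn hab
  have hcg := hg.continuousOn hab
  rw [← uIcc_of_le hab] at hcf hcg
  refine ⟨(hf.1.mul_continuousOn hcg).add (hg.1.continuousOn_mul hcf), fun t ht => ?_⟩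
  have hm : uIcc a t ⊆ uIcc a b := by
    rw [uIcc_of_le ht.1, uIcc_of_le hab]; exact Icc_subset_Icc_right ht.2
  -- `f` and `g` are arbitrary outside `[a, b]`; derivatives are taken of the globally defined
  -- primitives `F` and `G`, which agree with them on `[a, b]`.
  set F : ℝ → ℝ := (fun _ => f a) + fun t => ∫ s in a..t, f' s with hF
  set G : ℝ → ℝ := (fun _ => g a) + fun t => ∫ s in a..t, g' s with hG
  have hconst : ∀ k : ℝ, AbsolutelyContinuousOnInterval (fun _ : ℝ => k) a t := fun k =>
    ContDiffOn.absolutelyContinuousOnInterval contDiffOn_const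
  have hFac : AbsolutelyContinuousOnInterval F a t :=
    (hconst _).add ((hf.1.mono_set hm).absolutelyContinuousOnInterval_intervalIntegral left_mem_uIcc)
  have hGac : AbsolutelyContinuousOnInterval G a t :=
    (hconst _).add ((hg.1.mono_set hm).absolutelyContinuousOnInterval_intervalIntegral left_mem_uIcc)
  have hFf : ∀ s ∈ Icc a b, F s = f s := fun s hs => (hf.2 s hs).symm
  have hGg : ∀ s ∈ Icc a b, G s = g s := fun s hs => (hg.2 s hs).symm
  have key := hFac.integral_deriv_mul_eq_sub hGac
  have ha : a ∈ Icc a b := ⟨le_rfl, hab⟩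
  rw [hFf a ha, hGg a ha, hFf t ht, hGg t ht] at key
  have : ∫ x in a..t, f' x * g x + f x * g' x = ∫ x in a..t, deriv F x * G x + F x * deriv G x := by
    apply intervalIntegral.integral_congr_ae
    filter_upwards [hf.1.ae_hasDerivAt_integral, hg.1.ae_hasDerivAt_integral] with x hx1 hx2 hx
    have hxab : x ∈ uIcc a b := hm (uIoc_subset_uIcc hx)
    have e1 : deriv F x = f' x := ((hx1 hxab a left_mem_uIcc).const_add (f a)).deriv
    have e2 : deriv G x = g' x := ((hx2 hxab a left_mem_uIcc).const_add (g a)).deriv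
    rw [uIcc_of_le hab] at hxab
    rw [e1, e2, hFf x hxab, hGg x hxab]
  rw [this, key]; ring

end IsPrimitiveOn

/-! ### Test functions and the lemma of du Bois-Reymond -/

/-- Smooth functions supported in a compact subinterval of `(a, b)`. -/
def IsBump (a b : ℝ) (χ : ℝ → ℝ) : Prop :=
  ContDiff ℝ ((⊤ : ℕ∞) : WithTop ℕ∞) χ ∧ ∃ c d, a < c ∧ d < b ∧ ∀ t, χ t ≠ 0 → t ∈ Icc c d

theorem exists_Icc_of_isCompact_subset_Ioo {a b : ℝ} {K : Set ℝ} (hK : IsCompact K)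
    (hKs : K ⊆ Ioo a b) : ∃ c d, a < c ∧ d < b ∧ K ⊆ Icc c d := by
  rcases K.eq_empty_or_nonempty with rfl | hne
  · exact ⟨a + 1, b - 1, by linarith, by linarith, empty_subset _⟩
  · exact ⟨sInf K, sSup K, (hKs (hK.sInf_mem hne)).1, (hKs (hK.sSup_mem hne)).2,
      fun t ht => ⟨csInf_le hK.bddBelow ht, le_csSup hK.bddAbove ht⟩⟩

theorem IsBump.of_tsupport {a b : ℝ} {χ : ℝ → ℝ} (h : ContDiff ℝ ((⊤ : ℕ∞) : WithTop ℕ∞) χ)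
    (hc : HasCompactSupport χ) (hs : tsupport χ ⊆ Ioo a b) : IsBump a b χ := by
  obtain ⟨c, d, hac, hdb, hcd⟩ := exists_Icc_of_isCompact_subset_Ioo hc hs
  exact ⟨h, c, d, hac, hdb, fun t ht => hcd (subset_tsupport _ ht)⟩

theorem IsBump.tsupport_subset {a b : ℝ} {χ : ℝ → ℝ} (h : IsBump a b χ) :
    HasCompactSupport χ ∧ tsupport χ ⊆ Ioo a b := by
  obtain ⟨-, c, d, hac, hdb, hcd⟩ := h
  have : tsupport χ ⊆ Icc c d := closure_minimal (fun t ht => hcd t ht) isClosed_Icc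
  exact ⟨isCompact_Icc.of_isClosed_subset (isClosed_tsupport _) this,
    this.trans (Icc_subset_Ioo hac hdb)⟩

theorem MeasureTheory.LocallyIntegrableOn.integrable_bump_mul {a b : ℝ} {N η : ℝ → ℝ}
    (hN : LocallyIntegrableOn N (Ioo a b)) (hc : Continuous η) (h1 : HasCompactSupport η)
    (h2 : tsupport η ⊆ Ioo a b) : Integrable (fun t => η t * N t) := by
  have h3 : IntegrableOn N (tsupport η) := hN.integrableOn_compact_subset h2 h1
  have h4 : IntegrableOn (fun t => η t * N t) (tsupport η) :=
    h3.continuousOn_mul hc.continuousOn h1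
  refine (integrableOn_iff_integrable_of_support_subset ?_).1 h4
  intro t ht
  exact subset_tsupport _ (left_ne_zero_of_mul ht)

/-- The lemma of du Bois-Reymond. -/
theorem ae_eq_const_of_integral_deriv_mul_eq_zero {a b : ℝ} (hab : a < b) {N : ℝ → ℝ}
    (hN : LocallyIntegrableOn N (Ioo a b))
    (h : ∀ χ, IsBump a b χ → ∫ t, deriv χ t * N t = 0) :
    ∃ k, ∀ᵐ t, t ∈ Ioo a b → N t = k := by
  set c : ℝ := (a + b) / 2 with hc
  let β : ContDiffBump c := ⟨(b - a) / 8, (b - a) / 4, by linarith, by linarith⟩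
  set χ₀ : ℝ → ℝ := β.normed volume with hχ₀
  have hχ₀s : ContDiff ℝ ((⊤ : ℕ∞) : WithTop ℕ∞) χ₀ := β.contDiff_normed
  have hχ₀c : HasCompactSupport χ₀ := β.hasCompactSupport_normed
  have hχ₀i : ∫ t, χ₀ t = 1 := β.integral_normed
  have hχ₀t : tsupport χ₀ ⊆ Ioo a b := by
    rw [hχ₀, β.tsupport_normed_eq, Real.closedBall_eq_Icc]
    exact Icc_subset_Ioo (by simp only [hc, β]; linarith) (by simp only [hc, β]; linarith)
  set k : ℝ := ∫ t, χ₀ t * N t with hk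
  refine ⟨k, ?_⟩
  have := isOpen_Ioo.ae_eq_zero_of_integral_contDiff_smul_eq_zero (f := fun t => N t - k)
    (μ := volume) (U := Ioo a b) (hN.sub (locallyIntegrableOn_const k)) ?_
  · filter_upwards [this] with t ht hmem
    linarith [ht hmem]
  intro η hη hηc hηt
  set J : ℝ := ∫ t, η t with hJ
  -- Subtracting a multiple of the normalized bump `χ₀` makes the integral vanish. The primitive `χ`
  -- of `θ` is then again compactly supported, and the hypothesis on derivatives applies to it.
  set θ : ℝ → ℝ := fun t => η t - J * χ₀ t with hθ
  have hθs : ContDiff ℝ ((⊤ : ℕ∞) : WithTop ℕ∞) θ := hη.sub (contDiff_const.mul hχ₀s)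
  have hηi : Integrable η := hη.continuous.integrable_of_hasCompactSupport hηc
  have hχ₀i' : Integrable χ₀ := hχ₀s.continuous.integrable_of_hasCompactSupport hχ₀c
  have hθi : Integrable θ := hηi.sub (hχ₀i'.const_mul J)
  have hθ0 : ∫ t, θ t = 0 := by
    rw [hθ, integral_sub hηi (hχ₀i'.const_mul J), integral_const_mul, hχ₀i]; simp [hJ]
  obtain ⟨u, v, hau, hvb, huv⟩ := exists_Icc_of_isCompact_subset_Ioo (hηc.isCompact.union hχ₀c.isCompact)
    (union_subset hηt hχ₀t)
  have hθz : ∀ t, t ∉ Icc u v → θ t = 0 := by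
    intro t ht
    have h1 : η t = 0 := image_eq_zero_of_notMem_tsupport fun h => ht (huv (Or.inl h))
    have h2 : χ₀ t = 0 := image_eq_zero_of_notMem_tsupport fun h => ht (huv (Or.inr h))
    simp [hθ, h1, h2]
  set χ : ℝ → ℝ := fun t => ∫ s in u..t, θ s with hχ
  have hder : ∀ t, HasDerivAt χ (θ t) t := fun t =>
    intervalIntegral.integral_hasDerivAt_right (hθs.continuous.intervalIntegrable _ _)
      (hθs.continuous.stronglyMeasurableAtFilter _ _) hθs.continuous.continuousAt
  have hderiv : deriv χ = θ := funext fun t => (hder t).deriv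
  have hχs : ContDiff ℝ ((⊤ : ℕ∞) : WithTop ℕ∞) χ :=
    contDiff_infty_iff_deriv.2 ⟨fun t => (hder t).differentiableAt, by rw [hderiv]; exact hθs⟩
  have hχsupp : ∀ t, χ t ≠ 0 → t ∈ Icc u v := by
    intro t ht
    by_contra hmem
    apply ht
    rcases lt_or_ge t u with h1 | h1
    · simp only [hχ]
      rw [intervalIntegral.integral_symm, intervalIntegral.integral_of_le h1.le, neg_eq_zero,
        integral_Ioc_eq_integral_Ioo]
      exact setIntegral_eq_zero_of_forall_eq_zero fun s hs =>
        hθz s fun h => absurd h.1 (not_le.2 hs.2)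
    · have h2 : v < t := by
        by_contra h3; exact hmem ⟨h1, not_lt.1 h3⟩
      simp only [hχ]
      rw [intervalIntegral.integral_of_le h1, ← integral_Icc_eq_integral_Ioc,
        setIntegral_eq_integral_of_forall_compl_eq_zero, hθ0]
      intro s hs
      exact hθz s fun h => hs ⟨h.1, h.2.trans h2.le⟩
  have hz := h χ ⟨hχs, u, v, hau, hvb, hχsupp⟩
  rw [hderiv] at hz
  have i1 := hN.integrable_bump_mul hη.continuous hηc hηt
  have i2 := hN.integrable_bump_mul hχ₀s.continuous hχ₀c hχ₀t
  have e1 : ∫ t, θ t * N t = (∫ t, η t * N t) - J * k := by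
    rw [hk, ← integral_const_mul, ← integral_sub i1 (i2.const_mul J)]
    congr 1; ext t; simp only [hθ]; ring
  have e2 : ∫ t, η t • (N t - k) = (∫ t, η t * N t) - J * k := by
    rw [hJ, ← integral_mul_const, ← integral_sub i1 (hηi.mul_const k)]
    congr 1; ext t; simp only [smul_eq_mul]; ring
  rw [e2, ← e1, hz]

/-! ### Fourier series on the circle and Wirtinger's inequality -/

/-- The real trigonometric system `cos (n φ)`, `sin (n φ)`, `n ∈ ℤ`. -/
noncomputable def trig (j : Bool × ℤ) (φ : ℝ) : ℝ :=
  if j.1 then Real.cos (j.2 * φ) else Real.sin (j.2 * φ)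

/-- The derivatives of the functions `trig j`. -/
noncomputable def trig' (j : Bool × ℤ) (φ : ℝ) : ℝ :=
  if j.1 then -(j.2 * Real.sin (j.2 * φ)) else j.2 * Real.cos (j.2 * φ)

theorem hasDerivAt_trig (j : Bool × ℤ) (φ : ℝ) : HasDerivAt (trig j) (trig' j φ) φ := by
  obtain ⟨b, n⟩ := j
  have h : HasDerivAt (fun φ : ℝ => (n : ℝ) * φ) n φ := by
    simpa using (hasDerivAt_id φ).const_mul (n : ℝ)
  cases b
  · have h1 : trig (false, n) = fun φ => Real.sin (n * φ) := by ext; simp [trig]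
    rw [h1]
    convert h.sin using 1
    simp [trig', mul_comm]
  · have h1 : trig (true, n) = fun φ => Real.cos (n * φ) := by ext; simp [trig]
    rw [h1]
    convert h.cos using 1
    simp [trig', mul_comm]

theorem contDiff_trig (j : Bool × ℤ) {N : WithTop ℕ∞} : ContDiff ℝ N (trig j) := by
  obtain ⟨b, n⟩ := j
  cases b
  · have h1 : trig (false, n) = fun φ => Real.sin (n * φ) := by ext; simp [trig]
    rw [h1]; fun_prop
  · have h1 : trig (true, n) = fun φ => Real.cos (n * φ) := by ext; simp [trig]
    rw [h1]; fun_prop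

theorem continuous_trig (j : Bool × ℤ) : Continuous (trig j) := (contDiff_trig j (N := 0)).continuous

theorem continuous_trig' (j : Bool × ℤ) : Continuous (trig' j) := by
  obtain ⟨b, n⟩ := j
  cases b
  · have h1 : trig' (false, n) = fun φ => n * Real.cos (n * φ) := by ext; simp [trig']
    rw [h1]; fun_prop
  · have h1 : trig' (true, n) = fun φ => -(n * Real.sin (n * φ)) := by ext; simp [trig']
    rw [h1]; fun_prop

theorem trig_add_two_pi (j : Bool × ℤ) (φ : ℝ) : trig j (φ + 2 * Real.pi) = trig j φ := by
  have h : (j.2 : ℝ) * (φ + 2 * Real.pi) = j.2 * φ + j.2 * (2 * Real.pi) := by ring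
  unfold trig
  split
  · rw [h, Real.cos_add_int_mul_two_pi]
  · rw [h, Real.sin_add_int_mul_two_pi]

theorem intervalIntegrable_of_memLp_two {f : ℝ → ℝ} {a b : ℝ} (hab : a ≤ b)
    (hf : MemLp f 2 (volume.restrict (Ioc a b))) : IntervalIntegrable f volume a b := by
  rw [intervalIntegrable_iff_integrableOn_Ioc_of_le hab]
  exact hf.integrable (by norm_num)

/-- For real `f` the complex coefficient is (C - iS)/(2π) with the cosine and sine integrals C and
S. This translates Parseval's identity into `hasSum_trig_coeff_sq`. -/
theorem norm_sq_fourierCoeffOn_ofReal {f : ℝ → ℝ}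
    (hf : IntervalIntegrable f volume 0 (2 * Real.pi)) (n : ℤ) :
    ‖fourierCoeffOn Real.two_pi_pos (fun x => (f x : ℂ)) n‖ ^ 2 =
      (2 * Real.pi)⁻¹ ^ 2 * ((∫ φ in (0 : ℝ)..(2 * Real.pi), trig (true, n) φ * f φ) ^ 2 +
        (∫ φ in (0 : ℝ)..(2 * Real.pi), trig (false, n) φ * f φ) ^ 2) := by
  set C := ∫ φ in (0 : ℝ)..(2 * Real.pi), trig (true, n) φ * f φ with hC
  set S := ∫ φ in (0 : ℝ)..(2 * Real.pi), trig (false, n) φ * f φ with hS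
  have i1 : IntervalIntegrable (fun φ => trig (true, n) φ * f φ) volume 0 (2 * Real.pi) :=
    hf.continuousOn_mul (continuous_trig _).continuousOn
  have i2 : IntervalIntegrable (fun φ => trig (false, n) φ * f φ) volume 0 (2 * Real.pi) :=
    hf.continuousOn_mul (continuous_trig _).continuousOn
  have i1' : IntervalIntegrable (fun φ => ((trig (true, n) φ * f φ : ℝ) : ℂ)) volume
      0 (2 * Real.pi) := ⟨i1.1.ofReal, i1.2.ofReal⟩
  have i2' : IntervalIntegrable (fun φ => ((trig (false, n) φ * f φ : ℝ) : ℂ)) volume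
      0 (2 * Real.pi) := ⟨i2.1.ofReal, i2.2.ofReal⟩
  have key : ∫ x in (0 : ℝ)..(2 * Real.pi),
      fourier (-n) (x : AddCircle (2 * Real.pi - 0)) • (f x : ℂ) = (C : ℂ) - S * Complex.I := by
    rw [hC, hS, ← intervalIntegral.integral_ofReal, ← intervalIntegral.integral_ofReal,
      ← intervalIntegral.integral_mul_const, ← intervalIntegral.integral_sub i1' (i2'.mul_const _)]
    congr 1
    ext x
    rw [fourier_coe_apply]
    have : 2 * (Real.pi : ℂ) * Complex.I * ((-n : ℤ) : ℂ) * (x : ℂ) / ((2 * Real.pi - 0 : ℝ) : ℂ)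
        = -((n : ℂ) * x) * Complex.I := by
      have hpi : (Real.pi : ℂ) ≠ 0 := by exact_mod_cast Real.pi_ne_zero
      push_cast
      field_simp
      ring
    rw [this, Complex.exp_mul_I]
    simp only [Complex.cos_neg, Complex.sin_neg, smul_eq_mul, trig, if_true, Bool.false_eq_true,
      if_false]
    push_cast
    ring
  rw [fourierCoeffOn_eq_integral, key, norm_smul, mul_pow]
  have e1 : ‖(C : ℂ) - S * Complex.I‖ ^ 2 = C ^ 2 + S ^ 2 := by
    rw [← Complex.normSq_eq_norm_sq, Complex.normSq_apply]
    simp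
    ring
  rw [e1]
  congr 1
  rw [sub_zero, one_div, Real.norm_eq_abs, sq_abs]

theorem hasSum_trig_coeff_sq {f : ℝ → ℝ} (hf : MemLp f 2 (volume.restrict (Ioc 0 (2 * Real.pi)))) :
    HasSum (fun n : ℤ =>
      (2 * Real.pi)⁻¹ ^ 2 * ((∫ φ in (0 : ℝ)..(2 * Real.pi), trig (true, n) φ * f φ) ^ 2 +
        (∫ φ in (0 : ℝ)..(2 * Real.pi), trig (false, n) φ * f φ) ^ 2))
      ((2 * Real.pi)⁻¹ * ∫ φ in (0 : ℝ)..(2 * Real.pi), f φ ^ 2) := by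
  have h := hasSum_sq_fourierCoeffOn Real.two_pi_pos (f := fun x => (f x : ℂ)) hf.ofReal
  simp only [norm_sq_fourierCoeffOn_ofReal
    (intervalIntegrable_of_memLp_two Real.two_pi_pos.le hf)] at h
  simpa using h

theorem ae_eq_zero_of_trig_coeff_eq_zero_of_memLp {f : ℝ → ℝ}
    (hf : MemLp f 2 (volume.restrict (Ioc 0 (2 * Real.pi))))
    (h : ∀ j, ∫ φ in (0 : ℝ)..(2 * Real.pi), trig j φ * f φ = 0) :
    f =ᵐ[volume.restrict (Ioc 0 (2 * Real.pi))] 0 := by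
  have h1 := hasSum_trig_coeff_sq hf
  simp only [h] at h1
  have h2 : (2 * Real.pi)⁻¹ * ∫ φ in (0 : ℝ)..(2 * Real.pi), f φ ^ 2 = 0 := by
    simpa using h1.tsum_eq.symm
  have h3 : ∫ φ in (0 : ℝ)..(2 * Real.pi), f φ ^ 2 = 0 := by
    rcases mul_eq_zero.1 h2 with h | h
    · exact absurd h (inv_ne_zero Real.two_pi_pos.ne')
    · exact h
  rw [intervalIntegral.integral_of_le Real.two_pi_pos.le,
    integral_eq_zero_iff_of_nonneg (fun _ => sq_nonneg _) hf.integrable_sq] at h3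
  filter_upwards [h3] with x hx
  simpa using hx

/-- An integrable function on the circle all of whose Fourier coefficients vanish is zero. -/
theorem ae_eq_zero_of_trig_coeff_eq_zero {f : ℝ → ℝ}
    (hf : IntervalIntegrable f volume 0 (2 * Real.pi))
    (h : ∀ j, ∫ φ in (0 : ℝ)..(2 * Real.pi), trig j φ * f φ = 0) :
    f =ᵐ[volume.restrict (Ioc 0 (2 * Real.pi))] 0 := by
  have hpos := Real.two_pi_pos
  -- `f` is only integrable, but its primitive `F` is continuous, hence square-integrable. The
  -- vanishing mean of `f` makes `F` periodic, and integration by parts then kills every nonzero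
  -- mode of `F`; subtracting the mean `A` kills the zero mode. By Parseval's identity `F` is
  -- constant, and so its almost-everywhere derivative `f` is zero.
  set F : ℝ → ℝ := fun t => ∫ s in (0 : ℝ)..t, f s with hF
  have hFp : IsPrimitiveOn F f 0 (2 * Real.pi) := ⟨hf, fun t _ => by simp [hF]⟩
  have hF1 : F (2 * Real.pi) = 0 := by simpa [hF, trig] using h (true, 0)
  have hF0 : F 0 = 0 := by simp [hF]
  set A : ℝ := (2 * Real.pi)⁻¹ * ∫ s in (0 : ℝ)..(2 * Real.pi), F s with hA
  have hFc : ContinuousOn F (Icc 0 (2 * Real.pi)) := hFp.continuousOn hpos.le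
  have hFi : IntervalIntegrable F volume 0 (2 * Real.pi) :=
    ContinuousOn.intervalIntegrable (by rwa [uIcc_of_le hpos.le])
  have hGp : IsPrimitiveOn (fun t => F t - A) f 0 (2 * Real.pi) :=
    ⟨hf, fun t _ => by simp [hF]; ring⟩
  have hGc : ContinuousOn (fun t => F t - A) (Icc 0 (2 * Real.pi)) := hFc.sub continuousOn_const
  have hGi : IntervalIntegrable (fun t => F t - A) volume 0 (2 * Real.pi) :=
    ContinuousOn.intervalIntegrable (by rwa [uIcc_of_le hpos.le])
  have hder : ∀ j, ∫ φ in (0 : ℝ)..(2 * Real.pi), trig' j φ * (F φ - A) = 0 := by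
    intro j
    have hT : IsPrimitiveOn (trig j) (trig' j) 0 (2 * Real.pi) :=
      IsPrimitiveOn.of_hasDerivAt hpos.le (continuous_trig j).continuousOn
        (fun t _ => hasDerivAt_trig j t) ((continuous_trig' j).intervalIntegrable _ _)
    have h1 := (hT.mul hpos.le hGp).integral_eq hpos.le
    have h2 : trig j (2 * Real.pi) = trig j 0 := by simpa using trig_add_two_pi j 0
    rw [h2, hF1, hF0, sub_self, intervalIntegral.integral_add
      (hGi.continuousOn_mul (continuous_trig' j).continuousOn)
      (hf.continuousOn_mul (continuous_trig j).continuousOn), h j, add_zero] at h1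
    exact h1
  have hG0 : (fun t => F t - A) =ᵐ[volume.restrict (Ioc 0 (2 * Real.pi))] 0 := by
    apply ae_eq_zero_of_trig_coeff_eq_zero_of_memLp
    · have : MemLp (fun t => F t - A) 2 (volume.restrict (Icc 0 (2 * Real.pi))) := by
        obtain ⟨C, hC⟩ := isCompact_Icc.exists_bound_of_continuousOn hGc
        exact MemLp.of_bound (hGc.aestronglyMeasurable measurableSet_Icc) C
          ((ae_restrict_iff' measurableSet_Icc).2 (Filter.Eventually.of_forall hC))
      exact this.mono_measure (Measure.restrict_mono Ioc_subset_Icc_self le_rfl)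
    · rintro ⟨b, n⟩
      by_cases hn : n = 0
      · subst hn
        cases b
        · simp [trig]
        · simp only [trig, if_true, Int.cast_zero, zero_mul, Real.cos_zero, one_mul]
          rw [intervalIntegral.integral_sub hFi (by simp)]
          simp [hA]
          field_simp
          ring
      · have hn' : (n : ℝ) ≠ 0 := by exact_mod_cast hn
        cases b
        · have := hder (true, n)
          simp only [trig', if_true] at this
          have e : ∀ φ, -((n : ℝ) * Real.sin (n * φ)) * (F φ - A) =
            -(n : ℝ) * (Real.sin (n * φ) * (F φ - A)) := fun φ => by ring
          simp only [e, intervalIntegral.integral_const_mul] at this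
          simpa [trig, hn'] using this
        · have := hder (false, n)
          simp only [trig', Bool.false_eq_true, if_false] at this
          have e : ∀ φ, ((n : ℝ) * Real.cos (n * φ)) * (F φ - A) =
            (n : ℝ) * (Real.cos (n * φ) * (F φ - A)) := fun φ => by ring
          simp only [e, intervalIntegral.integral_const_mul] at this
          simpa [trig, hn'] using this
  have hFconst : ∀ t ∈ Ioo 0 (2 * Real.pi), F t = A := by
    have h1 : (fun t => F t - A) =ᵐ[volume.restrict (Ioo 0 (2 * Real.pi))] fun _ => 0 :=
      ae_restrict_of_ae_restrict_of_subset Ioo_subset_Ioc_self hG0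
    have h2 := Measure.eqOn_open_of_ae_eq h1 isOpen_Ioo (hGc.mono Ioo_subset_Icc_self)
      continuousOn_const
    intro t ht
    have := h2 ht
    simp only at this
    linarith
  rw [← restrict_Ioo_eq_restrict_Ioc]
  refine (ae_restrict_iff' measurableSet_Ioo).2 ?_
  filter_upwards [hf.ae_hasDerivAt_integral] with x hx hx'
  have h1 : HasDerivAt F (f x) x := by
    refine hx ?_ 0 left_mem_uIcc
    rw [uIcc_of_le hpos.le]; exact Ioo_subset_Icc_self hx'
  have h2 : HasDerivAt F 0 x :=
    (hasDerivAt_const x A).congr_of_eventuallyEq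
      (Filter.eventually_of_mem (isOpen_Ioo.mem_nhds hx') hFconst)
  exact h1.unique h2

/-- `p` is the weak derivative of the `2π`-periodic function `f`. -/
def IsPeriodicWeakDeriv (f p : ℝ → ℝ) : Prop :=
  ∀ j, ∫ φ in (0 : ℝ)..(2 * Real.pi), trig' j φ * f φ =
    -∫ φ in (0 : ℝ)..(2 * Real.pi), trig j φ * p φ

theorem IsPeriodicWeakDeriv.coeff_relations {f p : ℝ → ℝ} (h : IsPeriodicWeakDeriv f p) (n : ℤ) :
    (n : ℝ) * (∫ φ in (0 : ℝ)..(2 * Real.pi), trig (false, n) φ * f φ) =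
      (∫ φ in (0 : ℝ)..(2 * Real.pi), trig (true, n) φ * p φ) ∧
    (n : ℝ) * (∫ φ in (0 : ℝ)..(2 * Real.pi), trig (true, n) φ * f φ) =
      -(∫ φ in (0 : ℝ)..(2 * Real.pi), trig (false, n) φ * p φ) := by
  constructor
  · have h1 := h (true, n)
    have e : ∀ φ, trig' (true, n) φ * f φ = -(n : ℝ) * (trig (false, n) φ * f φ) := fun φ => by
      simp [trig', trig]; ring
    simp only [e, intervalIntegral.integral_const_mul] at h1
    linarith
  · have h1 := h (false, n)
    have e : ∀ φ, trig' (false, n) φ * f φ = (n : ℝ) * (trig (true, n) φ * f φ) := fun φ => by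
      simp [trig', trig]; ring
    simp only [e, intervalIntegral.integral_const_mul] at h1
    linarith

/-- Differentiation multiplies the size of the mode `n` by |n|, so Parseval's identity writes the
deficit in Wirtinger's inequality as a weighted sum. The weight is n² - 1 for n ≠ 0, and the mean
term compensates the -1 at n = 0. All weights are nonnegative and vanish exactly for |n| ≤ 1, which
gives both the inequality and its equality case. -/
theorem IsPeriodicWeakDeriv.hasSum_deficit {f p : ℝ → ℝ}
    (hf : MemLp f 2 (volume.restrict (Ioc 0 (2 * Real.pi))))
    (hp : MemLp p 2 (volume.restrict (Ioc 0 (2 * Real.pi)))) (h : IsPeriodicWeakDeriv f p) :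
    HasSum (fun n : ℤ => ((n : ℝ) ^ 2 - 1 + if n = 0 then 1 else 0) * ((2 * Real.pi)⁻¹ ^ 2 *
        ((∫ φ in (0 : ℝ)..(2 * Real.pi), trig (true, n) φ * f φ) ^ 2 +
        (∫ φ in (0 : ℝ)..(2 * Real.pi), trig (false, n) φ * f φ) ^ 2)))
      ((2 * Real.pi)⁻¹ * ((∫ φ in (0 : ℝ)..(2 * Real.pi), p φ ^ 2) +
        (2 * Real.pi)⁻¹ * (∫ φ in (0 : ℝ)..(2 * Real.pi), f φ) ^ 2 -
        ∫ φ in (0 : ℝ)..(2 * Real.pi), f φ ^ 2)) := by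
  have h1 := hasSum_trig_coeff_sq hf
  have h2 := hasSum_trig_coeff_sq hp
  have h3 : HasSum (fun n : ℤ => if n = 0 then (2 * Real.pi)⁻¹ ^ 2 *
      (∫ φ in (0 : ℝ)..(2 * Real.pi), f φ) ^ 2 else 0) ((2 * Real.pi)⁻¹ ^ 2 *
      (∫ φ in (0 : ℝ)..(2 * Real.pi), f φ) ^ 2) := hasSum_ite_eq _ _
  have h4 := (h2.add h3).sub h1
  refine (congrArg₂ (fun u v => HasSum u v) (funext fun n => ?_) ?_).mp h4
  · obtain ⟨r1, r2⟩ := h.coeff_relations n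
    rw [← r1, ← neg_eq_iff_eq_neg.2 r2]
    split_ifs with hn
    · subst hn
      simp [trig]
    · ring
  · ring

/-- Wirtinger's inequality. -/
theorem IsPeriodicWeakDeriv.integral_sq_le {f p : ℝ → ℝ}
    (hf : MemLp f 2 (volume.restrict (Ioc 0 (2 * Real.pi))))
    (hp : MemLp p 2 (volume.restrict (Ioc 0 (2 * Real.pi)))) (h : IsPeriodicWeakDeriv f p) :
    ∫ φ in (0 : ℝ)..(2 * Real.pi), f φ ^ 2 ≤ (∫ φ in (0 : ℝ)..(2 * Real.pi), p φ ^ 2) +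
        (2 * Real.pi)⁻¹ * (∫ φ in (0 : ℝ)..(2 * Real.pi), f φ) ^ 2 := by
  have h1 := (h.hasSum_deficit hf hp).nonneg fun n => by
    refine mul_nonneg ?_ (by positivity)
    split_ifs with hn
    · simp [hn]
    · have : (1 : ℝ) ≤ (n : ℝ) ^ 2 := by
        have : (1 : ℤ) ≤ n ^ 2 := by
          have := sq_pos_of_ne_zero (a := n) hn
          omega
        exact_mod_cast this
      linarith
  have h2 := nonneg_of_mul_nonneg_right h1 (inv_pos.2 Real.two_pi_pos)
  linarith

/-- A vanishing sum of nonnegative terms has vanishing terms, and the weight n² - 1 is positive for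
|n| ≥ 2. -/
theorem IsPeriodicWeakDeriv.coeff_eq_zero {f p : ℝ → ℝ}
    (hf : MemLp f 2 (volume.restrict (Ioc 0 (2 * Real.pi))))
    (hp : MemLp p 2 (volume.restrict (Ioc 0 (2 * Real.pi)))) (h : IsPeriodicWeakDeriv f p)
    (heq : ∫ φ in (0 : ℝ)..(2 * Real.pi), f φ ^ 2 = (∫ φ in (0 : ℝ)..(2 * Real.pi), p φ ^ 2) +
        (2 * Real.pi)⁻¹ * (∫ φ in (0 : ℝ)..(2 * Real.pi), f φ) ^ 2) {b : Bool} {n : ℤ}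
    (hn0 : n ≠ 0) (hn1 : n ≠ 1) (hn2 : n ≠ -1) :
    ∫ φ in (0 : ℝ)..(2 * Real.pi), trig (b, n) φ * f φ = 0 := by
  have h0 := h.hasSum_deficit hf hp
  rw [heq, sub_self, mul_zero, hasSum_zero_iff_of_nonneg] at h0
  · have h1 := congrFun h0 n
    simp only [hn0, if_false, add_zero, Pi.zero_apply] at h1
    have h2 : (1 : ℝ) < (n : ℝ) ^ 2 := by
      have : (1 : ℤ) < n ^ 2 := by
        rcases lt_or_gt_of_ne hn0 with h | h
        · have : n ≤ -2 := by omega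
          nlinarith
        · have : 2 ≤ n := by omega
          nlinarith
      exact_mod_cast this
    have h3 : (2 * Real.pi)⁻¹ ^ 2 ≠ 0 := pow_ne_zero _ (inv_ne_zero Real.two_pi_pos.ne')
    have h4 := (mul_eq_zero.1 h1).resolve_left (by linarith)
    have h5 := (mul_eq_zero.1 h4).resolve_left h3
    cases b
    · nlinarith [sq_nonneg (∫ φ in (0 : ℝ)..(2 * Real.pi), trig (true, n) φ * f φ)]
    · nlinarith [sq_nonneg (∫ φ in (0 : ℝ)..(2 * Real.pi), trig (false, n) φ * f φ)]
  · intro n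
    refine mul_nonneg ?_ (by positivity)
    split_ifs with hn
    · simp [hn]
    · have : (1 : ℝ) ≤ (n : ℝ) ^ 2 := by
        have : (1 : ℤ) ≤ n ^ 2 := by
          have := sq_pos_of_ne_zero (a := n) hn
          omega
        exact_mod_cast this
      linarith

theorem memLp_two_of_continuous {f : ℝ → ℝ} (hf : Continuous f) :
    MemLp f 2 (volume.restrict (Ioc 0 (2 * Real.pi))) := by
  obtain ⟨C, hC⟩ := isCompact_Icc.exists_bound_of_continuousOn
    (hf.continuousOn (s := Icc 0 (2 * Real.pi)))
  exact MemLp.of_bound hf.aestronglyMeasurable C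
    ((ae_restrict_iff' measurableSet_Ioc).2
      (Filter.Eventually.of_forall fun x hx => hC x (Ioc_subset_Icc_self hx)))

theorem isPeriodicWeakDeriv_of_hasDerivAt {f p : ℝ → ℝ} (hp : Continuous p)
    (h : ∀ t, HasDerivAt f (p t) t) (hper : f (2 * Real.pi) = f 0) : IsPeriodicWeakDeriv f p := by
  intro j
  have hc : Continuous f := continuous_iff_continuousAt.2 fun t => (h t).continuousAt
  have hT : IsPrimitiveOn (trig j) (trig' j) 0 (2 * Real.pi) :=
    IsPrimitiveOn.of_hasDerivAt Real.two_pi_pos.le (continuous_trig j).continuousOn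
      (fun t _ => hasDerivAt_trig j t) ((continuous_trig' j).intervalIntegrable _ _)
  have hF : IsPrimitiveOn f p 0 (2 * Real.pi) :=
    IsPrimitiveOn.of_hasDerivAt Real.two_pi_pos.le hc.continuousOn
      (fun t _ => h t) (hp.intervalIntegrable _ _)
  have h1 := (hT.mul Real.two_pi_pos.le hF).integral_eq Real.two_pi_pos.le
  have h2 : trig j (2 * Real.pi) = trig j 0 := by simpa using trig_add_two_pi j 0
  rw [h2, hper, sub_self, intervalIntegral.integral_add
    (f := fun s => trig' j s * f s) (g := fun s => trig j s * p s)
    (((continuous_trig' j).mul hc).intervalIntegrable _ _)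
    (((continuous_trig j).mul hp).intervalIntegrable _ _)] at h1
  linarith

theorem integral_cos_sq_two_pi : ∫ φ in (0 : ℝ)..(2 * Real.pi), Real.cos φ ^ 2 = Real.pi := by
  rw [integral_cos_sq]; simp

theorem integral_sin_sq_two_pi : ∫ φ in (0 : ℝ)..(2 * Real.pi), Real.sin φ ^ 2 = Real.pi := by
  rw [integral_sin_sq]; simp

theorem integral_cos_mul_sin_two_pi :
    ∫ φ in (0 : ℝ)..(2 * Real.pi), Real.cos φ * Real.sin φ = 0 := by
  simp_rw [mul_comm (Real.cos _)]
  rw [integral_sin_mul_cos₁]; simp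

/-- Orthogonality of the higher modes to 1, cos and sin needs no product formulas: these three
functions are extremal in Wirtinger's inequality, so `coeff_eq_zero` applies to them. -/
theorem trig_coeff_one {b : Bool} {n : ℤ} (hn0 : n ≠ 0) (hn1 : n ≠ 1) (hn2 : n ≠ -1) :
    ∫ φ in (0 : ℝ)..(2 * Real.pi), trig (b, n) φ = 0 := by
  have h := (isPeriodicWeakDeriv_of_hasDerivAt (f := fun _ => 1) (p := fun _ => 0)
    continuous_const (fun t => hasDerivAt_const t _) rfl).coeff_eq_zero
    (memLp_two_of_continuous continuous_const) (memLp_two_of_continuous continuous_const)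
    (by simp; field_simp) (b := b) hn0 hn1 hn2
  simpa using h

theorem trig_coeff_cos {b : Bool} {n : ℤ} (hn0 : n ≠ 0) (hn1 : n ≠ 1) (hn2 : n ≠ -1) :
    ∫ φ in (0 : ℝ)..(2 * Real.pi), trig (b, n) φ * Real.cos φ = 0 := by
  refine (isPeriodicWeakDeriv_of_hasDerivAt (f := Real.cos) (p := fun t => - Real.sin t)
    Real.continuous_sin.neg Real.hasDerivAt_cos (by simp)).coeff_eq_zero
    (memLp_two_of_continuous Real.continuous_cos)
    (memLp_two_of_continuous Real.continuous_sin.neg) ?_ (b := b) hn0 hn1 hn2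
  have e : ∀ φ, (-Real.sin) φ ^ 2 = Real.sin φ ^ 2 := fun φ => neg_sq _
  rw [intervalIntegral.integral_congr (g := fun φ => Real.sin φ ^ 2) fun φ _ => e φ,
    integral_cos_sq_two_pi, integral_sin_sq_two_pi]; simp

theorem trig_coeff_sin {b : Bool} {n : ℤ} (hn0 : n ≠ 0) (hn1 : n ≠ 1) (hn2 : n ≠ -1) :
    ∫ φ in (0 : ℝ)..(2 * Real.pi), trig (b, n) φ * Real.sin φ = 0 := by
  refine (isPeriodicWeakDeriv_of_hasDerivAt (f := Real.sin) (p := Real.cos)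
    Real.continuous_cos Real.hasDerivAt_sin (by simp)).coeff_eq_zero
    (memLp_two_of_continuous Real.continuous_sin)
    (memLp_two_of_continuous Real.continuous_cos) ?_ (b := b) hn0 hn1 hn2
  rw [integral_cos_sq_two_pi, integral_sin_sq_two_pi]; simp

/-- A function on the circle without Fourier modes of order at least two. -/
theorem ae_eq_of_high_trig_coeff_eq_zero {f : ℝ → ℝ}
    (hf : IntervalIntegrable f volume 0 (2 * Real.pi))
    (h : ∀ (b : Bool) (n : ℤ), n ≠ 0 → n ≠ 1 → n ≠ -1 →
      ∫ φ in (0 : ℝ)..(2 * Real.pi), trig (b, n) φ * f φ = 0) :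
    ∀ᵐ φ ∂(volume.restrict (Ioc 0 (2 * Real.pi))), f φ =
      (2 * Real.pi)⁻¹ * (∫ s in (0 : ℝ)..(2 * Real.pi), f s) +
      Real.pi⁻¹ * (∫ s in (0 : ℝ)..(2 * Real.pi), Real.cos s * f s) * Real.cos φ +
      Real.pi⁻¹ * (∫ s in (0 : ℝ)..(2 * Real.pi), Real.sin s * f s) * Real.sin φ := by
  have hpi := Real.pi_ne_zero
  set A := (2 * Real.pi)⁻¹ * (∫ s in (0 : ℝ)..(2 * Real.pi), f s) with hA
  set B := Real.pi⁻¹ * (∫ s in (0 : ℝ)..(2 * Real.pi), Real.cos s * f s) with hB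
  set C := Real.pi⁻¹ * (∫ s in (0 : ℝ)..(2 * Real.pi), Real.sin s * f s) with hC
  have hA' : ∫ s in (0 : ℝ)..(2 * Real.pi), f s = 2 * Real.pi * A := by rw [hA]; field_simp
  have hB' : ∫ s in (0 : ℝ)..(2 * Real.pi), Real.cos s * f s = Real.pi * B := by
    rw [hB]; field_simp
  have hC' : ∫ s in (0 : ℝ)..(2 * Real.pi), Real.sin s * f s = Real.pi * C := by
    rw [hC]; field_simp
  have hi : ∀ g : ℝ → ℝ, Continuous g → IntervalIntegrable g volume 0 (2 * Real.pi) :=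
    fun g hg => hg.intervalIntegrable _ _
  have hgi : IntervalIntegrable (fun φ => f φ - (A + B * Real.cos φ + C * Real.sin φ)) volume
      0 (2 * Real.pi) := hf.sub (hi _ (by fun_prop))
  have key : ∀ u : ℝ → ℝ, Continuous u → ∫ φ in (0 : ℝ)..(2 * Real.pi),
      u φ * (f φ - (A + B * Real.cos φ + C * Real.sin φ)) =
      (∫ φ in (0 : ℝ)..(2 * Real.pi), u φ * f φ) - A * (∫ φ in (0 : ℝ)..(2 * Real.pi), u φ)
      - B * (∫ φ in (0 : ℝ)..(2 * Real.pi), u φ * Real.cos φ)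
      - C * (∫ φ in (0 : ℝ)..(2 * Real.pi), u φ * Real.sin φ) := by
    intro u hu
    have c1 : Continuous fun φ => u φ * Real.cos φ := by fun_prop
    have c2 : Continuous fun φ => u φ * Real.sin φ := by fun_prop
    rw [← intervalIntegral.integral_const_mul, ← intervalIntegral.integral_const_mul,
      ← intervalIntegral.integral_const_mul,
      ← intervalIntegral.integral_sub (hf.continuousOn_mul hu.continuousOn) (hi _ (by fun_prop)),
      ← intervalIntegral.integral_sub ((hf.continuousOn_mul hu.continuousOn).sub
        (hi _ (by fun_prop))) (hi _ (by fun_prop)),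
      ← intervalIntegral.integral_sub (((hf.continuousOn_mul hu.continuousOn).sub
        (hi _ (by fun_prop))).sub (hi _ (by fun_prop))) (hi _ (by fun_prop))]
    congr 1; ext φ; ring
  have k0 := key (fun _ => 1) continuous_const
  have k1 := key Real.cos Real.continuous_cos
  have k2 := key Real.sin Real.continuous_sin
  simp only [one_mul] at k0
  have e1 : ∀ φ, Real.cos φ * Real.cos φ = Real.cos φ ^ 2 := fun φ => (sq _).symm
  have e2 : ∀ φ, Real.sin φ * Real.sin φ = Real.sin φ ^ 2 := fun φ => (sq _).symm
  have e3 : ∀ φ, Real.sin φ * Real.cos φ = Real.cos φ * Real.sin φ := fun φ => mul_comm _ _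
  simp only [e1, e2, e3, hA', hB', hC', integral_cos_sq_two_pi, integral_sin_sq_two_pi,
    integral_cos_mul_sin_two_pi, integral_cos, integral_sin, Real.sin_two_pi, Real.sin_zero,
    Real.cos_two_pi, Real.cos_zero, sub_self, mul_zero, sub_zero,
    intervalIntegral.integral_const, smul_eq_mul, mul_one] at k0 k1 k2
  -- The modes 0, 1 and -1 of the difference vanish by the choice of `A`, `B`, `C`, the others by
  -- hypothesis and orthogonality.
  have hz := ae_eq_zero_of_trig_coeff_eq_zero hgi ?_
  · filter_upwards [hz] with φ hφ
    have : f φ - (A + B * Real.cos φ + C * Real.sin φ) = 0 := hφ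
    linarith
  rintro ⟨b, n⟩
  by_cases hn0 : n = 0
  · subst hn0
    cases b
    · simp [trig]
    · simp only [trig, if_true, Int.cast_zero, zero_mul, Real.cos_zero, one_mul]
      rw [k0]; ring
  by_cases hn1 : n = 1
  · subst hn1
    cases b
    · simp only [trig, Bool.false_eq_true, if_false, Int.cast_one, one_mul]
      rw [k2]; ring
    · simp only [trig, if_true, Int.cast_one, one_mul]
      rw [k1]; ring
  by_cases hn2 : n = -1
  · subst hn2
    cases b
    · simp only [trig, Bool.false_eq_true, if_false, Int.cast_neg, Int.cast_one, neg_mul, one_mul,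
        Real.sin_neg, intervalIntegral.integral_neg]
      rw [k2]; ring
    · simp only [trig, if_true, Int.cast_neg, Int.cast_one, neg_mul, one_mul, Real.cos_neg]
      rw [k1]; ring
  rw [key _ (continuous_trig _), h b n hn0 hn1 hn2, trig_coeff_one hn0 hn1 hn2,
    trig_coeff_cos hn0 hn1 hn2, trig_coeff_sin hn0 hn1 hn2]
  ring

/-! ### Rotations about the third axis -/

/-- The horizontal part of a vector. -/
noncomputable def horPart : E3 →L[ℝ] E3 :=
  LinearMap.toContinuousLinearMap
    { toFun := fun v => !₂[v 0, v 1, 0]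
      map_add' := fun v w => by ext i; fin_cases i <;> simp
      map_smul' := fun c v => by ext i; fin_cases i <;> simp }

/-- The horizontal part of a vector, turned by a right angle. -/
noncomputable def quarterTurn : E3 →L[ℝ] E3 :=
  LinearMap.toContinuousLinearMap
    { toFun := fun v => !₂[-v 1, v 0, 0]
      map_add' := fun v w => by ext i; fin_cases i <;> simp [add_comm]
      map_smul' := fun c v => by ext i; fin_cases i <;> simp }

/-- The vertical part of a vector. -/
noncomputable def verPart : E3 →L[ℝ] E3 :=
  LinearMap.toContinuousLinearMap
    { toFun := fun v => !₂[0, 0, v 2]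
      map_add' := fun v w => by ext i; fin_cases i <;> simp
      map_smul' := fun c v => by ext i; fin_cases i <;> simp }

@[simp] theorem horPart_apply (v : E3) : horPart v = !₂[v 0, v 1, 0] := rfl
@[simp] theorem quarterTurn_apply (v : E3) : quarterTurn v = !₂[-v 1, v 0, 0] := rfl
@[simp] theorem verPart_apply (v : E3) : verPart v = !₂[0, 0, v 2] := rfl

/-- The rotation `rot φ` as a continuous linear map. -/
noncomputable def rotL (φ : ℝ) : E3 →L[ℝ] E3 :=
  Real.cos φ • horPart + Real.sin φ • quarterTurn + verPart

/-- The derivative of `rotL` with respect to the angle. -/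
noncomputable def drotL (φ : ℝ) : E3 →L[ℝ] E3 :=
  -Real.sin φ • horPart + Real.cos φ • quarterTurn

theorem rotL_apply (φ : ℝ) (v : E3) : rotL φ v = rot φ v := by
  ext i; fin_cases i <;> simp [rotL, rot, sub_eq_add_neg, add_comm]

@[simp] theorem rot_apply_zero (φ : ℝ) (v : E3) :
    rot φ v 0 = Real.cos φ * v 0 - Real.sin φ * v 1 := rfl
@[simp] theorem rot_apply_one (φ : ℝ) (v : E3) :
    rot φ v 1 = Real.sin φ * v 0 + Real.cos φ * v 1 := rfl
@[simp] theorem rot_apply_two (φ : ℝ) (v : E3) : rot φ v 2 = v 2 := rfl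

theorem drotL_apply_zero (φ : ℝ) (v : E3) :
    drotL φ v 0 = -Real.sin φ * v 0 - Real.cos φ * v 1 := by
  simp [drotL]; ring
theorem drotL_apply_one (φ : ℝ) (v : E3) :
    drotL φ v 1 = Real.cos φ * v 0 - Real.sin φ * v 1 := by
  simp [drotL]; ring
theorem drotL_apply_two (φ : ℝ) (v : E3) : drotL φ v 2 = 0 := by
  simp [drotL]

theorem norm_sq_eq_coords (v : E3) : ‖v‖ ^ 2 = v 0 ^ 2 + v 1 ^ 2 + v 2 ^ 2 := by
  rw [EuclideanSpace.norm_sq_eq, Fin.sum_univ_three]; simp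

theorem inner_eq_coords (v w : E3) : inner ℝ v w = v 0 * w 0 + v 1 * w 1 + v 2 * w 2 := by
  simp [PiLp.inner_apply, Fin.sum_univ_three, mul_comm]

theorem rot_rot (φ ψ : ℝ) (v : E3) : rot φ (rot ψ v) = rot (φ + ψ) v := by
  ext i
  fin_cases i
  · simp [Real.cos_add, Real.sin_add]; ring
  · simp [Real.cos_add, Real.sin_add]; ring
  · simp

@[simp] theorem rot_zero_angle (v : E3) : rot 0 v = v := by
  ext i; fin_cases i <;> simp [rot]

theorem rot_rot_neg (φ : ℝ) (v : E3) : rot φ (rot (-φ) v) = v := by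
  rw [rot_rot, add_neg_cancel, rot_zero_angle]

theorem rot_add_int_mul_two_pi (φ : ℝ) (n : ℤ) (v : E3) : rot (φ + n * (2 * Real.pi)) v = rot φ v := by
  simp [rot, Real.cos_add_int_mul_two_pi, Real.sin_add_int_mul_two_pi]

theorem rot_add_two_pi (φ : ℝ) (v : E3) : rot (φ + 2 * Real.pi) v = rot φ v := by
  simp [rot]

theorem inner_rot (φ : ℝ) (v w : E3) : inner ℝ (rot φ v) (rot φ w) = inner ℝ v w := by
  simp only [inner_eq_coords, rot_apply_zero, rot_apply_one, rot_apply_two]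
  linear_combination (v 0 * w 0 + v 1 * w 1) * Real.sin_sq_add_cos_sq φ

theorem norm_rot (φ : ℝ) (v : E3) : ‖rot φ v‖ = ‖v‖ := by
  rw [← sq_eq_sq₀ (norm_nonneg _) (norm_nonneg _), ← real_inner_self_eq_norm_sq, inner_rot,
    real_inner_self_eq_norm_sq]

theorem hor_sq_rot (φ : ℝ) (v : E3) : rot φ v 0 ^ 2 + rot φ v 1 ^ 2 = v 0 ^ 2 + v 1 ^ 2 := by
  simp only [rot_apply_zero, rot_apply_one]
  linear_combination (v 0 ^ 2 + v 1 ^ 2) * Real.sin_sq_add_cos_sq φ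

theorem norm_sq_drotL (φ : ℝ) (v : E3) : ‖drotL φ v‖ ^ 2 = v 0 ^ 2 + v 1 ^ 2 := by
  rw [norm_sq_eq_coords, drotL_apply_zero, drotL_apply_one, drotL_apply_two]
  linear_combination (v 0 ^ 2 + v 1 ^ 2) * Real.sin_sq_add_cos_sq φ

theorem continuous_rotL : Continuous rotL := by unfold rotL; fun_prop

theorem continuous_drotL : Continuous drotL := by unfold drotL; fun_prop

theorem continuous_rot : Continuous fun p : ℝ × E3 => rot p.1 p.2 := by
  have : (fun p : ℝ × E3 => rot p.1 p.2) = fun p => rotL p.1 p.2 := by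
    ext1 p; rw [rotL_apply]
  rw [this]
  exact (continuous_rotL.comp continuous_fst).clm_apply continuous_snd

theorem hasDerivAt_rot (φ : ℝ) (v : E3) : HasDerivAt (fun s => rot s v) (drotL φ v) φ := by
  have : (fun s => rot s v) = fun s => Real.cos s • horPart v + Real.sin s • quarterTurn v
      + verPart v := by
    ext1 s; rw [← rotL_apply]; rfl
  rw [this]
  exact (((Real.hasDerivAt_cos φ).smul_const _).add
    ((Real.hasDerivAt_sin φ).smul_const _)).add_const _

theorem abs_apply_le_norm (v : E3) (i : Fin 3) : |v i| ≤ ‖v‖ := by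
  simpa using PiLp.norm_apply_le v i

theorem hasDerivWithinAt_apply {f : ℝ → E3} {f' : E3} {s : Set ℝ} {t : ℝ}
    (h : HasDerivWithinAt f f' s t) (i : Fin 3) : HasDerivWithinAt (fun t => f t i) (f' i) s t :=
  (EuclideanSpace.proj (𝕜 := ℝ) i).hasFDerivAt.comp_hasDerivWithinAt t h

theorem hasDerivAt_apply {f : ℝ → E3} {f' : E3} {t : ℝ}
    (h : HasDerivAt f f' t) (i : Fin 3) : HasDerivAt (fun t => f t i) (f' i) t :=
  (EuclideanSpace.proj (𝕜 := ℝ) i).hasFDerivAt.comp_hasDerivAt t h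

theorem continuous_apply_E3 (i : Fin 3) : Continuous fun v : E3 => v i :=
  (EuclideanSpace.proj (𝕜 := ℝ) i).continuous

/-! ### Geometry of the profile and of its surface -/

namespace RevolutionProfile

variable (P : RevolutionProfile)

/-- The velocity of the profile curve. -/
noncomputable def vel (t : ℝ) : E3 := derivWithin P.γ P.I t

theorem continuousOn_γ : ContinuousOn P.γ P.I := P.contDiffOn.continuousOn

theorem hasDerivWithinAt_γ {t : ℝ} (ht : t ∈ P.I) : HasDerivWithinAt P.γ (P.vel t) P.I t :=
  ((P.contDiffOn.differentiableOn (by norm_num)) t ht).hasDerivWithinAt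

theorem hasDerivAt_γ {t : ℝ} (ht : t ∈ Ioo P.a P.b) : HasDerivAt P.γ (P.vel t) t :=
  (P.hasDerivWithinAt_γ (Ioo_subset_Icc_self ht)).hasDerivAt (Icc_mem_nhds ht.1 ht.2)

theorem continuousOn_vel : ContinuousOn P.vel P.I :=
  P.contDiffOn.continuousOn_derivWithin (uniqueDiffOn_Icc P.a_lt_b) le_rfl

theorem vel_ne_zero {t : ℝ} (ht : t ∈ P.I) : P.vel t ≠ 0 := P.regular t ht

theorem vel_one {t : ℝ} (ht : t ∈ P.I) : P.vel t 1 = 0 := by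
  have h1 := hasDerivWithinAt_apply (P.hasDerivWithinAt_γ ht) 1
  have h2 : HasDerivWithinAt (fun t => P.γ t 1) 0 P.I t :=
    (hasDerivWithinAt_const t P.I (0 : ℝ)).congr (fun s hs => P.in_plane s hs) (P.in_plane t ht)
  exact (uniqueDiffOn_Icc P.a_lt_b t ht).eq_deriv _ h1 h2

theorem h₂_eq (t : ℝ) : P.h₂ t = ‖P.vel t‖ := rfl

theorem h₂_pos {t : ℝ} (ht : t ∈ P.I) : 0 < P.h₂ t := norm_pos_iff.2 (P.vel_ne_zero ht)

theorem continuousOn_h₂ : ContinuousOn P.h₂ P.I := P.continuousOn_vel.norm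

theorem h₁_eq {t : ℝ} (ht : t ∈ P.I) : P.h₁ t = P.γ t 0 := abs_of_nonneg (P.x_nonneg t ht)

theorem continuousOn_h₁ : ContinuousOn P.h₁ P.I :=
  ((continuous_apply_E3 0).comp_continuousOn P.continuousOn_γ).abs

theorem h₁_nonneg (t : ℝ) : 0 ≤ P.h₁ t := abs_nonneg _

/-- An interior zero of x ≥ 0 is a minimum, so x' = 0 there; with y = 0 along the curve and z' = 0
by perpendicularity the velocity would vanish. So poles occur only at the end points of the
parameter interval. -/
theorem h₁_pos {t : ℝ} (ht : t ∈ Ioo P.a P.b) : 0 < P.h₁ t := by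
  have hI : t ∈ P.I := Ioo_subset_Icc_self ht
  refine lt_of_le_of_ne (P.h₁_nonneg t) fun h0 => ?_
  have hx : P.γ t 0 = 0 := by rw [← P.h₁_eq hI, ← h0]
  have hmin : IsLocalMin (fun t => P.γ t 0) t := by
    filter_upwards [isOpen_Ioo.mem_nhds ht] with s hs
    rw [hx]; exact P.x_nonneg s (Ioo_subset_Icc_self hs)
  have hd := hmin.hasDerivAt_eq_zero (hasDerivAt_apply (P.hasDerivAt_γ ht) 0)
  refine P.vel_ne_zero hI ?_
  ext i
  fin_cases i
  · exact hd
  · exact P.vel_one hI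
  · exact P.perp_axis t hI hx

theorem norm_vel_of_pole {t : ℝ} (ht : t ∈ P.I) (h0 : P.h₁ t = 0) :
    ‖P.vel t‖ = |P.vel t 0| := by
  have hx : P.γ t 0 = 0 := by rw [← P.h₁_eq ht, h0]
  have h := norm_sq_eq_coords (P.vel t)
  have hz : P.vel t 2 = 0 := P.perp_axis t ht hx
  rw [P.vel_one ht, hz] at h
  rw [← sq_eq_sq₀ (norm_nonneg _) (abs_nonneg _), sq_abs, h]; ring

/-- At a pole the velocity is purely radial, hence its x-component is nonzero; it is nonnegative as
the one-sided derivative of x ≥ 0 at a zero. -/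
theorem vel_pos_of_pole (h0 : P.h₁ P.a = 0) : 0 < P.vel P.a 0 := by
  have ha : P.a ∈ P.I := ⟨le_rfl, P.a_lt_b.le⟩
  have h1 : P.vel P.a 0 ≠ 0 := by
    intro h
    have := P.norm_vel_of_pole ha h0
    rw [h, abs_zero, norm_eq_zero] at this
    exact P.vel_ne_zero ha this
  refine lt_of_le_of_ne ?_ h1.symm
  have hx : P.γ P.a 0 = 0 := by rw [← P.h₁_eq ha, h0]
  have hd := hasDerivWithinAt_apply (P.hasDerivWithinAt_γ ha) 0
  have hd' := (hd.mono (Ioo_subset_Icc_self : Ioo P.a P.b ⊆ P.I))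
  rw [hasDerivWithinAt_iff_tendsto_slope' (by simp)] at hd'
  have hne : (nhdsWithin P.a (Ioo P.a P.b)).NeBot := by
    rw [← mem_closure_iff_nhdsWithin_neBot, closure_Ioo P.a_lt_b.ne]; exact ha
  refine ge_of_tendsto hd' ?_
  filter_upwards [self_mem_nhdsWithin] with s hs
  rw [slope_def_field, hx, sub_zero]
  exact div_nonneg (P.x_nonneg s (Ioo_subset_Icc_self hs)) (by linarith [hs.1])

theorem eq_endpoint_of_pole {t : ℝ} (ht : t ∈ P.I) (h0 : P.h₁ t = 0) : t = P.a ∨ t = P.b := by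
  by_contra h
  push Not at h
  exact (P.h₁_pos ⟨lt_of_le_of_ne ht.1 h.1.symm, lt_of_le_of_ne ht.2 h.2⟩).ne' h0

theorem not_loop_of_pole {t : ℝ} (ht : t ∈ P.I) (h0 : P.h₁ t = 0) : P.γ P.a ≠ P.γ P.b := by
  intro hl
  have h1 := P.loop_off_axis hl
  have hx : P.γ t 0 = 0 := by rw [← P.h₁_eq ht, h0]
  rcases P.eq_endpoint_of_pole ht h0 with rfl | rfl
  · linarith
  · rw [hl] at h1; linarith

theorem exists_h₂_bounds : ∃ c C, 0 < c ∧ ∀ t ∈ P.I, c ≤ P.h₂ t ∧ P.h₂ t ≤ C := by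
  have hne : P.I.Nonempty := ⟨P.a, le_rfl, P.a_lt_b.le⟩
  have hc : IsCompact P.I := isCompact_Icc
  obtain ⟨t₀, ht₀, h0⟩ := hc.exists_isMinOn hne P.continuousOn_h₂
  obtain ⟨t₁, ht₁, h1⟩ := hc.exists_isMaxOn hne P.continuousOn_h₂
  exact ⟨P.h₂ t₀, P.h₂ t₁, P.h₂_pos ht₀, fun t ht => ⟨h0 ht, h1 ht⟩⟩

theorem exists_h₁_le : ∃ C, 0 < C ∧ ∀ t ∈ P.I, P.h₁ t ≤ C := by
  obtain ⟨C, hC⟩ := isCompact_Icc.exists_bound_of_continuousOn P.continuousOn_h₁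
  exact ⟨max C 1, by positivity, fun t ht => (le_abs_self _).trans ((hC t ht).trans (le_max_left _ _))⟩

theorem ae_mem_Ioo : ∀ᵐ t ∂(volume.restrict P.I), t ∈ Ioo P.a P.b := by
  rw [I, ← restrict_Ioo_eq_restrict_Icc]
  exact ae_restrict_mem measurableSet_Ioo

theorem continuousOn_ξ : ContinuousOn P.ξ (univ ×ˢ P.I) := by
  have : P.ξ = (fun q : ℝ × E3 => rot q.1 q.2) ∘ fun p : ℝ × ℝ => (p.1, P.γ p.2) := rfl
  rw [this]
  refine continuous_rot.comp_continuousOn (continuousOn_fst.prodMk ?_)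
  exact P.continuousOn_γ.comp continuousOn_snd fun p hp => hp.2

theorem isCompact_rect : IsCompact P.rect := isCompact_Icc.prod isCompact_Icc

theorem measurableSet_rect : MeasurableSet P.rect := P.isCompact_rect.measurableSet

theorem rect_subset : P.rect ⊆ univ ×ˢ P.I := prod_mono (subset_univ _) subset_rfl

theorem isCompact_surface : IsCompact P.surface :=
  P.isCompact_rect.image_of_continuousOn (P.continuousOn_ξ.mono P.rect_subset)

theorem ξ_mem_surface (φ : ℝ) {t : ℝ} (ht : t ∈ P.I) : P.ξ (φ, t) ∈ P.surface := by
  obtain ⟨n, hn⟩ : ∃ n : ℤ, φ - n * (2 * Real.pi) ∈ Ico 0 (2 * Real.pi) := by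
    refine ⟨toIcoDiv Real.two_pi_pos 0 φ, ?_⟩
    simpa using sub_toIcoDiv_zsmul_mem_Ico Real.two_pi_pos 0 φ
  refine ⟨(φ - n * (2 * Real.pi), t), ⟨Ico_subset_Icc_self hn, ht⟩, ?_⟩
  have := rot_add_int_mul_two_pi φ (-n) (P.γ t)
  simp only [ξ]
  rw [← this]
  congr 1
  push_cast
  ring

theorem mem_surface_iff {p : E3} : p ∈ P.surface ↔ ∃ φ, ∃ t ∈ P.I, p = P.ξ (φ, t) := by
  constructor
  · rintro ⟨⟨φ, t⟩, h, rfl⟩; exact ⟨φ, t, h.2, rfl⟩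
  · rintro ⟨φ, t, h, rfl⟩; exact P.ξ_mem_surface φ h

theorem rot_ξ (ψ φ t : ℝ) : rot ψ (P.ξ (φ, t)) = P.ξ (ψ + φ, t) := rot_rot _ _ _

theorem rot_mem_surface (ψ : ℝ) {p : E3} (hp : p ∈ P.surface) : rot ψ p ∈ P.surface := by
  obtain ⟨φ, t, ht, rfl⟩ := P.mem_surface_iff.1 hp
  rw [rot_ξ]; exact P.ξ_mem_surface _ ht

theorem γ_mem_surface {t : ℝ} (ht : t ∈ P.I) : P.γ t ∈ P.surface := by
  have := P.ξ_mem_surface 0 ht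
  simpa [ξ] using this

theorem exists_surface_bound : ∃ R, 0 < R ∧ ∀ p ∈ P.surface, ‖p‖ ≤ R := by
  obtain ⟨R, hR⟩ := P.isCompact_surface.isBounded.exists_norm_le
  exact ⟨max R 1, by positivity, fun p hp => (hR p hp).trans (le_max_left _ _)⟩

theorem tauφ_eq (p : ℝ × ℝ) : P.tauφ p = drotL p.1 (P.γ p.2) :=
  (hasDerivAt_rot p.1 (P.γ p.2)).deriv

theorem tauT_eq {p : ℝ × ℝ} (hp : p.2 ∈ P.I) : P.tauT p = rot p.1 (P.vel p.2) := by
  have h := (rotL p.1).hasFDerivAt.comp_hasDerivWithinAt p.2 (P.hasDerivWithinAt_γ hp)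
  have h2 := h.derivWithin (uniqueDiffOn_Icc P.a_lt_b p.2 hp)
  rw [← rotL_apply, ← h2]
  unfold tauT
  congr 1
  ext1 s
  simp [ξ, rotL_apply]

theorem norm_tauφ {p : ℝ × ℝ} (hp : p.2 ∈ P.I) : ‖P.tauφ p‖ = P.h₁ p.2 := by
  rw [← sq_eq_sq₀ (norm_nonneg _) (P.h₁_nonneg _), P.tauφ_eq, norm_sq_drotL, P.in_plane p.2 hp,
    P.h₁_eq hp]
  ring

theorem norm_tauT {p : ℝ × ℝ} (hp : p.2 ∈ P.I) : ‖P.tauT p‖ = P.h₂ p.2 := by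
  rw [P.tauT_eq hp, norm_rot, P.h₂_eq]

theorem inner_tauφ_tauT {p : ℝ × ℝ} (hp : p.2 ∈ P.I) : inner ℝ (P.tauφ p) (P.tauT p) = 0 := by
  rw [P.tauT_eq hp, P.tauφ_eq, inner_eq_coords, drotL_apply_zero, drotL_apply_one, drotL_apply_two]
  simp only [rot_apply_zero, rot_apply_one, rot_apply_two, P.in_plane p.2 hp, P.vel_one hp]
  ring

theorem continuousOn_tauφ : ContinuousOn P.tauφ P.rect := by
  have : P.tauφ = fun p => drotL p.1 (P.γ p.2) := funext P.tauφ_eq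
  rw [this]
  exact (continuous_drotL.comp continuous_fst).continuousOn.clm_apply
    (P.continuousOn_γ.comp continuousOn_snd fun p hp => hp.2)

theorem continuousOn_tauT : ContinuousOn P.tauT P.rect := by
  have h : ContinuousOn (fun p : ℝ × ℝ => rotL p.1 (P.vel p.2)) P.rect :=
    (continuous_rotL.comp continuous_fst).continuousOn.clm_apply
      (P.continuousOn_vel.comp continuousOn_snd fun p hp => hp.2)
  exact h.congr fun p hp => by rw [P.tauT_eq hp.2, ← rotL_apply]

end RevolutionProfile

/-! ### Weak derivatives on an interval and on a strip -/

/-- Weak derivatives on an interval are derivatives in the sense of the fundamental theorem. -/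
theorem exists_eq_add_integral_of_weakDeriv {a b c₀ : ℝ} {f f' : ℝ → ℝ} (hc₀ : c₀ ∈ Ioo a b)
    (hf : LocallyIntegrableOn f (Ioo a b)) (hf' : LocallyIntegrableOn f' (Ioo a b))
    (h : ∀ χ, IsBump a b χ → ∫ t, deriv χ t * f t = -∫ t, χ t * f' t) :
    ∃ k, ∀ᵐ t, t ∈ Ioo a b → f t = k + ∫ s in c₀..t, f' s := by
  have hab : a < b := hc₀.1.trans hc₀.2
  have hii : ∀ {u v : ℝ}, u ∈ Ioo a b → v ∈ Ioo a b → IntervalIntegrable f' volume u v := by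
    intro u v hu hv
    have : uIcc u v ⊆ Ioo a b := ordConnected_Ioo.uIcc_subset hu hv
    exact (hf'.integrableOn_compact_subset this isCompact_uIcc).intervalIntegrable
  set F : ℝ → ℝ := fun t => ∫ s in c₀..t, f' s with hF
  have hprim : ∀ {u v : ℝ}, u ∈ Ioo a b → v ∈ Ioo a b → u ≤ v → IsPrimitiveOn F f' u v := by
    intro u v hu hv huv
    refine ⟨hii hu hv, fun t ht => ?_⟩
    have htm : t ∈ Ioo a b := ⟨hu.1.trans_le ht.1, ht.2.trans_lt hv.2⟩
    simp only [hF]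
    rw [intervalIntegral.integral_add_adjacent_intervals (hii hc₀ hu) (hii hu htm)]
  have hFc : ContinuousOn F (Ioo a b) := by
    intro t ht
    have h1 := (hprim (u := (a + t) / 2) (v := (t + b) / 2)
      ⟨by linarith [ht.1], by linarith [ht.1, ht.2]⟩ ⟨by linarith [ht.1, ht.2], by linarith [ht.2]⟩
      (by linarith)).continuousOn (by linarith)
    exact (h1.continuousAt (Icc_mem_nhds (by linarith [ht.1]) (by linarith [ht.2]))).continuousWithinAt
  have hFl : LocallyIntegrableOn F (Ioo a b) := hFc.locallyIntegrableOn measurableSet_Ioo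
  -- By the product rule the primitive `F` has the weak derivative `f'` too, so `f - F` falls under
  -- the lemma of du Bois-Reymond.
  suffices hz : ∀ χ, IsBump a b χ → ∫ t, deriv χ t * (f - F) t = 0 by
    obtain ⟨k, hk⟩ := ae_eq_const_of_integral_deriv_mul_eq_zero hab (hf.sub hFl) hz
    refine ⟨k, hk.mono fun t ht hm => ?_⟩
    have := ht hm
    simp only [Pi.sub_apply] at this
    linarith
  intro χ hχ
  obtain ⟨hs, c, d, hac, hdb, hcd⟩ := id hχ
  obtain ⟨hcs, hts⟩ := hχ.tsupport_subset
  have hdcont : Continuous (deriv χ) := hs.continuous_deriv (by simp)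
  have i1 := hf.integrable_bump_mul hdcont hcs.deriv ((tsupport_deriv_subset).trans hts)
  have i2 := hFl.integrable_bump_mul hdcont hcs.deriv ((tsupport_deriv_subset).trans hts)
  have i3 := hf'.integrable_bump_mul hs.continuous hcs hts
  have e0 : ∀ t, deriv χ t * (f - F) t = deriv χ t * f t - deriv χ t * F t := fun t => by
    simp only [Pi.sub_apply]; ring
  simp only [e0]
  rw [integral_sub i1 i2, h χ hχ, sub_eq_zero, eq_comm, eq_neg_iff_add_eq_zero, ← integral_add i2 i3]
  -- The interval from `u'` to `v'` covers the support and contains `c₀`, which ensures `u' ≤ v'`.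
  -- The `min` and `max` handle an empty `[c, d]`, where `c ≥ b` or `d ≤ a` is possible.
  set u := (a + min c b) / 2 with hu
  set v := (max d a + b) / 2 with hv
  set u' := min u c₀ with hu'
  set v' := max v c₀ with hv'
  have m1 : a < min c b := lt_min hac hab
  have m2 : max d a < b := max_lt hdb hab
  have hau : a < u' := lt_min (by linarith) hc₀.1
  have hvb : v' < b := max_lt (by linarith) hc₀.2
  have huc : u' < c := (min_le_left _ _).trans_lt (by linarith [min_le_left c b])
  have hdv : d < v' := lt_of_lt_of_le (by linarith [le_max_left d a]) (le_max_left _ _)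
  have huv : u' ≤ v' := (min_le_right _ _).trans (le_max_right _ _)
  have hum : u' ∈ Ioo a b := ⟨hau, (min_le_right _ _).trans_lt hc₀.2⟩
  have hvm : v' ∈ Ioo a b := ⟨hc₀.1.trans_le (le_max_right _ _), hvb⟩
  have hχp : IsPrimitiveOn χ (deriv χ) u' v' :=
    IsPrimitiveOn.of_hasDerivAt huv hs.continuous.continuousOn
      (fun t _ => (hs.differentiable (by simp) t).hasDerivAt) (hdcont.intervalIntegrable _ _)
  have key := (hχp.mul huv (hprim hum hvm huv)).integral_eq huv
  have z1 : χ u' = 0 := by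
    by_contra hne; linarith [(hcd _ hne).1]
  have z2 : χ v' = 0 := by
    by_contra hne; linarith [(hcd _ hne).2]
  rw [z1, z2, zero_mul, zero_mul, sub_zero] at key
  rw [← key, intervalIntegral.integral_of_le huv, ← integral_Icc_eq_integral_Ioc, eq_comm]
  apply setIntegral_eq_integral_of_forall_compl_eq_zero
  intro t ht
  have hnot : t ∉ Icc c d := fun hm => ht ⟨huc.le.trans hm.1, hm.2.trans hdv.le⟩
  have z3 : χ t = 0 := by by_contra hne; exact hnot (hcd _ hne)
  have z4 : deriv χ t = 0 := by
    have : t ∉ tsupport χ := fun hm =>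
      hnot (closure_minimal (fun t ht => hcd t ht) isClosed_Icc hm)
    exact image_eq_zero_of_notMem_tsupport fun hm => this (tsupport_deriv_subset hm)
  rw [z3, z4, zero_mul, zero_mul, add_zero]

/-- Local integrability on the strip `[0, 2π] × (a, b)`. -/
def StripIntegrable (H : ℝ × ℝ → ℝ) (a b : ℝ) : Prop :=
  ∀ c d, a < c → d < b → IntegrableOn H (Icc 0 (2 * Real.pi) ×ˢ Icc c d)

namespace StripIntegrable

variable {H H₁ H₂ : ℝ × ℝ → ℝ} {a b : ℝ}

theorem of_integrableOn (h : IntegrableOn H (Icc 0 (2 * Real.pi) ×ˢ Icc a b)) :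
    StripIntegrable H a b := fun _ _ hc hd =>
  h.mono_set (prod_mono subset_rfl (Icc_subset_Icc hc.le hd.le))

theorem add (h₁ : StripIntegrable H₁ a b) (h₂ : StripIntegrable H₂ a b) :
    StripIntegrable (fun p => H₁ p + H₂ p) a b := fun c d hc hd => (h₁ c d hc hd).add (h₂ c d hc hd)

theorem sub (h₁ : StripIntegrable H₁ a b) (h₂ : StripIntegrable H₂ a b) :
    StripIntegrable (fun p => H₁ p - H₂ p) a b := fun c d hc hd => (h₁ c d hc hd).sub (h₂ c d hc hd)

theorem continuous_mul (h : StripIntegrable H a b) {e : ℝ → ℝ} (he : Continuous e) :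
    StripIntegrable (fun p => e p.1 * H p) a b := fun c d hc hd =>
  (h c d hc hd).continuousOn_mul (he.comp continuous_fst).continuousOn
    (isCompact_Icc.prod isCompact_Icc)

theorem integrable_prod (h : StripIntegrable H a b) {c d : ℝ} (hc : a < c) (hd : d < b) :
    Integrable H ((volume.restrict (Icc 0 (2 * Real.pi))).prod (volume.restrict (Icc c d))) := by
  have := h c d hc hd
  rwa [IntegrableOn, Measure.volume_eq_prod, ← Measure.prod_restrict] at this

theorem locallyIntegrableOn_integral (h : StripIntegrable H a b) :
    LocallyIntegrableOn (fun t => ∫ φ in Icc 0 (2 * Real.pi), H (φ, t)) (Ioo a b) := by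
  intro t ht
  have h1 := (h.integrable_prod (c := (a + t) / 2) (d := (t + b) / 2) (by linarith [ht.1])
    (by linarith [ht.2])).integral_prod_right
  exact ⟨_, mem_nhdsWithin_of_mem_nhds (Icc_mem_nhds (by linarith [ht.1]) (by linarith [ht.2])), h1⟩

theorem ae_integrable_slice (h : StripIntegrable H a b) :
    ∀ᵐ t, t ∈ Ioo a b → Integrable (fun φ => H (φ, t)) (volume.restrict (Icc 0 (2 * Real.pi))) := by
  have key : ∀ n : ℕ, ∀ᵐ t, t ∈ Icc (a + 1 / ((n : ℝ) + 1)) (b - 1 / ((n : ℝ) + 1)) →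
      Integrable (fun φ => H (φ, t)) (volume.restrict (Icc 0 (2 * Real.pi))) := by
    intro n
    have hpos : (0 : ℝ) < 1 / ((n : ℝ) + 1) := by positivity
    have := (h.integrable_prod (c := a + 1 / ((n : ℝ) + 1)) (d := b - 1 / ((n : ℝ) + 1))
      (by linarith) (by linarith)).prod_left_ae
    exact (ae_restrict_iff' measurableSet_Icc).1 this
  filter_upwards [ae_all_iff.2 key] with t ht hm
  obtain ⟨n, hn⟩ := exists_nat_one_div_lt (show 0 < min (t - a) (b - t) from
    lt_min (by linarith [hm.1]) (by linarith [hm.2]))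
  have h1 := hn.trans_le (min_le_left _ _)
  have h2 := hn.trans_le (min_le_right _ _)
  exact ht n ⟨by linarith, by linarith⟩

theorem ae_integrableOn_fiber (h : StripIntegrable H a b) :
    ∀ᵐ φ ∂(volume.restrict (Icc 0 (2 * Real.pi))), ∀ c d, a < c → d < b →
      IntegrableOn (fun t => H (φ, t)) (Icc c d) := by
  have key : ∀ n : ℕ, ∀ᵐ φ ∂(volume.restrict (Icc 0 (2 * Real.pi))),
      IntegrableOn (fun t => H (φ, t)) (Icc (a + 1 / ((n : ℝ) + 1)) (b - 1 / ((n : ℝ) + 1))) := by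
    intro n
    have hpos : (0 : ℝ) < 1 / ((n : ℝ) + 1) := by positivity
    exact (h.integrable_prod (c := a + 1 / ((n : ℝ) + 1)) (d := b - 1 / ((n : ℝ) + 1))
      (by linarith) (by linarith)).prod_right_ae
  filter_upwards [ae_all_iff.2 key] with φ hφ c d hc hd
  obtain ⟨n, hn⟩ := exists_nat_one_div_lt (show 0 < min (c - a) (b - d) from
    lt_min (by linarith) (by linarith))
  have h1 := hn.trans_le (min_le_left _ _)
  have h2 := hn.trans_le (min_le_right _ _)
  exact (hφ n).mono_set (Icc_subset_Icc (by linarith) (by linarith))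

/-- Fubini's theorem for integrands cut off in the second variable. -/
theorem integral_cutoff (h : StripIntegrable H a b) {η : ℝ → ℝ} (hη : Continuous η) {c d : ℝ}
    (hac : a < c) (hdb : d < b) (hcd : ∀ t, η t ≠ 0 → t ∈ Icc c d) :
    ∫ p in Icc 0 (2 * Real.pi) ×ˢ Icc a b, η p.2 * H p =
      ∫ t, η t * ∫ φ in Icc 0 (2 * Real.pi), H (φ, t) := by
  have hi : IntegrableOn (fun p : ℝ × ℝ => η p.2 * H p) (Icc 0 (2 * Real.pi) ×ˢ Icc c d) :=
    (h c d hac hdb).continuousOn_mul (hη.comp continuous_snd).continuousOn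
      (isCompact_Icc.prod isCompact_Icc)
  have e1 : ∫ p in Icc 0 (2 * Real.pi) ×ˢ Icc a b, η p.2 * H p =
      ∫ p in Icc 0 (2 * Real.pi) ×ˢ Icc c d, η p.2 * H p := by
    apply setIntegral_eq_of_subset_of_forall_sdiff_eq_zero
      (measurableSet_Icc.prod measurableSet_Icc)
    · exact prod_mono subset_rfl (Icc_subset_Icc hac.le hdb.le)
    · rintro ⟨φ, t⟩ ⟨hp, hn⟩
      have : η t = 0 := by
        by_contra hne; exact hn ⟨hp.1, hcd t hne⟩
      simp [this]
  rw [IntegrableOn, Measure.volume_eq_prod, ← Measure.prod_restrict] at hi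
  rw [e1, Measure.volume_eq_prod, ← Measure.prod_restrict, integral_prod_symm _ hi]
  simp only [integral_const_mul]
  apply setIntegral_eq_integral_of_forall_compl_eq_zero
  intro t ht
  have : η t = 0 := by
    by_contra hne; exact ht (hcd t hne)
  simp [this]

/-- If `H` is orthogonal to all functions of the second variable, then almost all its integrals
over the first variable vanish. -/
theorem ae_integral_eq_zero (h : StripIntegrable H a b)
    (hz : ∀ χ, IsBump a b χ → ∫ p in Icc 0 (2 * Real.pi) ×ˢ Icc a b, χ p.2 * H p = 0) :
    ∀ᵐ t, t ∈ Ioo a b → ∫ φ in Icc 0 (2 * Real.pi), H (φ, t) = 0 := by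
  refine isOpen_Ioo.ae_eq_zero_of_integral_contDiff_smul_eq_zero h.locallyIntegrableOn_integral ?_
  intro χ h1 h2 h3
  have hb := IsBump.of_tsupport h1 h2 h3
  obtain ⟨-, c, d, hac, hdb, hcd⟩ := id hb
  simp only [smul_eq_mul]
  rw [← h.integral_cutoff h1.continuous hac hdb hcd, hz χ hb]

end StripIntegrable

theorem integral_Icc_two_pi (f : ℝ → ℝ) :
    ∫ φ in Icc 0 (2 * Real.pi), f φ = ∫ φ in (0 : ℝ)..(2 * Real.pi), f φ := by
  rw [intervalIntegral.integral_of_le Real.two_pi_pos.le, integral_Icc_eq_integral_Ioc]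

theorem intervalIntegrable_two_pi {f : ℝ → ℝ}
    (h : Integrable f (volume.restrict (Icc 0 (2 * Real.pi)))) :
    IntervalIntegrable f volume 0 (2 * Real.pi) :=
  (intervalIntegrable_iff_integrableOn_Icc_of_le Real.two_pi_pos.le).2 h

theorem ae_restrict_Icc_two_pi {p : ℝ → Prop}
    (h : ∀ᵐ φ ∂(volume.restrict (Ioc 0 (2 * Real.pi))), p φ) :
    ∀ᵐ φ ∂(volume.restrict (Icc 0 (2 * Real.pi))), p φ := by
  rwa [← restrict_Ioc_eq_restrict_Icc]

/-- A function on the strip whose Fourier coefficients all vanish weakly is zero. -/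
theorem StripIntegrable.ae_eq_zero {H : ℝ × ℝ → ℝ} {a b : ℝ} (h : StripIntegrable H a b)
    (hz : ∀ j χ, IsBump a b χ →
      ∫ p in Icc 0 (2 * Real.pi) ×ˢ Icc a b, χ p.2 * (trig j p.1 * H p) = 0) :
    ∀ᵐ t, t ∈ Ioo a b → ∀ᵐ φ ∂(volume.restrict (Icc 0 (2 * Real.pi))), H (φ, t) = 0 := by
  have h1 : ∀ j, ∀ᵐ t, t ∈ Ioo a b → ∫ φ in Icc 0 (2 * Real.pi), trig j φ * H (φ, t) = 0 :=
    fun j => (h.continuous_mul (continuous_trig j)).ae_integral_eq_zero (hz j)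
  filter_upwards [ae_all_iff.2 h1, h.ae_integrable_slice] with t h2 h3 ht
  apply ae_restrict_Icc_two_pi
  exact ae_eq_zero_of_trig_coeff_eq_zero (intervalIntegrable_two_pi (h3 ht)) fun j => by
    rw [← integral_Icc_two_pi]; exact h2 j ht

/-- The oriented integral is a difference of two integrals of indicators depending measurably on the
parameter. Joint measurability is what permits the exchange of null sets in
`ae_fiber_eq_add_integral`. -/
theorem stronglyMeasurable_integral_second {d : ℝ × ℝ → ℝ} (hd : StronglyMeasurable d) (c₀ : ℝ) :
    StronglyMeasurable fun p : ℝ × ℝ => ∫ s in c₀..p.2, d (p.1, s) := by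
  have hm : StronglyMeasurable fun q : (ℝ × ℝ) × ℝ => d (q.1.1, q.2) :=
    hd.comp_measurable (by fun_prop)
  have s1 : MeasurableSet {q : (ℝ × ℝ) × ℝ | q.2 ∈ Ioc c₀ q.1.2} :=
    (measurableSet_lt measurable_const measurable_snd).inter
      (measurableSet_le measurable_snd (by fun_prop))
  have s2 : MeasurableSet {q : (ℝ × ℝ) × ℝ | q.2 ∈ Ioc q.1.2 c₀} :=
    (measurableSet_lt (by fun_prop) measurable_snd).inter
      (measurableSet_le measurable_snd measurable_const)
  have h1 := (hm.indicator s1).integral_prod_right' (ν := volume)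
  have h2 := (hm.indicator s2).integral_prod_right' (ν := volume)
  convert h1.sub h2 using 1
  ext p
  simp only [intervalIntegral, Pi.sub_apply]
  rw [← integral_indicator measurableSet_Ioc, ← integral_indicator measurableSet_Ioc]
  rfl

/-- A function on the strip with a weak derivative in the second variable is, on almost every
fiber, a primitive of that derivative. -/
theorem ae_fiber_eq_add_integral {a b c₀ : ℝ} {f d : ℝ × ℝ → ℝ} (hc₀ : c₀ ∈ Ioo a b)
    (hfm : StronglyMeasurable f) (hdm : StronglyMeasurable d)
    (hf : StripIntegrable f a b) (hd : StripIntegrable d a b)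
    (h : ∀ j χ, IsBump a b χ →
      ∫ p in Icc 0 (2 * Real.pi) ×ˢ Icc a b, deriv χ p.2 * (trig j p.1 * f p) =
      -∫ p in Icc 0 (2 * Real.pi) ×ˢ Icc a b, χ p.2 * (trig j p.1 * d p)) :
    ∀ᵐ φ ∂(volume.restrict (Icc 0 (2 * Real.pi))), ∃ k, ∀ᵐ t, t ∈ Ioo a b →
      f (φ, t) = k + ∫ s in c₀..t, d (φ, s) := by
  have hab : a < b := hc₀.1.trans hc₀.2
  set N : ℝ × ℝ → ℝ := fun p => f p - ∫ s in c₀..p.2, d (p.1, s) with hN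
  have hNm : StronglyMeasurable N := hfm.sub (stronglyMeasurable_integral_second hdm c₀)
  -- The aim is that `N` does not depend on `t`. Each Fourier coefficient of `f` in the first
  -- variable has the corresponding coefficient of `d` as its weak derivative, so each coefficient
  -- of `N` is a constant `κ j`.
  have hcoef : ∀ j, ∃ k, ∀ᵐ t, t ∈ Ioo a b →
      ∫ φ in Icc 0 (2 * Real.pi), trig j φ * f (φ, t) =
      k + ∫ s in c₀..t, ∫ φ in Icc 0 (2 * Real.pi), trig j φ * d (φ, s) := by
    intro j
    have hfj := hf.continuous_mul (continuous_trig j)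
    have hdj := hd.continuous_mul (continuous_trig j)
    refine exists_eq_add_integral_of_weakDeriv hc₀ hfj.locallyIntegrableOn_integral
      hdj.locallyIntegrableOn_integral ?_
    intro χ hχ
    obtain ⟨hs, c, d', hac, hdb, hcd⟩ := id hχ
    have hcd' : ∀ t, deriv χ t ≠ 0 → t ∈ Icc c d' := fun t ht =>
      closure_minimal (fun t ht => hcd t ht) isClosed_Icc
        (tsupport_deriv_subset (subset_tsupport _ ht))
    rw [← hfj.integral_cutoff (hs.continuous_deriv (by simp)) hac hdb hcd',
      ← hdj.integral_cutoff hs.continuous hac hdb hcd, h j χ hχ]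
  choose κ hκ using hcoef
  have hswap : ∀ t ∈ Ioo a b, Integrable (Function.uncurry fun s φ => d (φ, s))
      ((volume.restrict (uIoc c₀ t)).prod (volume.restrict (Icc 0 (2 * Real.pi)))) := by
    intro t ht
    have h1 := (hd.integrable_prod (c := min c₀ t) (d := max c₀ t) (lt_min hc₀.1 ht.1)
      (max_lt hc₀.2 ht.2)).swap
    refine h1.mono_measure (Measure.prod_mono (Measure.restrict_mono ?_ le_rfl) le_rfl)
    exact Ioc_subset_Icc_self
  have hNi : ∀ᵐ t, t ∈ Ioo a b →
      Integrable (fun φ => N (φ, t)) (volume.restrict (Icc 0 (2 * Real.pi))) := by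
    filter_upwards [hf.ae_integrable_slice] with t h1 ht
    refine (h1 ht).sub ?_
    have h2 := (hswap t ht).integral_prod_right
    simp only [intervalIntegral.intervalIntegral_eq_integral_uIoc]
    exact h2.smul (if c₀ ≤ t then (1 : ℝ) else -1)
  have hNcoef : ∀ᵐ t, t ∈ Ioo a b → ∀ j,
      ∫ φ in Icc 0 (2 * Real.pi), trig j φ * N (φ, t) = κ j := by
    filter_upwards [ae_all_iff.2 hκ, hf.ae_integrable_slice] with t h1 h2 ht j
    have h3 := h1 j ht
    have hbd : ∀ {u : ℝ → ℝ}, Integrable u (volume.restrict (Icc 0 (2 * Real.pi))) →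
        Integrable (fun φ => trig j φ * u φ) (volume.restrict (Icc 0 (2 * Real.pi))) := by
      intro u hu
      exact IntegrableOn.continuousOn_mul (continuous_trig j).continuousOn hu isCompact_Icc
    have hI : Integrable (fun φ => ∫ s in c₀..t, d (φ, s))
        (volume.restrict (Icc 0 (2 * Real.pi))) := by
      simp only [intervalIntegral.intervalIntegral_eq_integral_uIoc]
      exact ((hswap t ht).integral_prod_right).smul (if c₀ ≤ t then (1 : ℝ) else -1)
    have hsw : ∫ s in c₀..t, ∫ φ in Icc 0 (2 * Real.pi), trig j φ * d (φ, s) =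
        ∫ φ in Icc 0 (2 * Real.pi), trig j φ * ∫ s in c₀..t, d (φ, s) := by
      rw [intervalIntegral_integral_swap]
      · simp only [intervalIntegral.integral_const_mul]
      · have h4 := (hd.continuous_mul (continuous_trig j)).integrable_prod (c := min c₀ t)
          (d := max c₀ t) (lt_min hc₀.1 ht.1) (max_lt hc₀.2 ht.2) |>.swap
        exact h4.mono_measure (Measure.prod_mono (Measure.restrict_mono Ioc_subset_Icc_self le_rfl)
          le_rfl)
    simp only [hN, mul_sub]
    rw [integral_sub (hbd (h2 ht)) (hbd hI), ← hsw, h3]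
    ring
  have hpos : volume (Ioo a b) ≠ 0 := by simp [hab]
  -- One good level `t₁` serves as reference: at almost every other level `N` has the same Fourier
  -- coefficients, hence the same values for almost every φ.
  obtain ⟨t₁, ht₁, h1N, h1c⟩ : ∃ t₁ ∈ Ioo a b,
      Integrable (fun φ => N (φ, t₁)) (volume.restrict (Icc 0 (2 * Real.pi))) ∧
      ∀ j, ∫ φ in Icc 0 (2 * Real.pi), trig j φ * N (φ, t₁) = κ j := by
    by_contra hcon
    push Not at hcon
    refine hpos (measure_mono_null ?_ (ae_iff.1 (hNi.and hNcoef)))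
    intro t ht hmem
    obtain ⟨j, hj⟩ := hcon t ht (hmem.1 ht)
    exact hj (hmem.2 ht j)
  have hae : ∀ᵐ t ∂(volume.restrict (Ioo a b)), ∀ᵐ φ ∂(volume.restrict (Icc 0 (2 * Real.pi))),
      N (φ, t) = N (φ, t₁) := by
    rw [ae_restrict_iff' measurableSet_Ioo]
    filter_upwards [hNi, hNcoef] with t h2N h2c ht
    have h4 : (fun φ => N (φ, t) - N (φ, t₁)) =ᵐ[volume.restrict (Ioc 0 (2 * Real.pi))] 0 := by
      refine ae_eq_zero_of_trig_coeff_eq_zero (intervalIntegrable_two_pi ((h2N ht).sub h1N)) ?_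
      intro j
      have hbd : ∀ {u : ℝ → ℝ}, Integrable u (volume.restrict (Icc 0 (2 * Real.pi))) →
          Integrable (fun φ => trig j φ * u φ) (volume.restrict (Icc 0 (2 * Real.pi))) := by
        intro u hu
        exact IntegrableOn.continuousOn_mul (continuous_trig j).continuousOn hu isCompact_Icc
      rw [← integral_Icc_two_pi]
      simp only [mul_sub]
      rw [integral_sub (hbd (h2N ht)) (hbd h1N), h2c ht j, h1c j, sub_self]
    filter_upwards [ae_restrict_Icc_two_pi h4] with φ hφ
    exact sub_eq_zero.1 hφ
  have hmeas : MeasurableSet {x : ℝ × ℝ | N (x.2, x.1) = N (x.2, t₁)} := by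
    refine measurableSet_eq_fun ?_ ?_
    · exact hNm.measurable.comp (measurable_snd.prodMk measurable_fst)
    · exact hNm.measurable.comp (measurable_snd.prodMk measurable_const)
  -- Passage from "almost every t, almost every φ" to "almost every φ, almost every t".
  have hcomm := (Measure.ae_ae_comm (p := fun t φ => N (φ, t) = N (φ, t₁)) hmeas).1 hae
  filter_upwards [hcomm] with φ hφ
  refine ⟨N (φ, t₁), ?_⟩
  filter_upwards [(ae_restrict_iff' measurableSet_Ioo).1 hφ] with t ht hm
  rw [← ht hm]
  simp only [hN]
  ring

/-! ### Locally absolutely continuous curves in space -/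

theorem integral_apply_E3 {α : Type*} [MeasurableSpace α] {μ : Measure α} {f : α → E3}
    (hf : Integrable f μ) (i : Fin 3) : (∫ x, f x ∂μ) i = ∫ x, f x i ∂μ :=
  ((EuclideanSpace.proj (𝕜 := ℝ) i : E3 →L[ℝ] ℝ).integral_comp_comm hf).symm

theorem integrable_E3_iff {α : Type*} [MeasurableSpace α] {μ : Measure α} {f : α → E3} :
    Integrable f μ ↔ ∀ i, Integrable (fun x => f x i) μ := by
  constructor
  · intro h i
    exact (EuclideanSpace.proj (𝕜 := ℝ) i : E3 →L[ℝ] ℝ).integrable_comp h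
  · intro h
    have h0 : AEMeasurable (fun x => (f x).ofLp) μ :=
      aemeasurable_pi_iff.2 fun i => (h i).aestronglyMeasurable.aemeasurable
    have h1 : AEStronglyMeasurable f μ :=
      ((PiLp.continuous_toLp 2 (fun _ : Fin 3 => ℝ)).measurable.comp_aemeasurable
        h0).aestronglyMeasurable
    refine Integrable.mono' (((h 0).norm.add (h 1).norm).add (h 2).norm) h1 ?_
    refine Filter.Eventually.of_forall fun t => ?_
    have h2 := norm_sq_eq_coords (f t)
    simp only [Pi.add_apply, Real.norm_eq_abs]
    refine abs_le_of_sq_le_sq' ?_ (by positivity) |>.2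
    rw [h2, ← sq_abs (f t 0), ← sq_abs (f t 1), ← sq_abs (f t 2)]
    nlinarith [mul_nonneg (abs_nonneg (f t 0)) (abs_nonneg (f t 1)),
      mul_nonneg (abs_nonneg (f t 0)) (abs_nonneg (f t 2)),
      mul_nonneg (abs_nonneg (f t 1)) (abs_nonneg (f t 2))]

/-- `v` is a locally absolutely continuous curve on `(a, b)` with derivative `v'`; if `loop` holds,
the derivative is integrable and the curve closes up. -/
structure IsCurve (a b : ℝ) (loop : Prop) (v v' : ℝ → E3) : Prop where
  locInt : ∀ i, LocallyIntegrableOn (fun t => v' t i) (Ioo a b)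
  ftc : ∀ s ∈ Ioo a b, ∀ t ∈ Ioo a b, ∀ i, v t i - v s i = ∫ r in s..t, v' r i
  closes : loop → ∀ i, IntervalIntegrable (fun t => v' t i) volume a b ∧ ∫ r in a..b, v' r i = 0

/-- Test functions on an interval, in the sense of `RevolutionProfile.IsTest`. -/
def IsTest1 (a b : ℝ) (loop : Prop) (χ : ℝ → ℝ) : Prop :=
  ContDiff ℝ ((⊤ : ℕ∞) : WithTop ℕ∞) χ ∧ ((loop ∧ χ a = χ b) ∨
    ∃ c d, a < c ∧ d < b ∧ ∀ t, χ t ≠ 0 → t ∈ Icc c d)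

namespace IsCurve

variable {a b : ℝ} {loop : Prop} {v v' : ℝ → E3}

theorem isPrimitiveOn (h : IsCurve a b loop v v') {s t : ℝ} (hs : a < s) (hst : s ≤ t) (ht : t < b)
    (i : Fin 3) : IsPrimitiveOn (fun r => v r i) (fun r => v' r i) s t := by
  refine ⟨?_, fun r hr => ?_⟩
  · refine ((h.locInt i).integrableOn_compact_subset ?_ isCompact_uIcc).intervalIntegrable
    rw [uIcc_of_le hst]
    exact Icc_subset_Ioo hs ht
  · have := h.ftc s ⟨hs, hst.trans_lt ht⟩ r ⟨hs.trans_le hr.1, hr.2.trans_lt ht⟩ i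
    simp only
    linarith

theorem continuousOn_apply (h : IsCurve a b loop v v') (i : Fin 3) :
    ContinuousOn (fun t => v t i) (Ioo a b) := by
  intro t ht
  have h1 := (h.isPrimitiveOn (s := (a + t) / 2) (t := (t + b) / 2) (by linarith [ht.1])
    (by linarith [ht.1, ht.2]) (by linarith [ht.2]) i).continuousOn (by linarith [ht.1, ht.2])
  exact (h1.continuousAt
    (Icc_mem_nhds (by linarith [ht.1]) (by linarith [ht.2]))).continuousWithinAt

theorem continuousOn (h : IsCurve a b loop v v') : ContinuousOn v (Ioo a b) := by
  have h1 : ContinuousOn (fun t => (v t).ofLp) (Ioo a b) :=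
    continuousOn_pi.2 fun i => h.continuousOn_apply i
  exact (PiLp.continuous_toLp 2 (fun _ : Fin 3 => ℝ)).comp_continuousOn h1

theorem aestronglyMeasurable (h : IsCurve a b loop v v') :
    AEStronglyMeasurable v (volume.restrict (Icc a b)) := by
  rw [← restrict_Ioo_eq_restrict_Icc]
  exact h.continuousOn.aestronglyMeasurable measurableSet_Ioo

theorem aestronglyMeasurable_deriv (h : IsCurve a b loop v v') :
    AEStronglyMeasurable v' (volume.restrict (Icc a b)) := by
  rw [← restrict_Ioo_eq_restrict_Icc]
  have h1 : AEMeasurable (fun t => (v' t).ofLp) (volume.restrict (Ioo a b)) :=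
    aemeasurable_pi_iff.2 fun i => (h.locInt i).aestronglyMeasurable.aemeasurable
  exact ((PiLp.continuous_toLp 2 (fun _ : Fin 3 => ℝ)).measurable.comp_aemeasurable
    h1).aestronglyMeasurable

theorem integrableOn_deriv (h : IsCurve a b loop v v') {c d : ℝ} (hc : a < c) (hd : d < b) :
    IntegrableOn v' (Icc c d) :=
  integrable_E3_iff.2 fun i =>
    (h.locInt i).integrableOn_compact_subset (Icc_subset_Ioo hc hd) isCompact_Icc

theorem integrableOn_deriv_of_loop (h : IsCurve a b loop v v') (hab : a ≤ b) (hl : loop) :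
    IntegrableOn v' (Icc a b) :=
  integrable_E3_iff.2 fun i => (intervalIntegrable_iff_integrableOn_Icc_of_le hab).1 (h.closes hl i).1

/-- Integration by parts without boundary terms: either `χ` is supported inside the interval, or the
interval is a loop and both `χ` and the curve take equal values at its two ends. -/
theorem integral_deriv_mul_apply (h : IsCurve a b loop v v') (hab : a < b) {χ : ℝ → ℝ}
    (hχ : IsTest1 a b loop χ) (i : Fin 3) :
    ∫ t in Icc a b, deriv χ t * v t i = -∫ t in Icc a b, χ t * v' t i := by
  obtain ⟨hs, hχ⟩ := hχ
  have hdc : Continuous (deriv χ) := hs.continuous_deriv (by simp)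
  have hprim : ∀ {s t : ℝ}, s ≤ t → IsPrimitiveOn χ (deriv χ) s t := fun hst =>
    IsPrimitiveOn.of_hasDerivAt hst hs.continuous.continuousOn
      (fun t _ => (hs.differentiable (by simp) t).hasDerivAt) (hdc.intervalIntegrable _ _)
  rcases hχ with ⟨hl, hχ⟩ | ⟨c, d, hac, hdb, hcd⟩
  · set m := (a + b) / 2 with hm
    have hmI : m ∈ Ioo a b := ⟨by linarith, by linarith⟩
    obtain ⟨hi, hz⟩ := h.closes hl i
    have hsub : ∀ {s t : ℝ}, s ∈ Icc a b → t ∈ Icc a b →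
        IntervalIntegrable (fun t => v' t i) volume s t := fun hs ht =>
      hi.mono_set (by rw [uIcc_of_le hab.le]; exact ordConnected_Icc.uIcc_subset hs ht)
    have ha : a ∈ Icc a b := ⟨le_rfl, hab.le⟩
    have hb : b ∈ Icc a b := ⟨hab.le, le_rfl⟩
    have hmI' := Ioo_subset_Icc_self hmI
    -- The curve is controlled in the open interval only; `V` is its continuous extension to the
    -- closed one.
    set V : ℝ → ℝ := fun t => v m i + ∫ r in m..t, v' r i with hV
    have hVp : IsPrimitiveOn V (fun t => v' t i) a b := by
      refine ⟨hi, fun t ht => ?_⟩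
      simp only [hV]
      rw [add_assoc, intervalIntegral.integral_add_adjacent_intervals (hsub hmI' ha) (hsub ha ht)]
    have hVv : ∀ t ∈ Ioo a b, V t = v t i := fun t ht => by
      simp only [hV]; rw [← h.ftc m hmI t ht i]; ring
    have hVab : V b = V a := by
      have := hVp.integral_eq hab.le
      linarith
    have hVc : ContinuousOn V (uIcc a b) := by
      rw [uIcc_of_le hab.le]; exact hVp.continuousOn hab.le
    have key := ((hprim hab.le).mul hab.le hVp).integral_eq hab.le
    rw [hVab, hχ, sub_self, intervalIntegral.integral_add
      ((hdc.intervalIntegrable a b).mul_continuousOn hVc)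
      (hi.continuousOn_mul hs.continuous.continuousOn)] at key
    have e1 : ∫ t in Icc a b, deriv χ t * v t i = ∫ t in a..b, deriv χ t * V t := by
      rw [intervalIntegral.integral_of_le hab.le, integral_Ioc_eq_integral_Ioo,
        integral_Icc_eq_integral_Ioo]
      exact setIntegral_congr_fun measurableSet_Ioo fun t ht => by simp only; rw [hVv t ht]
    have e2 : ∫ t in Icc a b, χ t * v' t i = ∫ t in a..b, χ t * v' t i := by
      rw [intervalIntegral.integral_of_le hab.le, integral_Icc_eq_integral_Ioc]
    rw [e1, e2]; linarith
  · set u := (a + min c b) / 2 with hu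
    set w := (max d a + b) / 2 with hw
    set m := (a + b) / 2 with hm
    set u' := min u m with hu'
    set w' := max w m with hw'
    have m1 : a < min c b := lt_min hac hab
    have m2 : max d a < b := max_lt hdb hab
    have hau : a < u' := lt_min (by linarith) (by linarith)
    have hwb : w' < b := max_lt (by linarith) (by linarith)
    have huc : u' < c := (min_le_left _ _).trans_lt (by linarith [min_le_left c b])
    have hdw : d < w' := lt_of_lt_of_le (by linarith [le_max_left d a]) (le_max_left _ _)
    have huw : u' ≤ w' := (min_le_right _ _).trans (le_max_right _ _)
    have hVp := h.isPrimitiveOn hau huw hwb i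
    have hVc : ContinuousOn (fun t => v t i) (uIcc u' w') := by
      rw [uIcc_of_le huw]; exact hVp.continuousOn huw
    have key := ((hprim huw).mul huw hVp).integral_eq huw
    have z1 : χ u' = 0 := by
      by_contra hne; linarith [(hcd _ hne).1]
    have z2 : χ w' = 0 := by
      by_contra hne; linarith [(hcd _ hne).2]
    rw [z1, z2, zero_mul, zero_mul, sub_zero, intervalIntegral.integral_add
      ((hdc.intervalIntegrable u' w').mul_continuousOn hVc)
      (hVp.1.continuousOn_mul hs.continuous.continuousOn)] at key
    have zero : ∀ t, t ∉ Icc u' w' → χ t = 0 ∧ deriv χ t = 0 := by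
      intro t ht
      have hnot : t ∉ Icc c d := fun hm => ht ⟨huc.le.trans hm.1, hm.2.trans hdw.le⟩
      refine ⟨by by_contra hne; exact hnot (hcd _ hne), ?_⟩
      have : t ∉ tsupport χ := fun hm =>
        hnot (closure_minimal (fun t ht => hcd t ht) isClosed_Icc hm)
      exact image_eq_zero_of_notMem_tsupport fun hm => this (tsupport_deriv_subset hm)
    have e1 : ∫ t in Icc a b, deriv χ t * v t i = ∫ t in u'..w', deriv χ t * v t i := by
      rw [intervalIntegral.integral_of_le huw, ← integral_Icc_eq_integral_Ioc]
      refine setIntegral_eq_of_subset_of_forall_sdiff_eq_zero measurableSet_Icc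
        (Icc_subset_Icc hau.le hwb.le) fun t ht => ?_
      rw [(zero t ht.2).2, zero_mul]
    have e2 : ∫ t in Icc a b, χ t * v' t i = ∫ t in u'..w', χ t * v' t i := by
      rw [intervalIntegral.integral_of_le huw, ← integral_Icc_eq_integral_Ioc]
      refine setIntegral_eq_of_subset_of_forall_sdiff_eq_zero measurableSet_Icc
        (Icc_subset_Icc hau.le hwb.le) fun t ht => ?_
      rw [(zero t ht.2).1, zero_mul]
    rw [e1, e2]; linarith

end IsCurve

namespace IsCurve

variable {a b : ℝ} {loop : Prop} {v v' : ℝ → E3}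

theorem integral_deriv_smul (h : IsCurve a b loop v v') (hab : a < b) {χ : ℝ → ℝ}
    (hχ : IsTest1 a b loop χ) (h1 : IntegrableOn (fun t => deriv χ t • v t) (Icc a b))
    (h2 : IntegrableOn (fun t => χ t • v' t) (Icc a b)) :
    ∫ t in Icc a b, deriv χ t • v t = -∫ t in Icc a b, χ t • v' t := by
  ext i
  rw [PiLp.neg_apply, integral_apply_E3 h1, integral_apply_E3 h2]
  simpa using h.integral_deriv_mul_apply hab hχ i

end IsCurve

/-! ### Equivariant extension of a curve to the surface -/

open Classical in
/-- The (twisted) equivariant extension to the surface of a map given on a generating curve;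
`q₀` is its value on the axis. -/
noncomputable def revolve (σ : ℤ) (w : E3 → E3) (q₀ : E3) (p : E3) : E3 :=
  if p 0 = 0 ∧ p 1 = 0 then q₀ else
    rot (σ * Complex.arg (p 0 + p 1 * Complex.I))
      (w (rot (-Complex.arg (p 0 + p 1 * Complex.I)) p))

/-- Equivariance with respect to rotations, twisted by the integer `σ`. -/
def TwistedSymmetric (σ : ℤ) (S : Set E3) (u : E3 → E3) : Prop :=
  ∀ φ : ℝ, ∀ p ∈ S, u (rot φ p) = rot (σ * φ) (u p)

namespace RevolutionProfile

variable (P : RevolutionProfile)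

/-- `Complex.arg` recovers the angle only up to a multiple of 2π; since the twist `σ` is an integer,
neither rotation sees the difference. -/
theorem revolve_ξ (σ : ℤ) (w : E3 → E3) (q₀ : E3) (φ : ℝ) {t : ℝ} (ht : t ∈ P.I)
    (h : 0 < P.h₁ t) : revolve σ w q₀ (P.ξ (φ, t)) = rot (σ * φ) (w (P.γ t)) := by
  have hx : 0 < P.γ t 0 := by rwa [← P.h₁_eq ht]
  have hy := P.in_plane t ht
  have h0 : P.ξ (φ, t) 0 = P.γ t 0 * Real.cos φ := by simp [ξ, hy]; ring
  have h1 : P.ξ (φ, t) 1 = P.γ t 0 * Real.sin φ := by simp [ξ, hy]; ring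
  have hne : ¬ (P.ξ (φ, t) 0 = 0 ∧ P.ξ (φ, t) 1 = 0) := by
    rintro ⟨e0, e1⟩
    rw [h0] at e0
    rw [h1] at e1
    have c0 := (mul_eq_zero.1 e0).resolve_left hx.ne'
    have s0 := (mul_eq_zero.1 e1).resolve_left hx.ne'
    have := Real.sin_sq_add_cos_sq φ
    rw [c0, s0] at this
    norm_num at this
  have harg : ∃ k : ℤ, Complex.arg (P.ξ (φ, t) 0 + P.ξ (φ, t) 1 * Complex.I) =
      φ - k * (2 * Real.pi) := by
    refine ⟨toIocDiv Real.two_pi_pos (-Real.pi) φ, ?_⟩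
    rw [h0, h1]
    have e : ((P.γ t 0 * Real.cos φ : ℝ) : ℂ) + ((P.γ t 0 * Real.sin φ : ℝ) : ℂ) * Complex.I =
        (P.γ t 0 : ℂ) * (Complex.cos φ + Complex.sin φ * Complex.I) := by push_cast; ring
    rw [e, Complex.arg_mul_cos_add_sin_mul_I_eq_toIocMod hx, toIocMod]
    simp
  obtain ⟨k, hk⟩ := harg
  unfold revolve
  rw [if_neg hne, hk, P.rot_ξ]
  have e1 : -(φ - k * (2 * Real.pi)) + φ = 0 + k * (2 * Real.pi) := by ring
  have e2 : (σ : ℝ) * (φ - k * (2 * Real.pi)) = σ * φ + ((-(σ * k) : ℤ) : ℝ) * (2 * Real.pi) := by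
    push_cast; ring
  rw [e1, e2, rot_add_int_mul_two_pi]
  congr 1
  simp only [ξ]
  rw [rot_add_int_mul_two_pi, rot_zero_angle]

theorem revolve_pole (σ : ℤ) (w : E3 → E3) (q₀ : E3) (φ : ℝ) {t : ℝ} (ht : t ∈ P.I)
    (h : P.h₁ t = 0) : revolve σ w q₀ (P.ξ (φ, t)) = q₀ := by
  have hx : P.γ t 0 = 0 := by rwa [← P.h₁_eq ht]
  have hy := P.in_plane t ht
  unfold revolve
  rw [if_pos]
  simp [ξ, hx, hy]

theorem rot_of_axis {q : E3} (h0 : q 0 = 0) (h1 : q 1 = 0) (φ : ℝ) : rot φ q = q := by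
  ext i; fin_cases i <;> simp [h0, h1]

theorem twistedSymmetric_revolve (σ : ℤ) (w : E3 → E3) (q₀ : E3)
    (hq : ∀ t ∈ P.I, P.h₁ t = 0 → q₀ 0 = 0 ∧ q₀ 1 = 0) :
    TwistedSymmetric σ P.surface (revolve σ w q₀) := by
  intro φ p hp
  obtain ⟨ψ, t, ht, rfl⟩ := P.mem_surface_iff.1 hp
  rw [P.rot_ξ]
  rcases (P.h₁_nonneg t).eq_or_lt with h | h
  · rw [P.revolve_pole _ _ _ _ ht h.symm, P.revolve_pole _ _ _ _ ht h.symm,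
      rot_of_axis (hq t ht h.symm).1 (hq t ht h.symm).2]
  · rw [P.revolve_ξ _ _ _ _ ht h, P.revolve_ξ _ _ _ _ ht h, rot_rot]
    congr 1; ring

/-! ### Integration over the parameter rectangle -/

theorem restrict_rect : (volume.restrict P.rect : Measure (ℝ × ℝ)) =
    (volume.restrict (Icc 0 (2 * Real.pi))).prod (volume.restrict P.I) := by
  rw [rect, Measure.volume_eq_prod, ← Measure.prod_restrict]

theorem lintegral_rect {F : ℝ × ℝ → ℝ≥0∞} (hF : AEMeasurable F (volume.restrict P.rect)) :
    ∫⁻ p in P.rect, F p = ∫⁻ t in P.I, ∫⁻ φ in Icc 0 (2 * Real.pi), F (φ, t) := by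
  rw [restrict_rect] at hF ⊢
  exact lintegral_prod_symm _ hF

theorem lintegral_rect' {F : ℝ × ℝ → ℝ≥0∞} (hF : AEMeasurable F (volume.restrict P.rect)) :
    ∫⁻ p in P.rect, F p = ∫⁻ φ in Icc 0 (2 * Real.pi), ∫⁻ t in P.I, F (φ, t) := by
  rw [restrict_rect] at hF ⊢
  exact lintegral_prod _ hF

theorem ae_rect_snd {p : ℝ → Prop} (h : ∀ᵐ t ∂(volume.restrict P.I), p t) :
    ∀ᵐ q ∂(volume.restrict P.rect), p q.2 := by
  rw [restrict_rect]
  exact Measure.quasiMeasurePreserving_snd.ae h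

theorem aemeasurable_snd {f : ℝ → ℝ≥0∞} (hf : AEMeasurable f (volume.restrict P.I)) :
    AEMeasurable (fun p : ℝ × ℝ => f p.2) (volume.restrict P.rect) := by
  rw [restrict_rect]
  exact hf.comp_quasiMeasurePreserving Measure.quasiMeasurePreserving_snd

theorem aestronglyMeasurable_snd {F : Type*} [TopologicalSpace F] {f : ℝ → F}
    (hf : AEStronglyMeasurable f (volume.restrict P.I)) :
    AEStronglyMeasurable (fun p : ℝ × ℝ => f p.2) (volume.restrict P.rect) := by
  rw [restrict_rect]
  exact hf.comp_quasiMeasurePreserving Measure.quasiMeasurePreserving_snd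

theorem lintegral_rect_snd {f : ℝ → ℝ≥0∞} (hf : AEMeasurable f (volume.restrict P.I)) :
    ∫⁻ p in P.rect, f p.2 = ENNReal.ofReal (2 * Real.pi) * ∫⁻ t in P.I, f t := by
  rw [P.lintegral_rect (P.aemeasurable_snd hf)]
  simp only [lintegral_const, Measure.restrict_apply MeasurableSet.univ, univ_inter,
    Real.volume_Icc, sub_zero]
  rw [lintegral_mul_const' _ _ ENNReal.ofReal_ne_top, mul_comm]

theorem aemeasurable_h₁ : AEMeasurable P.h₁ (volume.restrict P.I) :=
  P.continuousOn_h₁.aemeasurable measurableSet_Icc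

theorem aemeasurable_h₂ : AEMeasurable P.h₂ (volume.restrict P.I) :=
  P.continuousOn_h₂.aemeasurable measurableSet_Icc

/-- The density of the Dirichlet energy of the surface map generated by the curve `v`. -/
noncomputable def curveDensity (v v' : ℝ → E3) (t : ℝ) : ℝ :=
  P.h₂ t / P.h₁ t * (v t 0 ^ 2 + v t 1 ^ 2) + P.h₁ t / P.h₂ t * ‖v' t‖ ^ 2

theorem curveDensity_nonneg (v v' : ℝ → E3) (t : ℝ) : 0 ≤ P.curveDensity v v' t := by
  have h1 := P.h₁_nonneg t
  have h2 : 0 ≤ P.h₂ t := norm_nonneg _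
  unfold curveDensity
  positivity

theorem aemeasurable_curveDensity {v v' : ℝ → E3}
    (hv : AEStronglyMeasurable v (volume.restrict P.I))
    (hv' : AEStronglyMeasurable v' (volume.restrict P.I)) :
    AEMeasurable (P.curveDensity v v') (volume.restrict P.I) := by
  have m : ∀ i, AEMeasurable (fun t => v t i) (volume.restrict P.I) := fun i =>
    (continuous_apply_E3 i).measurable.comp_aemeasurable hv.aemeasurable
  exact ((P.aemeasurable_h₂.div P.aemeasurable_h₁).mul
    (((m 0).pow_const 2).add ((m 1).pow_const 2))).add
    ((P.aemeasurable_h₁.div P.aemeasurable_h₂).mul (hv'.norm.aemeasurable.pow_const 2))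

variable {P} in
theorem IsTest.isTest1 {ψ : ℝ × ℝ → ℝ} (h : P.IsTest ψ) (φ : ℝ) :
    IsTest1 P.a P.b (P.γ P.a = P.γ P.b) fun t => ψ (φ, t) := by
  refine ⟨h.smooth.comp (by fun_prop), ?_⟩
  rcases h.boundary with ⟨hl, hb⟩ | ⟨c, d, hc, hd, hcd⟩
  · exact Or.inl ⟨hl, hb φ⟩
  · exact Or.inr ⟨c, d, hc, hd, fun t ht => hcd φ t ht⟩

theorem hasDerivAt_partial_snd {ψ : ℝ × ℝ → ℝ}
    (h : ContDiff ℝ ((⊤ : ℕ∞) : WithTop ℕ∞) ψ) (p : ℝ × ℝ) :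
    HasDerivAt (fun t => ψ (p.1, t)) (fderiv ℝ ψ p (0, 1)) p.2 := by
  have h1 : HasFDerivAt ψ (fderiv ℝ ψ p) (p.1, p.2) := (h.differentiable (by simp) p).hasFDerivAt
  exact h1.comp_hasDerivAt p.2 ((hasDerivAt_const p.2 p.1).prodMk (hasDerivAt_id p.2))

theorem hasDerivAt_partial_fst {ψ : ℝ × ℝ → ℝ}
    (h : ContDiff ℝ ((⊤ : ℕ∞) : WithTop ℕ∞) ψ) (p : ℝ × ℝ) :
    HasDerivAt (fun s => ψ (s, p.2)) (fderiv ℝ ψ p (1, 0)) p.1 := by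
  have h1 : HasFDerivAt ψ (fderiv ℝ ψ p) (p.1, p.2) := (h.differentiable (by simp) p).hasFDerivAt
  exact h1.comp_hasDerivAt p.1 ((hasDerivAt_id p.1).prodMk (hasDerivAt_const p.1 p.2))

theorem continuous_partial {ψ : ℝ × ℝ → ℝ} (h : ContDiff ℝ ((⊤ : ℕ∞) : WithTop ℕ∞) ψ)
    (e : ℝ × ℝ) : Continuous fun p => fderiv ℝ ψ p e :=
  (h.continuous_fderiv (by simp)).clm_apply continuous_const

/-- Integrability of a continuous multiple of a family of linear images of a curve. -/
theorem integrable_smul_clm {η : ℝ × ℝ → ℝ} (hη : Continuous η) {L : ℝ → E3 →L[ℝ] E3}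
    (hL : Continuous L) {v : ℝ → E3} {J : Set ℝ} (hJ : MeasurableSet J)
    (hv : AEStronglyMeasurable v (volume.restrict P.I))
    (hvJ : IntegrableOn v J) (hz : ∀ φ, ∀ t ∈ P.I, t ∉ J → η (φ, t) = 0) :
    Integrable (fun p : ℝ × ℝ => η p • L p.1 (v p.2)) (volume.restrict P.rect) := by
  obtain ⟨C, hC⟩ := P.isCompact_rect.exists_bound_of_continuousOn hη.continuousOn
  obtain ⟨D, hD⟩ := (isCompact_Icc (a := (0 : ℝ)) (b := 2 * Real.pi)).exists_bound_of_continuousOn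
    hL.continuousOn
  have hk : Integrable (fun t => J.indicator (fun t => C * (D * ‖v t‖)) t) (volume.restrict P.I) := by
    have : Integrable (fun t => C * (D * ‖v t‖)) (volume.restrict J) :=
      (hvJ.norm.const_mul D).const_mul C
    exact ((integrable_indicator_iff hJ).2 this).integrableOn
  have hk2 : Integrable (fun p : ℝ × ℝ => J.indicator (fun t => C * (D * ‖v t‖)) p.2)
      (volume.restrict P.rect) := by
    rw [restrict_rect]
    exact hk.comp_snd _
  have hm : AEStronglyMeasurable (fun p : ℝ × ℝ => η p • L p.1 (v p.2))
      (volume.restrict P.rect) := by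
    refine hη.aestronglyMeasurable.smul ?_
    exact isBoundedBilinearMap_apply.continuous.comp_aestronglyMeasurable
      ((hL.comp continuous_fst).aestronglyMeasurable.prodMk (P.aestronglyMeasurable_snd hv))
  refine hk2.mono' hm ?_
  filter_upwards [ae_restrict_mem P.measurableSet_rect] with p hp
  by_cases hpJ : p.2 ∈ J
  · rw [indicator_of_mem hpJ, norm_smul]
    have h1 := hC p hp
    have h2 := hD p.1 hp.1
    have h3 := (L p.1).le_opNorm (v p.2)
    have : ‖L p.1 (v p.2)‖ ≤ D * ‖v p.2‖ := h3.trans (by gcongr)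
    exact mul_le_mul h1 this (norm_nonneg _) ((norm_nonneg _).trans h1)
  · have := hz p.1 p.2 hp.2 hpJ
    rw [indicator_of_notMem hpJ]
    simp [this]

end RevolutionProfile

/-! ### The weak gradient of an equivariant map -/

namespace RevolutionProfile

variable (P : RevolutionProfile)

theorem _root_.continuous_innerSL_smulRight {E : Type*} [NormedAddCommGroup E]
    [InnerProductSpace ℝ E] :
    Continuous fun q : E × E => (innerSL ℝ q.1).smulRight q.2 :=
  ((ContinuousLinearMap.smulRightL ℝ E E).continuous.comp
    ((innerSL ℝ).continuous.comp continuous_fst)).clm_apply continuous_snd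

theorem _root_.MeasureTheory.AEStronglyMeasurable.innerSL_smulRight {E α : Type*}
    [NormedAddCommGroup E] [InnerProductSpace ℝ E] [MeasurableSpace α] {μ : Measure α}
    {c : α → ℝ} {f g : α → E} (hc : AEStronglyMeasurable c μ) (hf : AEStronglyMeasurable f μ)
    (hg : AEStronglyMeasurable g μ) :
    AEStronglyMeasurable (fun x => c x • (innerSL ℝ (f x)).smulRight (g x)) μ :=
  hc.smul (continuous_innerSL_smulRight.comp_aestronglyMeasurable (hf.prodMk hg))

/-- The linear map with prescribed values on the two coordinate tangent vectors. -/
noncomputable def frameMap (x y : ℝ × ℝ → E3) (p : ℝ × ℝ) : E3 →L[ℝ] E3 :=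
  (‖P.tauφ p‖ ^ 2)⁻¹ • (innerSL ℝ (P.tauφ p)).smulRight (x p) +
    (‖P.tauT p‖ ^ 2)⁻¹ • (innerSL ℝ (P.tauT p)).smulRight (y p)

theorem frameMap_tauφ (x y : ℝ × ℝ → E3) {p : ℝ × ℝ} (hp : p.2 ∈ P.I) (h : 0 < P.h₁ p.2) :
    P.frameMap x y p (P.tauφ p) = x p := by
  have h1 : ‖P.tauφ p‖ ≠ 0 := by rw [P.norm_tauφ hp]; exact h.ne'
  have h2 : inner ℝ (P.tauT p) (P.tauφ p) = 0 := by rw [real_inner_comm]; exact P.inner_tauφ_tauT hp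
  simp only [frameMap, add_apply, smul_apply,
    ContinuousLinearMap.smulRight_apply, innerSL_apply_apply, h2, real_inner_self_eq_norm_sq,
    zero_smul, smul_zero, add_zero]
  rw [smul_smul, inv_mul_cancel₀ (pow_ne_zero 2 h1), one_smul]

theorem frameMap_tauT (x y : ℝ × ℝ → E3) {p : ℝ × ℝ} (hp : p.2 ∈ P.I) :
    P.frameMap x y p (P.tauT p) = y p := by
  have h1 : ‖P.tauT p‖ ≠ 0 := by rw [P.norm_tauT hp]; exact (P.h₂_pos hp).ne'
  have h2 : inner ℝ (P.tauφ p) (P.tauT p) = 0 := P.inner_tauφ_tauT hp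
  simp only [frameMap, add_apply, smul_apply,
    ContinuousLinearMap.smulRight_apply, innerSL_apply_apply, h2, real_inner_self_eq_norm_sq,
    zero_smul, smul_zero, zero_add]
  rw [smul_smul, inv_mul_cancel₀ (pow_ne_zero 2 h1), one_smul]

theorem aestronglyMeasurable_frameMap {x y : ℝ × ℝ → E3}
    (hx : AEStronglyMeasurable x (volume.restrict P.rect))
    (hy : AEStronglyMeasurable y (volume.restrict P.rect)) :
    AEStronglyMeasurable (P.frameMap x y) (volume.restrict P.rect) := by
  have t1 := P.continuousOn_tauφ.aestronglyMeasurable (μ := volume) P.measurableSet_rect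
  have t2 := P.continuousOn_tauT.aestronglyMeasurable (μ := volume) P.measurableSet_rect
  have m1 : AEStronglyMeasurable (fun p => (‖P.tauφ p‖ ^ 2)⁻¹) (volume.restrict P.rect) :=
    ((t1.norm.aemeasurable.pow_const 2).inv).aestronglyMeasurable
  have m2 : AEStronglyMeasurable (fun p => (‖P.tauT p‖ ^ 2)⁻¹) (volume.restrict P.rect) :=
    ((t2.norm.aemeasurable.pow_const 2).inv).aestronglyMeasurable
  exact (AEStronglyMeasurable.innerSL_smulRight m1 t1 hx).add
    (AEStronglyMeasurable.innerSL_smulRight m2 t2 hy)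

/-- The area element h₁ h₂ and the normalization of the frame combine to the reciprocal weights
h₂/h₁ and h₁/h₂. At a pole the first is singular and the second degenerates. -/
theorem gradNormSq_mul {G : ℝ × ℝ → (E3 →L[ℝ] E3)} {p : ℝ × ℝ} (hp : p.2 ∈ P.I)
    (h : 0 < P.h₁ p.2) : P.gradNormSq G p * (P.h₁ p.2 * P.h₂ p.2) =
      P.h₂ p.2 / P.h₁ p.2 * ‖G p (P.tauφ p)‖ ^ 2 + P.h₁ p.2 / P.h₂ p.2 * ‖G p (P.tauT p)‖ ^ 2 := by
  have h2 := P.h₂_pos hp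
  simp only [gradNormSq, map_smul, norm_smul, norm_inv, P.norm_tauφ hp, P.norm_tauT hp,
    Real.norm_eq_abs, abs_of_pos h, abs_of_pos h2]
  field_simp

/-- The equivariant map generated by a curve, and its Dirichlet energy. -/
theorem isWeakGrad_revolve {σ : ℤ} (hσ : (σ : ℝ) ^ 2 = 1) {u : E3 → E3} {v V' : ℝ → E3}
    (hV : IsCurve P.a P.b (P.γ P.a = P.γ P.b) v V') {R : ℝ} (hR : ∀ t ∈ Ioo P.a P.b, ‖v t‖ ≤ R)
    (hfin : ∫⁻ t in P.I, ENNReal.ofReal (P.curveDensity v V' t) < ∞)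
    (hu : ∀ᵐ p ∂(volume.restrict P.rect), u (P.ξ p) = rot (σ * p.1) (v p.2)) :
    ∃ G, P.IsWeakGrad u G ∧ P.gradEnergy G =
      ENNReal.ofReal (2 * Real.pi) * ∫⁻ t in P.I, ENNReal.ofReal (P.curveDensity v V' t) := by
  have hab := P.a_lt_b
  have hvm : AEStronglyMeasurable v (volume.restrict P.I) := hV.aestronglyMeasurable
  have hvm' : AEStronglyMeasurable V' (volume.restrict P.I) := hV.aestronglyMeasurable_deriv
  have hmem : ∀ᵐ p ∂(volume.restrict P.rect), p.2 ∈ Ioo P.a P.b := P.ae_rect_snd P.ae_mem_Ioo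
  have hvint : IntegrableOn v P.I := by
    have : IsFiniteMeasure (volume.restrict P.I) :=
      inferInstanceAs (IsFiniteMeasure (volume.restrict (Icc P.a P.b)))
    refine Integrable.of_bound hvm R ?_
    filter_upwards [P.ae_mem_Ioo] with t ht using hR t ht
  -- In coordinates the map is L(φ) v(t), so L'(φ) v(t) and L(φ) V'(t) are the candidates for its
  -- partial derivatives. Since σ² = 1, the first has the length of the horizontal part of v(t).
  set L : ℝ → E3 →L[ℝ] E3 := fun φ => rotL (σ * φ) with hL
  set L' : ℝ → E3 →L[ℝ] E3 := fun φ => (σ : ℝ) • drotL (σ * φ) with hL'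
  have hlin : Continuous fun φ : ℝ => (σ : ℝ) * φ := by fun_prop
  have hLc : Continuous L := continuous_rotL.comp hlin
  have hLc' : Continuous L' := (continuous_drotL.comp hlin).const_smul (σ : ℝ)
  have hLd : ∀ φ x, HasDerivAt (fun φ => L φ x) (L' φ x) φ := by
    intro φ x
    have h1 : HasDerivAt (fun φ : ℝ => (σ : ℝ) * φ) σ φ := by
      simpa using (hasDerivAt_id φ).const_mul (σ : ℝ)
    have h2 := (hasDerivAt_rot (σ * φ) x).scomp φ h1
    simpa [hL, hL', rotL_apply, Function.comp_def] using h2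
  set X : ℝ × ℝ → E3 := fun p => L' p.1 (v p.2) with hX
  set Y : ℝ × ℝ → E3 := fun p => L p.1 (V' p.2) with hY
  have hXm : AEStronglyMeasurable X (volume.restrict P.rect) :=
    isBoundedBilinearMap_apply.continuous.comp_aestronglyMeasurable
      ((hLc'.comp continuous_fst).aestronglyMeasurable.prodMk (P.aestronglyMeasurable_snd hvm))
  have hYm : AEStronglyMeasurable Y (volume.restrict P.rect) :=
    isBoundedBilinearMap_apply.continuous.comp_aestronglyMeasurable
      ((hLc.comp continuous_fst).aestronglyMeasurable.prodMk (P.aestronglyMeasurable_snd hvm'))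
  have hGφ : ∀ᵐ p ∂(volume.restrict P.rect), P.frameMap X Y p (P.tauφ p) = X p := by
    filter_upwards [hmem] with p hp
    exact P.frameMap_tauφ X Y (Ioo_subset_Icc_self hp) (P.h₁_pos hp)
  have hGt : ∀ᵐ p ∂(volume.restrict P.rect), P.frameMap X Y p (P.tauT p) = Y p := by
    filter_upwards [hmem] with p hp
    exact P.frameMap_tauT X Y (Ioo_subset_Icc_self hp)
  have hen : P.gradEnergy (P.frameMap X Y) =
      ENNReal.ofReal (2 * Real.pi) * ∫⁻ t in P.I, ENNReal.ofReal (P.curveDensity v V' t) := by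
    rw [← P.lintegral_rect_snd (P.aemeasurable_curveDensity hvm hvm').ennreal_ofReal]
    unfold gradEnergy surfInt
    refine lintegral_congr_ae ?_
    filter_upwards [hmem, hGφ, hGt] with p hp h1 h2
    have hg : 0 ≤ P.gradNormSq (P.frameMap X Y) p := by unfold gradNormSq; positivity
    rw [← ENNReal.ofReal_mul hg, P.gradNormSq_mul (Ioo_subset_Icc_self hp) (P.h₁_pos hp), h1, h2]
    congr 1
    have e1 : ‖X p‖ ^ 2 = v p.2 0 ^ 2 + v p.2 1 ^ 2 := by
      simp only [hX, hL', smul_apply, norm_smul, mul_pow, norm_sq_drotL,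
        Real.norm_eq_abs, sq_abs, hσ, one_mul]
    have e2 : ‖Y p‖ = ‖V' p.2‖ := by simp only [hY, hL, rotL_apply, norm_rot]
    rw [e1, e2, curveDensity]
  have huL : ∀ᵐ p ∂(volume.restrict P.rect), u (P.ξ p) = L p.1 (v p.2) := by
    filter_upwards [hu] with p hp
    rw [hp, hL, rotL_apply]
  refine ⟨P.frameMap X Y, ⟨P.aestronglyMeasurable_frameMap hXm hYm, ?_, ?_, ?_⟩, hen⟩
  · rw [hen]; exact ENNReal.mul_lt_top ENNReal.ofReal_lt_top hfin
  · intro ψ hψ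
    have i1 := P.integrable_smul_clm (continuous_partial hψ.smooth (1, 0)) hLc measurableSet_Icc hvm
      hvint (fun _ t ht hn => absurd ht hn)
    have i2 := P.integrable_smul_clm hψ.smooth.continuous hLc' measurableSet_Icc hvm
      hvint (fun _ t ht hn => absurd ht hn)
    have e1 : ∫ p in P.rect, (fderiv ℝ ψ p (1, 0)) • u (P.ξ p) =
        ∫ p in P.rect, (fderiv ℝ ψ p (1, 0)) • L p.1 (v p.2) :=
      integral_congr_ae (by filter_upwards [huL] with p hp; rw [hp])
    have e2 : ∫ p in P.rect, ψ p • P.frameMap X Y p (P.tauφ p) =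
        ∫ p in P.rect, ψ p • L' p.1 (v p.2) :=
      integral_congr_ae (by filter_upwards [hGφ] with p hp; rw [hp])
    rw [e1, e2]
    rw [restrict_rect] at i1 i2 ⊢
    -- Integrating in φ first, for fixed `t`, the integrand is the φ-derivative of a function with
    -- equal values at 0 and 2π; no regularity in `t` is involved.
    rw [integral_prod_symm _ i1, integral_prod_symm _ i2, ← integral_neg]
    congr 1
    ext1 t
    have hd1 : ∀ φ, HasDerivAt (fun s => ψ (s, t)) (fderiv ℝ ψ (φ, t) (1, 0)) φ := fun φ =>
      hasDerivAt_partial_fst hψ.smooth (φ, t)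
    have hd : ∀ φ ∈ uIcc 0 (2 * Real.pi), HasDerivAt (fun s => ψ (s, t) • L s (v t))
        (ψ (φ, t) • L' φ (v t) + fderiv ℝ ψ (φ, t) (1, 0) • L φ (v t)) φ := fun φ _ =>
      (hd1 φ).smul (hLd φ (v t))
    have c1 : Continuous fun φ => ψ (φ, t) • L' φ (v t) :=
      (hψ.smooth.continuous.comp (by fun_prop)).smul (hLc'.clm_apply continuous_const)
    have c2 : Continuous fun φ => fderiv ℝ ψ (φ, t) (1, 0) • L φ (v t) :=
      ((continuous_partial hψ.smooth (1, 0)).comp (by fun_prop : Continuous fun φ => (φ, t))).smul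
        (hLc.clm_apply continuous_const)
    have key := intervalIntegral.integral_eq_sub_of_hasDerivAt hd
      ((c1.add c2).intervalIntegrable _ _)
    have hb : ψ (2 * Real.pi, t) • L (2 * Real.pi) (v t) = ψ (0, t) • L 0 (v t) := by
      have e1 : ψ (2 * Real.pi, t) = ψ (0, t) := by simpa using hψ.periodic 0 t
      have e2 : L (2 * Real.pi) (v t) = L 0 (v t) := by
        simp only [hL, rotL_apply, mul_zero]
        simpa using rot_add_int_mul_two_pi 0 σ (v t)
      rw [e1, e2]
    rw [hb, sub_self, intervalIntegral.integral_add (c1.intervalIntegrable _ _)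
      (c2.intervalIntegrable _ _), intervalIntegral.integral_of_le Real.two_pi_pos.le,
      intervalIntegral.integral_of_le Real.two_pi_pos.le, ← integral_Icc_eq_integral_Ioc,
      ← integral_Icc_eq_integral_Ioc] at key
    rw [eq_neg_iff_add_eq_zero, add_comm]
    exact key
  · intro ψ hψ
    -- Unless the profile is a loop, `V'` need not be integrable up to the ends of the interval. It
    -- is integrable on a set `J` off which the test function vanishes.
    obtain ⟨J, hJ, hJI, hz⟩ : ∃ J, MeasurableSet J ∧ IntegrableOn V' J ∧
        ∀ φ, ∀ t ∈ P.I, t ∉ J → ψ (φ, t) = 0 := by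
      rcases hψ.boundary with ⟨hl, -⟩ | ⟨c, d, hc, hd, hcd⟩
      · exact ⟨P.I, measurableSet_Icc, hV.integrableOn_deriv_of_loop hab.le hl,
          fun _ t ht hn => absurd ht hn⟩
      · refine ⟨Icc c d, measurableSet_Icc, hV.integrableOn_deriv hc hd, fun φ t _ hn => ?_⟩
        by_contra hne
        exact hn (hcd φ t hne)
    have i1 := P.integrable_smul_clm (continuous_partial hψ.smooth (0, 1)) hLc measurableSet_Icc hvm
      hvint (fun _ t ht hn => absurd ht hn)
    have i2 := P.integrable_smul_clm hψ.smooth.continuous hLc hJ hvm' hJI hz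
    have e1 : ∫ p in P.rect, (fderiv ℝ ψ p (0, 1)) • u (P.ξ p) =
        ∫ p in P.rect, (fderiv ℝ ψ p (0, 1)) • L p.1 (v p.2) :=
      integral_congr_ae (by filter_upwards [huL] with p hp; rw [hp])
    have e2 : ∫ p in P.rect, ψ p • P.frameMap X Y p (P.tauT p) =
        ∫ p in P.rect, ψ p • L p.1 (V' p.2) :=
      integral_congr_ae (by filter_upwards [hGt] with p hp; rw [hp])
    rw [e1, e2]
    rw [restrict_rect] at i1 i2 ⊢
    rw [integral_prod _ i1, integral_prod _ i2, ← integral_neg]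
    congr 1
    ext1 φ
    have hder : ∀ t, deriv (fun t => ψ (φ, t)) t = fderiv ℝ ψ (φ, t) (0, 1) := fun t =>
      (hasDerivAt_partial_snd hψ.smooth (φ, t)).deriv
    have hc1 : Continuous fun t => ψ (φ, t) := hψ.smooth.continuous.comp (by fun_prop)
    have hc2 : Continuous fun t => fderiv ℝ ψ (φ, t) (0, 1) :=
      (continuous_partial hψ.smooth (0, 1)).comp (by fun_prop : Continuous fun t => (φ, t))
    have j1 : IntegrableOn (fun t => fderiv ℝ ψ (φ, t) (0, 1) • v t) P.I :=
      IntegrableOn.continuousOn_smul hvint hc2.continuousOn isCompact_Icc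
    have j2 : IntegrableOn (fun t => ψ (φ, t) • V' t) P.I := by
      obtain ⟨C, hC⟩ := (isCompact_Icc (a := P.a) (b := P.b)).exists_bound_of_continuousOn
        hc1.continuousOn
      have hk : Integrable (J.indicator fun t => C * ‖V' t‖) (volume.restrict (Icc P.a P.b)) :=
        ((integrable_indicator_iff hJ).2 (hJI.norm.const_mul C)).integrableOn
      refine hk.mono' (hc1.aestronglyMeasurable.smul hvm') ?_
      filter_upwards [ae_restrict_mem measurableSet_Icc] with t ht
      by_cases hm : t ∈ J
      · rw [indicator_of_mem hm, norm_smul]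
        gcongr
        exact hC t ht
      · rw [indicator_of_notMem hm, hz φ t ht hm]
        simp
    have key := hV.integral_deriv_smul hab (hψ.isTest1 φ) (by simp only [hder]; exact j1) j2
    simp only [hder] at key
    -- For fixed φ the rotation is a constant linear map, so the claim reduces to integration by
    -- parts along the curve.
    have k1 : ∫ t in P.I, fderiv ℝ ψ (φ, t) (0, 1) • L φ (v t) =
        L φ (∫ t in P.I, fderiv ℝ ψ (φ, t) (0, 1) • v t) := by
      rw [← (L φ).integral_comp_comm j1]; simp only [map_smul]
    have k2 : ∫ t in P.I, ψ (φ, t) • L φ (V' t) = L φ (∫ t in P.I, ψ (φ, t) • V' t) := by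
      rw [← (L φ).integral_comp_comm j2]; simp only [map_smul]
    rw [k1, k2, ← map_neg]
    exact congrArg _ key

end RevolutionProfile

/-! ### The energy of an equivariant map -/

theorem cross_e3 (v : E3) : cross v e3 = !₂[v 1, -v 0, 0] := by
  ext i
  fin_cases i <;> simp [cross, e3, crossProduct]

theorem norm_sq_cross_e3 (v : E3) : ‖cross v e3‖ ^ 2 = v 0 ^ 2 + v 1 ^ 2 := by
  rw [cross_e3, norm_sq_eq_coords]
  simp
  ring

theorem cross_e3_eq_zero_iff (v : E3) : cross v e3 = 0 ↔ v 0 ^ 2 + v 1 ^ 2 = 0 := by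
  rw [← norm_sq_cross_e3, sq_eq_zero_iff, norm_eq_zero]

/-- Over a full turn the horizontal part of a rotated vector averages to zero, whichever the sense
of rotation. This is why equivariant maps pay no penalty. -/
theorem cross_integral_rot {σ : ℤ} (hσ : (σ : ℝ) ^ 2 = 1) (φ : ℝ) (v : E3) :
    cross ((2 * Real.pi)⁻¹ • ∫ θ in (0 : ℝ)..(2 * Real.pi), rot (σ * (θ + φ)) v) e3 = 0 := by
  have hlin : Continuous fun θ : ℝ => (σ : ℝ) * (θ + φ) := by fun_prop
  have hcont : Continuous fun θ : ℝ => rot (σ * (θ + φ)) v := by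
    simp_rw [← rotL_apply]
    exact (continuous_rotL.comp hlin).clm_apply continuous_const
  have hd : ∀ θ : ℝ, HasDerivAt (fun θ : ℝ => (σ : ℝ) * (θ + φ)) σ θ := fun θ => by
    simpa using ((hasDerivAt_id θ).add_const φ).const_mul (σ : ℝ)
  have hcomp : ∀ i, (∫ θ in (0 : ℝ)..(2 * Real.pi), rot (σ * (θ + φ)) v) i =
      ∫ θ in (0 : ℝ)..(2 * Real.pi), rot (σ * (θ + φ)) v i := by
    intro i
    rw [intervalIntegral.integral_of_le Real.two_pi_pos.le,
      intervalIntegral.integral_of_le Real.two_pi_pos.le]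
    exact integral_apply_E3 (hcont.integrableOn_Ioc) i
  have hper : (σ : ℝ) * (2 * Real.pi + φ) = σ * (0 + φ) + σ * (2 * Real.pi) := by ring
  have e0 : ∫ θ in (0 : ℝ)..(2 * Real.pi), rot (σ * (θ + φ)) v 0 = 0 := by
    -- The antiderivative carries the factor 1/σ, which equals σ because σ² = 1.
    rw [intervalIntegral.integral_eq_sub_of_hasDerivAt (f := fun θ : ℝ =>
      (σ : ℝ) * (Real.sin (σ * (θ + φ)) * v 0 + Real.cos (σ * (θ + φ)) * v 1))
      (f' := fun θ => rot (σ * (θ + φ)) v 0)]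
    · rw [hper, Real.sin_add_int_mul_two_pi, Real.cos_add_int_mul_two_pi, sub_self]
    · intro θ _
      refine ((((hd θ).sin.mul_const (v 0)).add ((hd θ).cos.mul_const (v 1))).const_mul (σ : ℝ)).congr_deriv ?_
      simp only [rot_apply_zero]
      linear_combination (Real.cos (σ * (θ + φ)) * v 0 - Real.sin (σ * (θ + φ)) * v 1) * hσ
    · exact ((continuous_apply_E3 0).comp hcont).intervalIntegrable _ _
  have e1 : ∫ θ in (0 : ℝ)..(2 * Real.pi), rot (σ * (θ + φ)) v 1 = 0 := by
    rw [intervalIntegral.integral_eq_sub_of_hasDerivAt (f := fun θ : ℝ =>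
      (σ : ℝ) * (Real.sin (σ * (θ + φ)) * v 1 - Real.cos (σ * (θ + φ)) * v 0))
      (f' := fun θ => rot (σ * (θ + φ)) v 1)]
    · rw [hper, Real.sin_add_int_mul_two_pi, Real.cos_add_int_mul_two_pi, sub_self]
    · intro θ _
      refine ((((hd θ).sin.mul_const (v 1)).sub ((hd θ).cos.mul_const (v 0))).const_mul (σ : ℝ)).congr_deriv ?_
      simp only [rot_apply_one]
      linear_combination (Real.cos (σ * (θ + φ)) * v 1 + Real.sin (σ * (θ + φ)) * v 0) * hσ
    · exact ((continuous_apply_E3 1).comp hcont).intervalIntegrable _ _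
  rw [cross_e3_eq_zero_iff, PiLp.smul_apply, PiLp.smul_apply, hcomp, hcomp, e0, e1]
  simp

namespace RevolutionProfile

variable (P Q : RevolutionProfile)

/-- The energy, up to the factor `2π`, of the equivariant map generated by the curve `v`. -/
noncomputable def curveEnergy (g : ℝ → ℝ) (a : E3 → E3) (v v' : ℝ → E3) : ℝ≥0∞ :=
  ∫⁻ t in P.I, ENNReal.ofReal
    (P.curveDensity v v' t + P.h₁ t * P.h₂ t * g (inner ℝ (v t) (a (P.γ t))))

theorem aemeasurable_inner {a : E3 → E3} (ha : ContinuousOn a P.surface) {v : ℝ → E3}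
    (hv : AEStronglyMeasurable v (volume.restrict P.I)) :
    AEMeasurable (fun t => inner ℝ (v t) (a (P.γ t))) (volume.restrict P.I) := by
  have h : ContinuousOn (fun t => a (P.γ t)) P.I :=
    ha.comp P.continuousOn_γ fun t ht => P.γ_mem_surface ht
  exact (hv.inner (h.aestronglyMeasurable measurableSet_Icc)).aemeasurable

theorem surfInt_lt_top_of_bounded {f : ℝ × ℝ → ℝ≥0∞} {C : ℝ}
    (h : ∀ p ∈ P.rect, f p ≤ ENNReal.ofReal C) : P.surfInt f < ∞ := by
  obtain ⟨c, D, -, hD⟩ := P.exists_h₂_bounds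
  obtain ⟨E, hE0, hE⟩ := P.exists_h₁_le
  have h1 : P.surfInt f ≤ ∫⁻ _ in P.rect, ENNReal.ofReal C * ENNReal.ofReal (E * D) := by
    refine setLIntegral_mono' P.measurableSet_rect fun p hp => ?_
    have h0 : 0 ≤ P.h₂ p.2 := norm_nonneg _
    exact mul_le_mul' (h p hp) (ENNReal.ofReal_le_ofReal
      (mul_le_mul (hE _ hp.2) (hD _ hp.2).2 h0 hE0.le))
  refine h1.trans_lt ?_
  rw [lintegral_const]
  refine ENNReal.mul_lt_top (ENNReal.mul_lt_top ENNReal.ofReal_lt_top ENNReal.ofReal_lt_top) ?_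
  rw [Measure.restrict_apply_univ]
  exact P.isCompact_rect.measure_lt_top

/-- The source of all competitors. Two versions of the curve occur: `v` fixes the values of the map
at every point off the axis, as membership in T and the explicit formula are pointwise statements,
while `V` is an absolutely continuous representative, which carries the gradient. The hypothesis
`hpole` supplies a rotation-invariant value at the poles. -/
theorem exists_revolve {σ : ℤ} (hσ : (σ : ℝ) ^ 2 = 1) (ω : E3 → ℝ) {g : ℝ → ℝ} (hg : Continuous g)
    (hg0 : ∀ s, 0 ≤ g s) {a : E3 → E3} (ha : ContinuousOn a P.surface)
    (has : TwistedSymmetric σ P.surface a) {v V V' : ℝ → E3}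
    (hv : ∀ t ∈ P.I, 0 < P.h₁ t → v t ∈ Q.surface) (hvl : P.γ P.a = P.γ P.b → v P.a = v P.b)
    (hV : IsCurve P.a P.b (P.γ P.a = P.γ P.b) V V') (hVQ : ∀ t ∈ Ioo P.a P.b, V t ∈ Q.surface)
    (hvV : ∀ᵐ t ∂(volume.restrict P.I), v t = V t) (hfin : P.curveEnergy g a V V' < ∞)
    (hpole : ∀ t ∈ P.I, P.h₁ t = 0 → ∃ q ∈ Q.surface, q 0 = 0 ∧ q 1 = 0) :
    ∃ u, P.MemH1To Q.surface u ∧ TwistedSymmetric σ P.surface u ∧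
      (∀ φ, ∀ t ∈ P.I, 0 < P.h₁ t → u (P.ξ (φ, t)) = rot (σ * φ) (v t)) ∧
      P.energy ω g a u ≤ ENNReal.ofReal (2 * Real.pi) * P.curveEnergy g a V V' := by
  obtain ⟨q₀, hq₀⟩ : ∃ q₀ : E3, ∀ t ∈ P.I, P.h₁ t = 0 → q₀ ∈ Q.surface ∧ q₀ 0 = 0 ∧ q₀ 1 = 0 := by
    by_cases h : ∃ t ∈ P.I, P.h₁ t = 0
    · obtain ⟨t, ht, h0⟩ := h
      obtain ⟨q, hq⟩ := hpole t ht h0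
      exact ⟨q, fun _ _ _ => hq⟩
    · exact ⟨0, fun t ht h0 => absurd ⟨t, ht, h0⟩ h⟩
  -- The parameter is recovered from the point of the profile; the only ambiguity is at the base
  -- point of a loop, where `hvl` makes it harmless.
  set w : E3 → E3 := fun q => v (Function.invFunOn P.γ P.I q) with hw
  have hwv : ∀ t ∈ P.I, w (P.γ t) = v t := by
    intro t ht
    have h1 : Function.invFunOn P.γ P.I (P.γ t) ∈ P.I := Function.invFunOn_mem ⟨t, ht, rfl⟩
    have h2 : P.γ (Function.invFunOn P.γ P.I (P.γ t)) = P.γ t := Function.invFunOn_eq ⟨t, ht, rfl⟩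
    simp only [hw]
    rcases P.simple _ h1 t ht h2 with h | ⟨ha, hb⟩ | ⟨hb, ha⟩
    · rw [h]
    · rw [ha, hb] at h2
      rw [ha, hb, hvl h2]
    · subst ha
      rw [hb] at h2
      rw [hb, hvl h2.symm]
  set u := revolve σ w q₀ with hu
  have huv : ∀ φ, ∀ t ∈ P.I, 0 < P.h₁ t → u (P.ξ (φ, t)) = rot (σ * φ) (v t) := by
    intro φ t ht h
    rw [hu, P.revolve_ξ σ w q₀ φ ht h, hwv t ht]
  have huQ : ∀ p ∈ P.surface, u p ∈ Q.surface := by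
    intro p hp
    obtain ⟨φ, t, ht, rfl⟩ := P.mem_surface_iff.1 hp
    rcases (P.h₁_nonneg t).eq_or_lt with h | h
    · rw [hu, P.revolve_pole _ _ _ _ ht h.symm]
      exact (hq₀ t ht h.symm).1
    · rw [huv φ t ht h]
      exact Q.rot_mem_surface _ (hv t ht h)
  have huae : ∀ᵐ p ∂(volume.restrict P.rect), u (P.ξ p) = rot (σ * p.1) (V p.2) := by
    filter_upwards [P.ae_rect_snd hvV, P.ae_rect_snd P.ae_mem_Ioo] with p h1 h2
    rw [← h1]
    exact huv p.1 p.2 (Ioo_subset_Icc_self h2) (P.h₁_pos h2)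
  obtain ⟨R, hR0, hR⟩ := Q.exists_surface_bound
  have hVm : AEStronglyMeasurable V (volume.restrict P.I) := hV.aestronglyMeasurable
  have hVm' : AEStronglyMeasurable V' (volume.restrict P.I) := hV.aestronglyMeasurable_deriv
  have hgm : AEMeasurable (fun t => P.h₁ t * P.h₂ t * g (inner ℝ (V t) (a (P.γ t))))
      (volume.restrict P.I) :=
    (P.aemeasurable_h₁.mul P.aemeasurable_h₂).mul
      (hg.measurable.comp_aemeasurable (P.aemeasurable_inner ha hVm))
  have hgnn : ∀ t, 0 ≤ P.h₁ t * P.h₂ t * g (inner ℝ (V t) (a (P.γ t))) := fun t =>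
    mul_nonneg (mul_nonneg (P.h₁_nonneg t) (norm_nonneg _)) (hg0 _)
  have hsplit : P.curveEnergy g a V V' = (∫⁻ t in P.I, ENNReal.ofReal (P.curveDensity V V' t)) +
      ∫⁻ t in P.I, ENNReal.ofReal (P.h₁ t * P.h₂ t * g (inner ℝ (V t) (a (P.γ t)))) := by
    rw [← lintegral_add_left' (P.aemeasurable_curveDensity hVm hVm').ennreal_ofReal]
    refine lintegral_congr fun t => ?_
    rw [← ENNReal.ofReal_add (P.curveDensity_nonneg _ _ _) (hgnn t)]
  have hfin' : ∫⁻ t in P.I, ENNReal.ofReal (P.curveDensity V V' t) < ∞ := by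
    rw [hsplit] at hfin
    exact (ENNReal.add_lt_top.1 hfin).1
  obtain ⟨G, hG, hGe⟩ := P.isWeakGrad_revolve hσ hV (fun t ht => hR _ (hVQ t ht)) hfin' huae
  refine ⟨u, ⟨⟨?_, ?_, G, hG⟩, huQ⟩, ?_, huv, ?_⟩
  · have hlin : Continuous fun φ : ℝ => (σ : ℝ) * φ := by fun_prop
    have h1 : AEStronglyMeasurable (fun p : ℝ × ℝ => rot (σ * p.1) (V p.2))
        (volume.restrict P.rect) := by
      simp_rw [← rotL_apply]
      exact isBoundedBilinearMap_apply.continuous.comp_aestronglyMeasurable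
        (((continuous_rotL.comp hlin).comp continuous_fst).aestronglyMeasurable.prodMk
          (P.aestronglyMeasurable_snd hVm))
    exact h1.congr (by filter_upwards [huae] with p hp using hp.symm)
  · refine P.surfInt_lt_top_of_bounded (C := R ^ 2) fun p hp => ENNReal.ofReal_le_ofReal ?_
    have := hR _ (huQ _ (P.ξ_mem_surface p.1 hp.2))
    exact pow_le_pow_left₀ (norm_nonneg _) this 2
  · exact P.twistedSymmetric_revolve σ w q₀ fun t ht h => (hq₀ t ht h).2
  · have hpen : P.penalty ω u = 0 := by
      unfold penalty surfInt
      refine (lintegral_congr_ae (g := fun _ => 0) ?_).trans lintegral_zero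
      filter_upwards [P.ae_rect_snd P.ae_mem_Ioo] with p h2
      have hI := Ioo_subset_Icc_self h2
      have h3 : circleAvg u (P.ξ p) = (2 * Real.pi)⁻¹ •
          ∫ θ in (0 : ℝ)..(2 * Real.pi), rot (σ * (θ + p.1)) (v p.2) := by
        unfold circleAvg
        congr 1
        refine intervalIntegral.integral_congr fun θ _ => ?_
        have h4 : rot θ (P.ξ p) = P.ξ (θ + p.1, p.2) := P.rot_ξ θ p.1 p.2
        simp only [h4, huv _ p.2 hI (P.h₁_pos h2)]
      rw [h3, cross_integral_rot hσ]
      simp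
    have hani : P.anisotropy g a u = ENNReal.ofReal (2 * Real.pi) *
        ∫⁻ t in P.I, ENNReal.ofReal (P.h₁ t * P.h₂ t * g (inner ℝ (V t) (a (P.γ t)))) := by
      rw [← P.lintegral_rect_snd hgm.ennreal_ofReal]
      unfold anisotropy surfInt
      refine lintegral_congr_ae ?_
      filter_upwards [huae, P.ae_rect_snd P.ae_mem_Ioo] with p h1 h2
      have h3 : a (P.ξ p) = rot (σ * p.1) (a (P.γ p.2)) :=
        has p.1 _ (P.γ_mem_surface (Ioo_subset_Icc_self h2))
      rw [h1, h3, inner_rot, ← ENNReal.ofReal_mul (hg0 _), mul_comm]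
    have hdir : P.dirichlet u ≤ P.gradEnergy G := iInf₂_le G hG
    unfold energy
    rw [hpen, add_zero, hani, hsplit, mul_add]
    gcongr
    rw [← hGe]
    exact hdir

end RevolutionProfile

/-! ### Fields with weak partial derivatives, and uniqueness of the Dirichlet energy -/

namespace RevolutionProfile

variable (P : RevolutionProfile)

/-- The density of the Dirichlet energy in the coordinates `(φ, t)` in terms of the partial
derivatives. -/
noncomputable def fieldDensity (Φ D : ℝ × ℝ → E3) (p : ℝ × ℝ) : ℝ :=
  P.h₂ p.2 / P.h₁ p.2 * ‖Φ p‖ ^ 2 + P.h₁ p.2 / P.h₂ p.2 * ‖D p‖ ^ 2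

/-- A bounded field on the parameter rectangle with weak partial derivatives `Φ` and `D` of
finite energy. -/
structure IsWeakField (M Φ D : ℝ × ℝ → E3) : Prop where
  meas : AEStronglyMeasurable M (volume.restrict P.rect)
  meas_φ : AEStronglyMeasurable Φ (volume.restrict P.rect)
  meas_t : AEStronglyMeasurable D (volume.restrict P.rect)
  bounded : ∃ R, ∀ p ∈ P.rect, ‖M p‖ ≤ R
  energy_lt_top : ∫⁻ p in P.rect, ENNReal.ofReal (P.fieldDensity Φ D p) < ∞
  weak_φ : ∀ ψ, P.IsTest ψ →
    ∫ p in P.rect, (fderiv ℝ ψ p (1, 0)) • M p = -∫ p in P.rect, ψ p • Φ p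
  weak_t : ∀ ψ, P.IsTest ψ →
    ∫ p in P.rect, (fderiv ℝ ψ p (0, 1)) • M p = -∫ p in P.rect, ψ p • D p

theorem gradEnergy_eq (G : ℝ × ℝ → (E3 →L[ℝ] E3)) : P.gradEnergy G =
    ∫⁻ p in P.rect, ENNReal.ofReal
      (P.fieldDensity (fun p => G p (P.tauφ p)) (fun p => G p (P.tauT p)) p) := by
  unfold gradEnergy surfInt
  refine lintegral_congr_ae ?_
  filter_upwards [P.ae_rect_snd P.ae_mem_Ioo] with p hp
  have hg : 0 ≤ P.gradNormSq G p := by unfold gradNormSq; positivity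
  rw [← ENNReal.ofReal_mul hg, P.gradNormSq_mul (Ioo_subset_Icc_self hp) (P.h₁_pos hp)]
  rfl

theorem IsWeakGrad.isWeakField {m : E3 → E3} {G : ℝ × ℝ → (E3 →L[ℝ] E3)}
    (hm : AEStronglyMeasurable (fun p => m (P.ξ p)) (volume.restrict P.rect))
    (hb : ∃ R, ∀ q ∈ P.surface, ‖m q‖ ≤ R) (hG : P.IsWeakGrad m G) :
    P.IsWeakField (fun p => m (P.ξ p)) (fun p => G p (P.tauφ p)) (fun p => G p (P.tauT p)) := by
  refine ⟨hm, ?_, ?_, ?_, ?_, hG.weak_φ, hG.weak_t⟩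
  · exact isBoundedBilinearMap_apply.continuous.comp_aestronglyMeasurable (hG.measurable.prodMk
      (P.continuousOn_tauφ.aestronglyMeasurable P.measurableSet_rect))
  · exact isBoundedBilinearMap_apply.continuous.comp_aestronglyMeasurable (hG.measurable.prodMk
      (P.continuousOn_tauT.aestronglyMeasurable P.measurableSet_rect))
  · obtain ⟨R, hR⟩ := hb
    exact ⟨R, fun p hp => hR _ ⟨p, hp, rfl⟩⟩
  · rw [← P.gradEnergy_eq]; exact hG.energy_lt_top

theorem _root_.MeasureTheory.memLp_two_of_sq_le {α E : Type*} [MeasurableSpace α] {μ ν : Measure α}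
    [NormedAddCommGroup E] {f : α → E} {w : α → ℝ} {K : ℝ} (hf : AEStronglyMeasurable f ν)
    (hνμ : ν ≤ μ) (hw : ∫⁻ x, ENNReal.ofReal (w x) ∂μ < ∞) (hK : 0 ≤ K)
    (hfw : ∀ᵐ x ∂ν, ‖f x‖ ^ 2 ≤ K * w x) : MemLp f 2 ν := by
  refine (memLp_two_iff_integrable_sq_norm hf).2 ⟨hf.norm.pow 2, ?_⟩
  rw [hasFiniteIntegral_iff_ofReal (ae_of_all _ fun _ => by positivity)]
  calc ∫⁻ x, ENNReal.ofReal (‖f x‖ ^ 2) ∂ν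
      ≤ ∫⁻ x, ENNReal.ofReal K * ENNReal.ofReal (w x) ∂ν := by
        refine lintegral_mono_ae ?_
        filter_upwards [hfw] with x hx
        rw [← ENNReal.ofReal_mul hK]
        exact ENNReal.ofReal_le_ofReal hx
    _ = ENNReal.ofReal K * ∫⁻ x, ENNReal.ofReal (w x) ∂ν :=
        lintegral_const_mul' _ _ ENNReal.ofReal_ne_top
    _ ≤ ENNReal.ofReal K * ∫⁻ x, ENNReal.ofReal (w x) ∂μ := by
        gcongr
    _ < ∞ := ENNReal.mul_lt_top ENNReal.ofReal_lt_top hw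

namespace IsWeakField

variable {P} {M Φ D : ℝ × ℝ → E3}

/-- The weight h₂/h₁ is bounded below by a positive constant, so ∂_φ is square-integrable up to the
poles. The weight h₁/h₂ of ∂_t vanishes there, which confines `memLp_t` to compact sets of
parameters with h₁ > 0. -/
theorem memLp_φ (h : P.IsWeakField M Φ D) : MemLp Φ 2 (volume.restrict P.rect) := by
  obtain ⟨c, C, hc, hC⟩ := P.exists_h₂_bounds
  obtain ⟨E, hE0, hE⟩ := P.exists_h₁_le
  refine memLp_two_of_sq_le h.meas_φ le_rfl h.energy_lt_top (K := E / c) (by positivity) ?_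
  filter_upwards [P.ae_rect_snd P.ae_mem_Ioo] with p hp
  have hI := Ioo_subset_Icc_self hp
  have h1 := P.h₁_pos hp
  have h2 := P.h₂_pos hI
  have h3 : 1 ≤ E / c * (P.h₂ p.2 / P.h₁ p.2) := by
    rw [div_mul_div_comm, le_div_iff₀ (by positivity)]
    nlinarith [hE _ hI, (hC _ hI).1]
  have h4 : 0 ≤ E / c * (P.h₁ p.2 / P.h₂ p.2 * ‖D p‖ ^ 2) := by positivity
  unfold fieldDensity
  nlinarith [sq_nonneg ‖Φ p‖]

theorem memLp_t (h : P.IsWeakField M Φ D) {J : Set ℝ} (hJ : IsCompact J) (hJI : J ⊆ P.I)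
    (hpos : ∀ t ∈ J, 0 < P.h₁ t) :
    MemLp D 2 (volume.restrict (Icc 0 (2 * Real.pi) ×ˢ J)) := by
  obtain ⟨c, C, hc, hC⟩ := P.exists_h₂_bounds
  obtain ⟨ε, hε, hεJ⟩ := hJ.exists_forall_le' (P.continuousOn_h₁.mono hJI) hpos
  have hsub : Icc 0 (2 * Real.pi) ×ˢ J ⊆ P.rect := prod_mono subset_rfl hJI
  have hle : (volume.restrict (Icc 0 (2 * Real.pi) ×ˢ J) : Measure (ℝ × ℝ)) ≤
      volume.restrict P.rect := Measure.restrict_mono hsub le_rfl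
  have hC0 : 0 ≤ C := hc.le.trans ((hC P.a ⟨le_rfl, P.a_lt_b.le⟩).1.trans
    (hC P.a ⟨le_rfl, P.a_lt_b.le⟩).2)
  refine memLp_two_of_sq_le (h.meas_t.mono_measure hle) hle h.energy_lt_top (K := C / ε)
    (by positivity) ?_
  filter_upwards [ae_restrict_mem (measurableSet_Icc.prod hJ.measurableSet)] with p hp
  have hI := hJI hp.2
  have h1 := hpos _ hp.2
  have h2 := P.h₂_pos hI
  have h3 : 1 ≤ C / ε * (P.h₁ p.2 / P.h₂ p.2) := by
    rw [div_mul_div_comm, le_div_iff₀ (by positivity)]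
    nlinarith [hεJ _ hp.2, (hC _ hI).2]
  have h4 : 0 ≤ C / ε * (P.h₂ p.2 / P.h₁ p.2 * ‖Φ p‖ ^ 2) := by positivity
  unfold fieldDensity
  nlinarith [sq_nonneg ‖D p‖]

theorem _root_.RevolutionProfile.isFiniteMeasure_rect :
    IsFiniteMeasure (volume.restrict P.rect : Measure (ℝ × ℝ)) :=
  ⟨by rw [Measure.restrict_apply_univ]; exact P.isCompact_rect.measure_lt_top⟩

theorem integrable (h : P.IsWeakField M Φ D) : Integrable M (volume.restrict P.rect) := by
  obtain ⟨R, hR⟩ := h.bounded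
  have := P.isFiniteMeasure_rect
  exact Integrable.of_bound h.meas R ((ae_restrict_mem P.measurableSet_rect).mono hR)

theorem integrable_φ (h : P.IsWeakField M Φ D) : Integrable Φ (volume.restrict P.rect) := by
  have := P.isFiniteMeasure_rect
  exact h.memLp_φ.integrable (by norm_num)

theorem integrableOn_t (h : P.IsWeakField M Φ D) {J : Set ℝ} (hJ : IsCompact J) (hJI : J ⊆ P.I)
    (hpos : ∀ t ∈ J, 0 < P.h₁ t) : IntegrableOn D (Icc 0 (2 * Real.pi) ×ˢ J) := by
  have : IsFiniteMeasure (volume.restrict (Icc 0 (2 * Real.pi) ×ˢ J) : Measure (ℝ × ℝ)) :=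
    ⟨by rw [Measure.restrict_apply_univ]; exact (isCompact_Icc.prod hJ).measure_lt_top⟩
  exact (h.memLp_t hJ hJI hpos).integrable (by norm_num)

theorem integrable_t_of_loop (h : P.IsWeakField M Φ D) (hl : P.γ P.a = P.γ P.b) :
    Integrable D (volume.restrict P.rect) :=
  h.integrableOn_t isCompact_Icc subset_rfl fun t ht =>
    lt_of_le_of_ne (P.h₁_nonneg t) fun h0 => P.not_loop_of_pole ht h0.symm hl

theorem strip (h : P.IsWeakField M Φ D) (i : Fin 3) :
    StripIntegrable (fun p => M p i) P.a P.b :=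
  .of_integrableOn (integrable_E3_iff.1 h.integrable i)

theorem strip_φ (h : P.IsWeakField M Φ D) (i : Fin 3) :
    StripIntegrable (fun p => Φ p i) P.a P.b :=
  .of_integrableOn (integrable_E3_iff.1 h.integrable_φ i)

theorem strip_t (h : P.IsWeakField M Φ D) (i : Fin 3) :
    StripIntegrable (fun p => D p i) P.a P.b := fun c d hc hd =>
  integrable_E3_iff.1 (h.integrableOn_t (isCompact_Icc (a := c) (b := d))
    (Icc_subset_Icc hc.le hd.le) fun _ ht => P.h₁_pos ⟨hc.trans_le ht.1, ht.2.trans_lt hd⟩) i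

/-- Products of a mode in φ with a cut-off in `t` suffice as test functions: they reduce the weak
equations to statements on Fourier coefficients of circles of latitude. -/
theorem _root_.RevolutionProfile.isTest_trig_mul (j : Bool × ℤ) {χ : ℝ → ℝ}
    (hχ : IsTest1 P.a P.b (P.γ P.a = P.γ P.b) χ) : P.IsTest fun p => trig j p.1 * χ p.2 := by
  refine ⟨((contDiff_trig j).comp contDiff_fst).mul (hχ.1.comp contDiff_snd), ?_, ?_⟩
  · intro φ t
    simp only [trig_add_two_pi]
  · rcases hχ.2 with ⟨hl, he⟩ | ⟨c, d, hc, hd, hcd⟩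
    · exact Or.inl ⟨hl, fun φ => by simp only [he]⟩
    · exact Or.inr ⟨c, d, hc, hd, fun φ t ht => hcd t (right_ne_zero_of_mul ht)⟩

theorem _root_.IsBump.isTest1 {a b : ℝ} {χ : ℝ → ℝ} (h : IsBump a b χ) (loop : Prop) :
    IsTest1 a b loop χ := by
  obtain ⟨hs, c, d, hac, hdb, hcd⟩ := h
  exact ⟨hs, Or.inr ⟨c, d, hac, hdb, hcd⟩⟩

theorem integrable_test_smul_t (h : P.IsWeakField M Φ D) {ψ : ℝ × ℝ → ℝ} (hψ : P.IsTest ψ) :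
    Integrable (fun p => ψ p • D p) (volume.restrict P.rect) := by
  have hc : Continuous ψ := hψ.smooth.continuous
  rcases hψ.boundary with ⟨hl, -⟩ | ⟨c, d, hac, hdb, hcd⟩
  · exact IntegrableOn.continuousOn_smul (h.integrable_t_of_loop hl) hc.continuousOn P.isCompact_rect
  · have h1 : IntegrableOn (fun p => ψ p • D p) (Icc 0 (2 * Real.pi) ×ˢ Icc c d) :=
      IntegrableOn.continuousOn_smul (h.integrableOn_t (isCompact_Icc (a := c) (b := d))
        (Icc_subset_Icc hac.le hdb.le)
        fun _ ht => P.h₁_pos ⟨hac.trans_le ht.1, ht.2.trans_lt hdb⟩) hc.continuousOn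
        (isCompact_Icc.prod isCompact_Icc)
    refine h1.of_forall_sdiff_eq_zero P.measurableSet_rect ?_
    rintro ⟨φ, t⟩ ⟨hp, hn⟩
    have : ψ (φ, t) = 0 := by
      by_contra hne; exact hn ⟨hp.1, hcd φ t hne⟩
    simp [this]

theorem integral_trig'_mul (h : P.IsWeakField M Φ D) (j : Bool × ℤ) {χ : ℝ → ℝ}
    (hχ : IsTest1 P.a P.b (P.γ P.a = P.γ P.b) χ) (i : Fin 3) :
    ∫ p in P.rect, χ p.2 * (trig' j p.1 * M p i) = -∫ p in P.rect, χ p.2 * (trig j p.1 * Φ p i) := by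
  have hψ := P.isTest_trig_mul j hχ
  have hd : ∀ p : ℝ × ℝ, fderiv ℝ (fun p : ℝ × ℝ => trig j p.1 * χ p.2) p (1, 0) =
      trig' j p.1 * χ p.2 := fun p =>
    (hasDerivAt_partial_fst hψ.smooth p).unique ((hasDerivAt_trig j p.1).mul_const (χ p.2))
  have hc : Continuous fun p : ℝ × ℝ => fderiv ℝ (fun p : ℝ × ℝ => trig j p.1 * χ p.2) p (1, 0) :=
    continuous_partial hψ.smooth _
  have key := congrArg (fun v : E3 => v i) (h.weak_φ _ hψ)
  simp only [PiLp.neg_apply] at key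
  rw [integral_apply_E3 (IntegrableOn.continuousOn_smul h.integrable hc.continuousOn
      P.isCompact_rect) i, integral_apply_E3 (IntegrableOn.continuousOn_smul h.integrable_φ
      hψ.smooth.continuous.continuousOn P.isCompact_rect) i] at key
  simp only [PiLp.smul_apply, smul_eq_mul, hd] at key
  refine ((?_ : _ = _).trans key).trans (congrArg Neg.neg ?_)
  · exact integral_congr_ae (ae_of_all _ fun p => by ring)
  · exact integral_congr_ae (ae_of_all _ fun p => by ring)

theorem integral_deriv_mul (h : P.IsWeakField M Φ D) (j : Bool × ℤ) {χ : ℝ → ℝ}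
    (hχ : IsTest1 P.a P.b (P.γ P.a = P.γ P.b) χ) (i : Fin 3) :
    ∫ p in P.rect, deriv χ p.2 * (trig j p.1 * M p i) =
      -∫ p in P.rect, χ p.2 * (trig j p.1 * D p i) := by
  have hψ := P.isTest_trig_mul j hχ
  have hd : ∀ p : ℝ × ℝ, fderiv ℝ (fun p : ℝ × ℝ => trig j p.1 * χ p.2) p (0, 1) =
      trig j p.1 * deriv χ p.2 := fun p =>
    (hasDerivAt_partial_snd hψ.smooth p).unique
      (((hχ.1.differentiable (by simp) p.2).hasDerivAt).const_mul (trig j p.1))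
  have hc : Continuous fun p : ℝ × ℝ => fderiv ℝ (fun p : ℝ × ℝ => trig j p.1 * χ p.2) p (0, 1) :=
    continuous_partial hψ.smooth _
  have key := congrArg (fun v : E3 => v i) (h.weak_t _ hψ)
  simp only [PiLp.neg_apply] at key
  rw [integral_apply_E3 (IntegrableOn.continuousOn_smul h.integrable hc.continuousOn
      P.isCompact_rect) i, integral_apply_E3 (h.integrable_test_smul_t hψ) i] at key
  simp only [PiLp.smul_apply, smul_eq_mul, hd] at key
  refine ((?_ : _ = _).trans key).trans (congrArg Neg.neg ?_)
  · exact integral_congr_ae (ae_of_all _ fun p => by ring)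
  · exact integral_congr_ae (ae_of_all _ fun p => by ring)

/-- On almost every circle of latitude, `Φ` is the periodic weak derivative of `M`. -/
theorem ae_isPeriodicWeakDeriv (h : P.IsWeakField M Φ D) (i : Fin 3) :
    ∀ᵐ t ∂(volume.restrict P.I),
      IsPeriodicWeakDeriv (fun φ => M (φ, t) i) (fun φ => Φ (φ, t) i) := by
  have h1 : ∀ j, ∀ᵐ t, t ∈ Ioo P.a P.b →
      ∫ φ in Icc 0 (2 * Real.pi), (trig' j φ * M (φ, t) i + trig j φ * Φ (φ, t) i) = 0 := by
    intro j
    have s1 := (h.strip i).continuous_mul (continuous_trig' j)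
    have s2 := (h.strip_φ i).continuous_mul (continuous_trig j)
    refine (s1.add s2).ae_integral_eq_zero fun χ hχ => ?_
    have i1 : Integrable (fun p : ℝ × ℝ => χ p.2 * (trig' j p.1 * M p i))
        (volume.restrict P.rect) := by
      refine IntegrableOn.continuousOn_mul (hχ.1.continuous.comp continuous_snd).continuousOn
        ?_ P.isCompact_rect
      exact IntegrableOn.continuousOn_mul ((continuous_trig' j).comp continuous_fst).continuousOn
        (integrable_E3_iff.1 h.integrable i) P.isCompact_rect
    have i2 : Integrable (fun p : ℝ × ℝ => χ p.2 * (trig j p.1 * Φ p i))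
        (volume.restrict P.rect) := by
      refine IntegrableOn.continuousOn_mul (hχ.1.continuous.comp continuous_snd).continuousOn
        ?_ P.isCompact_rect
      exact IntegrableOn.continuousOn_mul ((continuous_trig j).comp continuous_fst).continuousOn
        (integrable_E3_iff.1 h.integrable_φ i) P.isCompact_rect
    simp only [mul_add]
    change ∫ p in P.rect, _ = 0
    rw [integral_add i1 i2, h.integral_trig'_mul j (hχ.isTest1 _) i, neg_add_cancel]
  have h2 := (h.strip i).ae_integrable_slice
  have h3 := (h.strip_φ i).ae_integrable_slice
  have h4 : ∀ᵐ t, t ∈ Ioo P.a P.b →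
      IsPeriodicWeakDeriv (fun φ => M (φ, t) i) (fun φ => Φ (φ, t) i) := by
    filter_upwards [ae_all_iff.2 h1, h2, h3] with t k1 k2 k3 ht j
    have k := k1 j ht
    rw [integral_add (IntegrableOn.continuousOn_mul (continuous_trig' j).continuousOn (k2 ht)
        isCompact_Icc) (IntegrableOn.continuousOn_mul (continuous_trig j).continuousOn (k3 ht)
        isCompact_Icc), integral_Icc_two_pi, integral_Icc_two_pi] at k
    exact eq_neg_of_add_eq_zero_left k
  filter_upwards [P.ae_mem_Ioo, ae_restrict_of_ae h4] with t ht k using k ht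

/-- The weak partial derivatives are unique. -/
theorem lintegral_fieldDensity_eq (h : P.IsWeakField M Φ D) {Φ₁ D₁ : ℝ × ℝ → E3}
    (h₁ : P.IsWeakField M Φ₁ D₁) : ∫⁻ p in P.rect, ENNReal.ofReal (P.fieldDensity Φ D p) =
      ∫⁻ p in P.rect, ENNReal.ofReal (P.fieldDensity Φ₁ D₁ p) := by
  have hφ : ∀ i, ∀ᵐ t, t ∈ Ioo P.a P.b → ∀ᵐ φ ∂(volume.restrict (Icc 0 (2 * Real.pi))),
      Φ (φ, t) i - Φ₁ (φ, t) i = 0 := by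
    intro i
    refine ((h.strip_φ i).sub (h₁.strip_φ i)).ae_eq_zero fun j χ hχ => ?_
    have hi : ∀ {F : ℝ × ℝ → E3}, Integrable F (volume.restrict P.rect) →
        Integrable (fun p : ℝ × ℝ => χ p.2 * (trig j p.1 * F p i)) (volume.restrict P.rect) := by
      intro F hF
      refine IntegrableOn.continuousOn_mul (hχ.1.continuous.comp continuous_snd).continuousOn
        ?_ P.isCompact_rect
      exact IntegrableOn.continuousOn_mul ((continuous_trig j).comp continuous_fst).continuousOn
        (integrable_E3_iff.1 hF i) P.isCompact_rect
    simp only [mul_sub]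
    change ∫ p in P.rect, _ = 0
    rw [integral_sub (hi h.integrable_φ) (hi h₁.integrable_φ)]
    have e1 := h.integral_trig'_mul j (hχ.isTest1 _) i
    have e2 := h₁.integral_trig'_mul j (hχ.isTest1 _) i
    linarith
  have ht : ∀ i, ∀ᵐ t, t ∈ Ioo P.a P.b → ∀ᵐ φ ∂(volume.restrict (Icc 0 (2 * Real.pi))),
      D (φ, t) i - D₁ (φ, t) i = 0 := by
    intro i
    refine ((h.strip_t i).sub (h₁.strip_t i)).ae_eq_zero fun j χ hχ => ?_
    have hψ := P.isTest_trig_mul j (hχ.isTest1 _)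
    have hi : ∀ {F : ℝ × ℝ → E3},
        Integrable (fun p => (trig j p.1 * χ p.2) • F p) (volume.restrict P.rect) →
        Integrable (fun p : ℝ × ℝ => χ p.2 * (trig j p.1 * F p i)) (volume.restrict P.rect) := by
      intro F hF
      refine (integrable_E3_iff.1 hF i).congr (ae_of_all _ fun p => ?_)
      simp only [PiLp.smul_apply, smul_eq_mul]
      ring
    simp only [mul_sub]
    change ∫ p in P.rect, _ = 0
    rw [integral_sub (hi (h.integrable_test_smul_t hψ)) (hi (h₁.integrable_test_smul_t hψ))]
    have e1 := h.integral_deriv_mul j (hχ.isTest1 _) i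
    have e2 := h₁.integral_deriv_mul j (hχ.isTest1 _) i
    linarith
  have hmeas : ∀ {F F' : ℝ × ℝ → E3}, AEStronglyMeasurable F (volume.restrict P.rect) →
      AEStronglyMeasurable F' (volume.restrict P.rect) →
      AEMeasurable (fun p => ENNReal.ofReal (P.fieldDensity F F' p)) (volume.restrict P.rect) := by
    intro F F' hF hF'
    refine AEMeasurable.ennreal_ofReal (((?_ : AEMeasurable _ _).mul ?_).add
      ((?_ : AEMeasurable _ _).mul ?_))
    · exact (P.aestronglyMeasurable_snd (P.aemeasurable_h₂.div P.aemeasurable_h₁).aestronglyMeasurable).aemeasurable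
    · exact hF.norm.aemeasurable.pow_const 2
    · exact (P.aestronglyMeasurable_snd (P.aemeasurable_h₁.div P.aemeasurable_h₂).aestronglyMeasurable).aemeasurable
    · exact hF'.norm.aemeasurable.pow_const 2
  rw [P.lintegral_rect (hmeas h.meas_φ h.meas_t), P.lintegral_rect (hmeas h₁.meas_φ h₁.meas_t)]
  refine lintegral_congr_ae ?_
  filter_upwards [P.ae_mem_Ioo, ae_restrict_of_ae (ae_all_iff.2 hφ),
    ae_restrict_of_ae (ae_all_iff.2 ht)] with t hm k1 k2
  refine lintegral_congr_ae ?_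
  filter_upwards [ae_all_iff.2 fun i => k1 i hm, ae_all_iff.2 fun i => k2 i hm] with φ q1 q2
  have e1 : Φ (φ, t) = Φ₁ (φ, t) := by
    ext i; exact sub_eq_zero.1 (q1 i)
  have e2 : D (φ, t) = D₁ (φ, t) := by
    ext i; exact sub_eq_zero.1 (q2 i)
  simp only [fieldDensity, e1, e2]

end IsWeakField

/-- By uniqueness of the weak partial derivatives all admissible gradients have the same energy, so
any one of them realizes the infimum. -/
theorem dirichlet_eq_gradEnergy {m : E3 → E3} {G : ℝ × ℝ → (E3 →L[ℝ] E3)}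
    (hm : AEStronglyMeasurable (fun p => m (P.ξ p)) (volume.restrict P.rect))
    (hb : ∃ R, ∀ q ∈ P.surface, ‖m q‖ ≤ R) (hG : P.IsWeakGrad m G) :
    P.dirichlet m = P.gradEnergy G := by
  refine le_antisymm (iInf₂_le G hG) (le_iInf₂ fun G' hG' => ?_)
  rw [P.gradEnergy_eq, P.gradEnergy_eq]
  exact ((IsWeakGrad.isWeakField P hm hb hG).lintegral_fieldDensity_eq
    (IsWeakGrad.isWeakField P hm hb hG')).le

end RevolutionProfile

/-! ### Representatives along meridians -/

theorem _root_.MeasureTheory.StronglyMeasurable.apply_E3 {α : Type*} [MeasurableSpace α]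
    {f : α → E3} (hf : StronglyMeasurable f) (i : Fin 3) : StronglyMeasurable fun x => f x i :=
  (continuous_apply_E3 i).comp_stronglyMeasurable hf

namespace IsCurve

variable {a b : ℝ} {loop : Prop} {v v' : ℝ → E3}

theorem mem_of_ae_mem (h : IsCurve a b loop v v') {C : Set E3} (hC : IsClosed C)
    (hv : ∀ᵐ t ∂(volume.restrict (Icc a b)), v t ∈ C) : ∀ t ∈ Ioo a b, v t ∈ C := by
  intro t ht
  by_contra hn
  have ho : IsOpen (Ioo a b ∩ v ⁻¹' Cᶜ) := h.continuousOn.isOpen_inter_preimage isOpen_Ioo hC.isOpen_compl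
  have hpos : 0 < volume (Ioo a b ∩ v ⁻¹' Cᶜ) := ho.measure_pos volume ⟨t, ht, hn⟩
  refine hpos.ne' (measure_mono_null ?_ (ae_iff.1 ((ae_restrict_iff' measurableSet_Icc).1 hv)))
  rintro s ⟨hs, hsC⟩ hs'
  exact hsC (hs' (Ioo_subset_Icc_self hs))

theorem rotate (h : IsCurve a b loop v v') (θ : ℝ) :
    IsCurve a b loop (fun t => rot θ (v t)) (fun t => rot θ (v' t)) := by
  have hI : ∀ s ∈ Ioo a b, ∀ t ∈ Ioo a b, ∀ i, IntervalIntegrable (fun t => v' t i) volume s t := by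
    intro s hs t ht i
    rw [intervalIntegrable_iff]
    refine ((h.locInt i).integrableOn_compact_subset (t := uIcc s t) ?_ isCompact_uIcc).mono_set
      uIoc_subset_uIcc
    exact ordConnected_Ioo.uIcc_subset hs ht
  refine ⟨fun i => ?_, fun s hs t ht i => ?_, fun hl i => ?_⟩
  · fin_cases i
    · exact ((h.locInt 0).smul (Real.cos θ)).sub ((h.locInt 1).smul (Real.sin θ))
    · exact ((h.locInt 0).smul (Real.sin θ)).add ((h.locInt 1).smul (Real.cos θ))
    · exact h.locInt 2
  · have e := h.ftc s hs t ht
    have i0 := (hI s hs t ht 0)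
    have i1 := (hI s hs t ht 1)
    fin_cases i
    · simp only [Fin.zero_eta, rot_apply_zero]
      rw [intervalIntegral.integral_sub (i0.const_mul _) (i1.const_mul _),
        intervalIntegral.integral_const_mul, intervalIntegral.integral_const_mul, ← e 0, ← e 1]
      ring
    · simp only [Fin.mk_one, rot_apply_one]
      rw [intervalIntegral.integral_add (i0.const_mul _) (i1.const_mul _),
        intervalIntegral.integral_const_mul, intervalIntegral.integral_const_mul, ← e 0, ← e 1]
      ring
    · exact e 2
  · have e := h.closes hl
    obtain ⟨i0, e0⟩ := e 0
    obtain ⟨i1, e1⟩ := e 1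
    fin_cases i
    · refine ⟨(i0.const_mul _).sub (i1.const_mul _), ?_⟩
      simp only [Fin.zero_eta, rot_apply_zero]
      rw [intervalIntegral.integral_sub (i0.const_mul _) (i1.const_mul _),
        intervalIntegral.integral_const_mul, intervalIntegral.integral_const_mul, e0, e1]
      ring
    · refine ⟨(i0.const_mul _).add (i1.const_mul _), ?_⟩
      simp only [Fin.mk_one, rot_apply_one]
      rw [intervalIntegral.integral_add (i0.const_mul _) (i1.const_mul _),
        intervalIntegral.integral_const_mul, intervalIntegral.integral_const_mul, e0, e1]
      ring
    · exact e 2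

end IsCurve

theorem StripIntegrable.congr {H₁ H₂ : ℝ × ℝ → ℝ} {a b : ℝ} (h : StripIntegrable H₁ a b)
    (he : H₁ =ᵐ[volume.restrict (Icc 0 (2 * Real.pi) ×ˢ Icc a b)] H₂) : StripIntegrable H₂ a b :=
  fun c d hc hd => (h c d hc hd).congr
    (ae_restrict_of_ae_restrict_of_subset (prod_mono subset_rfl (Icc_subset_Icc hc.le hd.le)) he)

namespace RevolutionProfile

variable {P : RevolutionProfile}

theorem ae_ae_of_ae_rect {p : ℝ × ℝ → Prop} (h : ∀ᵐ q ∂(volume.restrict P.rect), p q) :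
    ∀ᵐ φ ∂(volume.restrict (Icc 0 (2 * Real.pi))), ∀ᵐ t ∂(volume.restrict P.I), p (φ, t) := by
  rw [P.restrict_rect] at h
  exact Measure.ae_ae_of_ae_prod h

namespace IsWeakField

variable {M Φ D : ℝ × ℝ → E3}

/-- On a loop, test functions that are constant in `t` are admissible. With the modes in φ they show
that all Fourier coefficients of φ ↦ ∫ D dt vanish, so almost every meridian closes up. -/
theorem ae_integral_t_eq_zero_of_loop (h : P.IsWeakField M Φ D) (hl : P.γ P.a = P.γ P.b)
    (i : Fin 3) : ∀ᵐ φ ∂(volume.restrict (Icc 0 (2 * Real.pi))),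
      IntervalIntegrable (fun t => D (φ, t) i) volume P.a P.b ∧ ∫ t in P.a..P.b, D (φ, t) i = 0 := by
  have hD := integrable_E3_iff.1 (h.integrable_t_of_loop hl) i
  have hD' := hD
  rw [P.restrict_rect] at hD'
  have hz : (fun φ => ∫ t in P.I, D (φ, t) i) =ᵐ[volume.restrict (Ioc 0 (2 * Real.pi))] 0 := by
    refine ae_eq_zero_of_trig_coeff_eq_zero (intervalIntegrable_two_pi hD'.integral_prod_left) ?_
    intro j
    have htest : IsTest1 P.a P.b (P.γ P.a = P.γ P.b) fun _ => (1 : ℝ) :=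
      ⟨contDiff_const, Or.inl ⟨hl, rfl⟩⟩
    have key := h.integral_deriv_mul j htest i
    simp only [deriv_const', zero_mul, integral_zero, one_mul, zero_eq_neg] at key
    have hj : Integrable (fun p : ℝ × ℝ => trig j p.1 * D p i) (volume.restrict P.rect) :=
      IntegrableOn.continuousOn_mul ((continuous_trig j).comp continuous_fst).continuousOn
        hD P.isCompact_rect
    rw [P.restrict_rect] at key hj
    rw [integral_prod _ hj] at key
    simp only [integral_const_mul] at key
    rw [← integral_Icc_two_pi]
    exact key
  filter_upwards [ae_restrict_Icc_two_pi hz, hD'.prod_right_ae] with φ h1 h2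
  refine ⟨(intervalIntegrable_iff_integrableOn_Icc_of_le P.a_lt_b.le).2 h2, ?_⟩
  rw [intervalIntegral.integral_of_le P.a_lt_b.le, ← integral_Icc_eq_integral_Ioc]
  exact h1

/-- Almost every meridian carries a locally absolutely continuous representative of `M`. -/
theorem ae_exists_isCurve (h : P.IsWeakField M Φ D) :
    ∀ᵐ φ ∂(volume.restrict (Icc 0 (2 * Real.pi))), ∃ V,
      IsCurve P.a P.b (P.γ P.a = P.γ P.b) V (fun t => D (φ, t)) ∧
      ∀ᵐ t ∂(volume.restrict P.I), M (φ, t) = V t := by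
  set c₀ := (P.a + P.b) / 2 with hc₀
  have hab := P.a_lt_b
  have hc₀m : c₀ ∈ Ioo P.a P.b := ⟨by linarith, by linarith⟩
  -- Strongly measurable versions are needed for the theorem on fibers; the result is carried back
  -- to `M` and `D` by Fubini's theorem.
  obtain ⟨M₁, hM₁, hM⟩ := h.meas
  obtain ⟨D₁, hD₁, hD⟩ := h.meas_t
  have hMi : ∀ i, (fun p => M p i) =ᵐ[volume.restrict P.rect] fun p => M₁ p i := fun i => by
    filter_upwards [hM] with p hp using by rw [hp]
  have hDi : ∀ i, (fun p => D p i) =ᵐ[volume.restrict P.rect] fun p => D₁ p i := fun i => by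
    filter_upwards [hD] with p hp using by rw [hp]
  have key : ∀ i, ∀ᵐ φ ∂(volume.restrict (Icc 0 (2 * Real.pi))), ∃ k, ∀ᵐ t, t ∈ Ioo P.a P.b →
      M₁ (φ, t) i = k + ∫ s in c₀..t, D₁ (φ, s) i := by
    intro i
    have m1 : StronglyMeasurable fun p => M₁ p i := hM₁.apply_E3 i
    have m2 : StronglyMeasurable fun p => D₁ p i := hD₁.apply_E3 i
    have s1 : StripIntegrable (fun p => M₁ p i) P.a P.b := (h.strip i).congr (hMi i)
    have s2 : StripIntegrable (fun p => D₁ p i) P.a P.b := (h.strip_t i).congr (hDi i)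
    refine ae_fiber_eq_add_integral (f := fun p => M₁ p i) (d := fun p => D₁ p i)
      hc₀m m1 m2 s1 s2 fun j χ hχ => ?_
    have e := h.integral_deriv_mul j (hχ.isTest1 _) i
    refine ((?_ : _ = _).trans e).trans (congrArg Neg.neg ?_)
    · refine integral_congr_ae ?_
      filter_upwards [hMi i] with p hp using by simp only [hp]
    · refine integral_congr_ae ?_
      filter_upwards [hDi i] with p hp using by simp only [hp]
  have hloop : ∀ i, ∀ᵐ φ ∂(volume.restrict (Icc 0 (2 * Real.pi))), P.γ P.a = P.γ P.b →
      IntervalIntegrable (fun t => D (φ, t) i) volume P.a P.b ∧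
        ∫ t in P.a..P.b, D (φ, t) i = 0 := by
    intro i
    by_cases hl : P.γ P.a = P.γ P.b
    · filter_upwards [h.ae_integral_t_eq_zero_of_loop hl i] with φ hφ _ using hφ
    · exact ae_of_all _ fun _ h' => absurd h' hl
  filter_upwards [ae_all_iff.2 key, ae_all_iff.2 hloop, ae_ae_of_ae_rect hM, ae_ae_of_ae_rect hD,
    ae_all_iff.2 fun i => (h.strip_t i).ae_integrableOn_fiber] with φ k1 k2 k3 k4 k5
  choose k hk using k1
  have hloc : ∀ i, LocallyIntegrableOn (fun t => D (φ, t) i) (Ioo P.a P.b) := by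
    intro i t ht
    exact ⟨_, mem_nhdsWithin_of_mem_nhds (Icc_mem_nhds (a := (P.a + t) / 2) (b := (t + P.b) / 2)
      (by linarith [ht.1]) (by linarith [ht.2])),
      k5 i _ _ (by linarith [ht.1]) (by linarith [ht.2])⟩
  have hint : ∀ s ∈ Ioo P.a P.b, ∀ t ∈ Ioo P.a P.b, ∀ i,
      IntervalIntegrable (fun t => D (φ, t) i) volume s t := by
    intro s hs t ht i
    rw [intervalIntegrable_iff]
    refine ((hloc i).integrableOn_compact_subset (t := uIcc s t) ?_ isCompact_uIcc).mono_set
      uIoc_subset_uIcc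
    exact ordConnected_Ioo.uIcc_subset hs ht
  refine ⟨fun t => WithLp.toLp 2 fun i => k i + ∫ s in c₀..t, D (φ, s) i, ⟨hloc, ?_, fun hl i => k2 i hl⟩, ?_⟩
  · intro s hs t ht i
    simp only
    rw [← intervalIntegral.integral_interval_sub_left (hint _ hc₀m _ ht i) (hint _ hc₀m _ hs i)]
    ring
  · have k4' : ∀ᵐ s, s ∈ P.I → D (φ, s) = D₁ (φ, s) := (ae_restrict_iff' measurableSet_Icc).1 k4
    filter_upwards [k3, P.ae_mem_Ioo, ae_restrict_of_ae (ae_all_iff.2 hk)] with t q1 q2 q3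
    ext i
    rw [q1, q3 i q2]
    simp only
    congr 1
    refine intervalIntegral.integral_congr_ae ?_
    filter_upwards [k4'] with s hs hm
    rw [hs (Ioo_subset_Icc_self (ordConnected_Ioo.uIcc_subset hc₀m q2 (uIoc_subset_uIcc hm)))]

end IsWeakField

end RevolutionProfile

/-! ### The comparison on one circle of latitude -/

section Circle

variable {u p : ℝ → E3}

theorem norm_sq_integral_two_pi (hp : ∀ i, MemLp (fun φ => p φ i) 2 (volume.restrict (Ioc 0 (2 * Real.pi)))) :
    ∫ φ in (0 : ℝ)..(2 * Real.pi), ‖p φ‖ ^ 2 = (∫ φ in (0 : ℝ)..(2 * Real.pi), p φ 0 ^ 2) +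
      (∫ φ in (0 : ℝ)..(2 * Real.pi), p φ 1 ^ 2) + ∫ φ in (0 : ℝ)..(2 * Real.pi), p φ 2 ^ 2 := by
  have h : ∀ i, IntervalIntegrable (fun φ => p φ i ^ 2) volume 0 (2 * Real.pi) := fun i =>
    (intervalIntegrable_iff_integrableOn_Ioc_of_le Real.two_pi_pos.le).2 (hp i).integrable_sq
  rw [← intervalIntegral.integral_add (h 0) (h 1), ← intervalIntegral.integral_add ((h 0).add (h 1)) (h 2)]
  simp only [norm_sq_eq_coords]

/-- Wirtinger's inequality for the horizontal part of a periodic field. -/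
theorem integral_horizontal_sq_le (hu : ∀ i, MemLp (fun φ => u φ i) 2 (volume.restrict (Ioc 0 (2 * Real.pi))))
    (hp : ∀ i, MemLp (fun φ => p φ i) 2 (volume.restrict (Ioc 0 (2 * Real.pi))))
    (h : ∀ i, IsPeriodicWeakDeriv (fun φ => u φ i) fun φ => p φ i) :
    (∫ φ in (0 : ℝ)..(2 * Real.pi), u φ 0 ^ 2) + (∫ φ in (0 : ℝ)..(2 * Real.pi), u φ 1 ^ 2) ≤
      (∫ φ in (0 : ℝ)..(2 * Real.pi), ‖p φ‖ ^ 2) + (2 * Real.pi)⁻¹ *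
        ((∫ φ in (0 : ℝ)..(2 * Real.pi), u φ 0) ^ 2 + (∫ φ in (0 : ℝ)..(2 * Real.pi), u φ 1) ^ 2) := by
  have h0 := (h 0).integral_sq_le (hu 0) (hp 0)
  have h1 := (h 1).integral_sq_le (hu 1) (hp 1)
  have h2 : 0 ≤ ∫ φ in (0 : ℝ)..(2 * Real.pi), p φ 2 ^ 2 :=
    intervalIntegral.integral_nonneg Real.two_pi_pos.le fun _ _ => sq_nonneg _
  rw [norm_sq_integral_two_pi hp]
  linarith

/-- The cosine coefficient of the first modes of a field. -/
noncomputable def cosCoeff (f : ℝ → ℝ) : ℝ :=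
  Real.pi⁻¹ * ∫ s in (0 : ℝ)..(2 * Real.pi), Real.cos s * f s

/-- The sine coefficient of the first modes of a field. -/
noncomputable def sinCoeff (f : ℝ → ℝ) : ℝ :=
  Real.pi⁻¹ * ∫ s in (0 : ℝ)..(2 * Real.pi), Real.sin s * f s

/-- The mean value. -/
noncomputable def meanCoeff (f : ℝ → ℝ) : ℝ :=
  (2 * Real.pi)⁻¹ * ∫ s in (0 : ℝ)..(2 * Real.pi), f s

/-- Equality for the sum forces equality in Wirtinger's inequality for each horizontal component,
and forces the derivative of the vertical component, which was discarded in the estimate, to vanish.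
-/
theorem ae_eq_modes_of_integral_sq_eq
    (hu : ∀ i, MemLp (fun φ => u φ i) 2 (volume.restrict (Ioc 0 (2 * Real.pi))))
    (hp : ∀ i, MemLp (fun φ => p φ i) 2 (volume.restrict (Ioc 0 (2 * Real.pi))))
    (h : ∀ i, IsPeriodicWeakDeriv (fun φ => u φ i) fun φ => p φ i)
    (z0 : ∫ φ in (0 : ℝ)..(2 * Real.pi), u φ 0 = 0) (z1 : ∫ φ in (0 : ℝ)..(2 * Real.pi), u φ 1 = 0)
    (heq : (∫ φ in (0 : ℝ)..(2 * Real.pi), u φ 0 ^ 2) + (∫ φ in (0 : ℝ)..(2 * Real.pi), u φ 1 ^ 2) =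
      ∫ φ in (0 : ℝ)..(2 * Real.pi), ‖p φ‖ ^ 2) :
    ∀ᵐ φ ∂(volume.restrict (Ioc 0 (2 * Real.pi))),
      u φ 0 = cosCoeff (fun s => u s 0) * Real.cos φ + sinCoeff (fun s => u s 0) * Real.sin φ ∧
      u φ 1 = cosCoeff (fun s => u s 1) * Real.cos φ + sinCoeff (fun s => u s 1) * Real.sin φ ∧
      u φ 2 = meanCoeff fun s => u s 2 := by
  have hui : ∀ i, IntervalIntegrable (fun φ => u φ i) volume 0 (2 * Real.pi) := fun i =>
    intervalIntegrable_of_memLp_two Real.two_pi_pos.le (hu i)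
  have h0 := (h 0).integral_sq_le (hu 0) (hp 0)
  have h1 := (h 1).integral_sq_le (hu 1) (hp 1)
  have h2 : 0 ≤ ∫ φ in (0 : ℝ)..(2 * Real.pi), p φ 2 ^ 2 :=
    intervalIntegral.integral_nonneg Real.two_pi_pos.le fun _ _ => sq_nonneg _
  rw [norm_sq_integral_two_pi hp] at heq
  rw [z0] at h0
  rw [z1] at h1
  have e0 : ∫ φ in (0 : ℝ)..(2 * Real.pi), u φ 0 ^ 2 = (∫ φ in (0 : ℝ)..(2 * Real.pi), p φ 0 ^ 2) +
      (2 * Real.pi)⁻¹ * (∫ φ in (0 : ℝ)..(2 * Real.pi), u φ 0) ^ 2 := by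
    rw [z0]; linarith
  have e1 : ∫ φ in (0 : ℝ)..(2 * Real.pi), u φ 1 ^ 2 = (∫ φ in (0 : ℝ)..(2 * Real.pi), p φ 1 ^ 2) +
      (2 * Real.pi)⁻¹ * (∫ φ in (0 : ℝ)..(2 * Real.pi), u φ 1) ^ 2 := by
    rw [z1]; linarith
  have e2 : ∫ φ in (0 : ℝ)..(2 * Real.pi), p φ 2 ^ 2 = 0 := by linarith
  have hp2 : ∀ᵐ φ ∂(volume.restrict (Ioc 0 (2 * Real.pi))), p φ 2 = 0 := by
    rw [intervalIntegral.integral_of_le Real.two_pi_pos.le,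
      setIntegral_eq_zero_iff_of_nonneg_ae (ae_of_all _ fun _ => sq_nonneg _)
        (hp 2).integrable_sq] at e2
    filter_upwards [e2] with φ hφ
    exact pow_eq_zero_iff two_ne_zero |>.1 hφ
  have hp2z : ∀ j, ∫ φ in (0 : ℝ)..(2 * Real.pi), trig j φ * p φ 2 = 0 := by
    intro j
    rw [intervalIntegral.integral_of_le Real.two_pi_pos.le]
    refine (integral_congr_ae (g := fun _ => 0) ?_).trans (integral_zero _ _)
    filter_upwards [hp2] with φ hφ
    rw [hφ, mul_zero]
  have hz : ∀ (b : Bool) (n : ℤ), n ≠ 0 →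
      ∫ φ in (0 : ℝ)..(2 * Real.pi), trig (b, n) φ * u φ 2 = 0 := by
    intro b n hn
    have hn' : (n : ℝ) ≠ 0 := by exact_mod_cast hn
    obtain ⟨r1, r2⟩ := (h 2).coeff_relations n
    rw [hp2z] at r1 r2
    cases b
    · exact (mul_eq_zero.1 r1).resolve_left hn'
    · rw [neg_zero] at r2; exact (mul_eq_zero.1 r2).resolve_left hn'
  have hc : ∫ s in (0 : ℝ)..(2 * Real.pi), Real.cos s * u s 2 = 0 := by
    simpa [trig] using hz true 1 one_ne_zero
  have hs : ∫ s in (0 : ℝ)..(2 * Real.pi), Real.sin s * u s 2 = 0 := by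
    simpa [trig] using hz false 1 one_ne_zero
  filter_upwards [ae_eq_of_high_trig_coeff_eq_zero (hui 0)
      fun b n k0 k1 k2 => (h 0).coeff_eq_zero (hu 0) (hp 0) e0 k0 k1 k2,
    ae_eq_of_high_trig_coeff_eq_zero (hui 1)
      fun b n k0 k1 k2 => (h 1).coeff_eq_zero (hu 1) (hp 1) e1 k0 k1 k2,
    ae_eq_of_high_trig_coeff_eq_zero (hui 2) fun b n k0 _ _ => hz b n k0] with φ q0 q1 q2
  refine ⟨?_, ?_, ?_⟩
  · rw [q0, z0]; unfold cosCoeff sinCoeff; ring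
  · rw [q1, z1]; unfold cosCoeff sinCoeff; ring
  · rw [q2, hc, hs]; unfold meanCoeff; ring

end Circle

/-- The pointwise comparison on one circle: with `k = h₂ / h₁`, the penalty density dominates the
deficit in Wirtinger's inequality, strictly unless the mean vanishes. -/
theorem ofReal_add_mul_compare {x h N E A : ℝ} {W : ℝ≥0∞} (hx : 0 < x) (hh : 0 < h) (hN : 0 ≤ N)
    (hE : 0 ≤ E) (hA : 0 ≤ A) (hAE : A ≤ E + (2 * Real.pi)⁻¹ * N)
    (hW : ENNReal.ofReal (Real.sqrt (2 * Real.pi)) < ENNReal.ofReal x * W) :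
    ENNReal.ofReal (h / x * A) ≤ ENNReal.ofReal (h / x * E) +
        ENNReal.ofReal ((2 * Real.pi)⁻¹ ^ 2 * N * (x * h)) * W ^ 2 ∧
      (ENNReal.ofReal (h / x * A) = ENNReal.ofReal (h / x * E) +
        ENNReal.ofReal ((2 * Real.pi)⁻¹ ^ 2 * N * (x * h)) * W ^ 2 → N = 0 ∧ A = E) := by
  have hpi := Real.pi_pos
  -- The hypothesis on the weight, squared. At the threshold W² = 2π/x² the penalty is exactly the
  -- mean term of Wirtinger's inequality, as `hid` shows. The comparison stays in the extended
  -- half-line, so that an infinite `W` is covered.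
  have hW2 : ENNReal.ofReal (2 * Real.pi / x ^ 2) < W ^ 2 := by
    have h1 : ENNReal.ofReal (Real.sqrt (2 * Real.pi) / x) < W := by
      rw [ENNReal.ofReal_div_of_pos hx]
      refine ENNReal.div_lt_of_lt_mul' hW
    have h2 := ENNReal.pow_lt_pow_left two_ne_zero h1
    rwa [← ENNReal.ofReal_pow (by positivity), div_pow, Real.sq_sqrt (by positivity)] at h2
  have hid : (2 * Real.pi)⁻¹ ^ 2 * N * (x * h) * (2 * Real.pi / x ^ 2) =
      h / x * ((2 * Real.pi)⁻¹ * N) := by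
    field_simp
  have hle : ENNReal.ofReal (h / x * ((2 * Real.pi)⁻¹ * N)) ≤
      ENNReal.ofReal ((2 * Real.pi)⁻¹ ^ 2 * N * (x * h)) * W ^ 2 := by
    rw [← hid, ENNReal.ofReal_mul (by positivity)]
    gcongr
  have hsum : ENNReal.ofReal (h / x * A) ≤ ENNReal.ofReal (h / x * E) +
      ENNReal.ofReal (h / x * ((2 * Real.pi)⁻¹ * N)) := by
    rw [← ENNReal.ofReal_add (by positivity) (by positivity), ← mul_add]
    exact ENNReal.ofReal_le_ofReal (by gcongr)
  refine ⟨hsum.trans (by gcongr), fun heq => ?_⟩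
  have hN0 : N = 0 := by
    by_contra hne
    have hNp : 0 < N := lt_of_le_of_ne hN (Ne.symm hne)
    have hlt : ENNReal.ofReal (h / x * ((2 * Real.pi)⁻¹ * N)) <
        ENNReal.ofReal ((2 * Real.pi)⁻¹ ^ 2 * N * (x * h)) * W ^ 2 := by
      rw [← hid, ENNReal.ofReal_mul (by positivity)]
      exact ENNReal.mul_lt_mul_right (ENNReal.ofReal_pos.2 (by positivity)).ne'
        ENNReal.ofReal_ne_top hW2
    have := hsum.trans_lt (ENNReal.add_lt_add_left ENNReal.ofReal_ne_top hlt)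
    exact absurd heq this.ne
  refine ⟨hN0, ?_⟩
  subst hN0
  simp only [mul_zero, zero_mul, ENNReal.ofReal_zero, add_zero] at heq
  have hk : 0 < h / x := by positivity
  exact mul_left_cancel₀ hk.ne' ((ENNReal.ofReal_eq_ofReal_iff (by positivity) (by positivity)).1 heq)

/-! ### The energy sliced by circles of latitude and by meridians -/

namespace RevolutionProfile

variable (P : RevolutionProfile)

theorem circWeight_sq (ω : E3 → ℝ) (t : ℝ) : P.circWeight ω t ^ 2 =
    ∫⁻ φ in Icc 0 (2 * Real.pi), ENNReal.ofReal (ω (P.ξ (φ, t)) ^ 2) := by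
  rw [circWeight, ← ENNReal.rpow_natCast, ← ENNReal.rpow_mul]
  norm_num

variable {P}

theorem aemeasurable_comp_ξ {ω : E3 → ℝ} (hω : Measurable (P.surface.domRestrict ω)) :
    AEMeasurable (fun p => ω (P.ξ p)) (volume.restrict P.rect) := by
  refine aemeasurable_restrict_of_measurable_subtype P.measurableSet_rect ?_
  have h1 : Continuous fun p : P.rect => (⟨P.ξ p, ⟨p, p.2, rfl⟩⟩ : P.surface) :=
    Continuous.subtype_mk (continuousOn_iff_continuous_domRestrict.1 (P.continuousOn_ξ.mono P.rect_subset)) _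
  exact hω.comp h1.measurable

theorem circleAvg_ξ (m : E3 → E3) (p : ℝ × ℝ) : circleAvg m (P.ξ p) =
    (2 * Real.pi)⁻¹ • ∫ θ in (0 : ℝ)..(2 * Real.pi), m (P.ξ (θ, p.2)) := by
  have hper : Function.Periodic (fun θ => m (P.ξ (θ, p.2))) (2 * Real.pi) := fun θ => by
    simp only [ξ, rot_add_two_pi]
  have h1 : ∀ θ, m (rot θ (P.ξ p)) = m (P.ξ (θ + p.1, p.2)) := fun θ =>
    congrArg m (P.rot_ξ θ p.1 p.2)
  unfold circleAvg
  simp only [h1]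
  rw [intervalIntegral.integral_comp_add_right (fun θ => m (P.ξ (θ, p.2)))]
  have := hper.intervalIntegral_add_eq p.1 0
  rw [zero_add] at this
  rw [zero_add, add_comm (2 * Real.pi) p.1, this]

theorem ae_memLp_slice {f : ℝ × ℝ → ℝ} (hf : MemLp f 2 (volume.restrict P.rect)) :
    ∀ᵐ t ∂(volume.restrict P.I),
      MemLp (fun φ => f (φ, t)) 2 (volume.restrict (Ioc 0 (2 * Real.pi))) := by
  have := P.isFiniteMeasure_rect
  have h1 := hf.integrable (by norm_num)
  have h2 := hf.integrable_sq
  rw [P.restrict_rect] at h1 h2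
  filter_upwards [h1.prod_left_ae, h2.prod_left_ae] with t k1 k2
  rw [restrict_Ioc_eq_restrict_Icc]
  exact (memLp_two_iff_integrable_sq k1.aestronglyMeasurable).2 k2

theorem _root_.MeasureTheory.MemLp.apply_E3 {α : Type*} [MeasurableSpace α] {μ : Measure α}
    {f : α → E3} {q : ℝ≥0∞} (hf : MemLp f q μ) (i : Fin 3) : MemLp (fun x => f x i) q μ :=
  hf.of_le ((continuous_apply_E3 i).comp_aestronglyMeasurable hf.1)
    (ae_of_all _ fun x => abs_apply_le_norm (f x) i)

theorem IsWeakField.memLp {M Φ D : ℝ × ℝ → E3} (h : P.IsWeakField M Φ D) :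
    MemLp M 2 (volume.restrict P.rect) := by
  obtain ⟨R, hR⟩ := h.bounded
  have := P.isFiniteMeasure_rect
  exact MemLp.of_bound h.meas R ((ae_restrict_mem P.measurableSet_rect).mono hR)

/-- The squared horizontal part of the integral over a circle of latitude. -/
noncomputable def circleSq (M : ℝ × ℝ → E3) (t : ℝ) : ℝ :=
  (∫ φ in (0 : ℝ)..(2 * Real.pi), M (φ, t) 0) ^ 2 + (∫ φ in (0 : ℝ)..(2 * Real.pi), M (φ, t) 1) ^ 2

theorem circleSq_nonneg (M : ℝ × ℝ → E3) (t : ℝ) : 0 ≤ circleSq M t := by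
  unfold circleSq; positivity

theorem norm_sq_cross_circleAvg {m : E3 → E3} {p : ℝ × ℝ}
    (hi : IntervalIntegrable (fun φ => m (P.ξ (φ, p.2))) volume 0 (2 * Real.pi)) :
    ‖cross (circleAvg m (P.ξ p)) e3‖ ^ 2 =
      (2 * Real.pi)⁻¹ ^ 2 * circleSq (fun p => m (P.ξ p)) p.2 := by
  have hcomp : ∀ i, (∫ θ in (0 : ℝ)..(2 * Real.pi), m (P.ξ (θ, p.2))) i =
      ∫ θ in (0 : ℝ)..(2 * Real.pi), m (P.ξ (θ, p.2)) i := by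
    intro i
    rw [intervalIntegral.integral_of_le Real.two_pi_pos.le,
      intervalIntegral.integral_of_le Real.two_pi_pos.le]
    exact integral_apply_E3 hi.1 i
  rw [norm_sq_cross_e3, circleAvg_ξ, PiLp.smul_apply, PiLp.smul_apply, hcomp, hcomp, circleSq]
  simp only [smul_eq_mul]
  ring

theorem aemeasurable_circleSq {M : ℝ × ℝ → E3} (hM : AEStronglyMeasurable M (volume.restrict P.rect)) :
    AEMeasurable (circleSq M) (volume.restrict P.I) := by
  have h : ∀ i, AEMeasurable (fun t => ∫ φ in (0 : ℝ)..(2 * Real.pi), M (φ, t) i)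
      (volume.restrict P.I) := by
    intro i
    have h1 : AEStronglyMeasurable (fun p => M p i) (volume.restrict P.rect) :=
      (continuous_apply_E3 i).comp_aestronglyMeasurable hM
    rw [P.restrict_rect] at h1
    have h2 := h1.prod_swap.integral_prod_right'.aemeasurable
    refine h2.congr (ae_of_all _ fun t => ?_)
    exact integral_Icc_two_pi fun φ => M (φ, t) i
  exact ((h 0).pow_const 2).add ((h 1).pow_const 2)

theorem aemeasurable_circWeight_sq {ω : E3 → ℝ} (hω : Measurable (P.surface.domRestrict ω)) :
    AEMeasurable (fun t => P.circWeight ω t ^ 2) (volume.restrict P.I) := by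
  have h1 : AEMeasurable (fun p => ENNReal.ofReal (ω (P.ξ p) ^ 2)) (volume.restrict P.rect) :=
    ((aemeasurable_comp_ξ hω).pow_const 2).ennreal_ofReal
  rw [P.restrict_rect] at h1
  refine h1.prod_swap.lintegral_prod_right'.congr (ae_of_all _ fun t => ?_)
  exact (P.circWeight_sq ω t).symm

/-- The circular mean is constant along each circle of latitude, so integrating over φ turns ω² into
the square of the circular weight. -/
theorem penalty_eq {ω : E3 → ℝ} (hω : Measurable (P.surface.domRestrict ω)) {m : E3 → E3}
    (hm : Integrable (fun p => m (P.ξ p)) (volume.restrict P.rect)) :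
    P.penalty ω m = ∫⁻ t in P.I, ENNReal.ofReal ((2 * Real.pi)⁻¹ ^ 2 *
      circleSq (fun p => m (P.ξ p)) t * (P.h₁ t * P.h₂ t)) * P.circWeight ω t ^ 2 := by
  have hi : ∀ᵐ t ∂(volume.restrict P.I),
      IntervalIntegrable (fun φ => m (P.ξ (φ, t))) volume 0 (2 * Real.pi) := by
    have hm' := hm
    rw [P.restrict_rect] at hm'
    filter_upwards [hm'.prod_left_ae] with t ht
    exact (intervalIntegrable_iff_integrableOn_Icc_of_le Real.two_pi_pos.le).2 ht
  have h1 : P.penalty ω m = ∫⁻ p in P.rect, ENNReal.ofReal ((2 * Real.pi)⁻¹ ^ 2 *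
      circleSq (fun p => m (P.ξ p)) p.2 * (P.h₁ p.2 * P.h₂ p.2)) *
        ENNReal.ofReal (ω (P.ξ p) ^ 2) := by
    unfold penalty surfInt
    refine lintegral_congr_ae ?_
    filter_upwards [P.ae_rect_snd hi] with p hp
    have hn := circleSq_nonneg (fun p => m (P.ξ p)) p.2
    have hn1 := P.h₁_nonneg p.2
    have hn2 : 0 ≤ P.h₂ p.2 := norm_nonneg _
    rw [norm_sq_cross_circleAvg hp, ← ENNReal.ofReal_mul (by positivity),
      ← ENNReal.ofReal_mul (by positivity)]
    congr 1
    ring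
  have hmeas : AEMeasurable (fun t => ENNReal.ofReal ((2 * Real.pi)⁻¹ ^ 2 *
      circleSq (fun p => m (P.ξ p)) t * (P.h₁ t * P.h₂ t))) (volume.restrict P.I) :=
    (((aemeasurable_circleSq hm.1).const_mul _).mul
      (P.aemeasurable_h₁.mul P.aemeasurable_h₂)).ennreal_ofReal
  have hmeas' : AEMeasurable (fun p => ENNReal.ofReal ((2 * Real.pi)⁻¹ ^ 2 *
      circleSq (fun p => m (P.ξ p)) p.2 * (P.h₁ p.2 * P.h₂ p.2)) *
        ENNReal.ofReal (ω (P.ξ p) ^ 2)) (volume.restrict P.rect) :=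
    (P.aemeasurable_snd hmeas).mul ((aemeasurable_comp_ξ hω).pow_const 2).ennreal_ofReal
  rw [h1, P.lintegral_rect hmeas']
  refine lintegral_congr fun t => ?_
  rw [P.circWeight_sq]
  exact lintegral_const_mul' (ENNReal.ofReal ((2 * Real.pi)⁻¹ ^ 2 *
    circleSq (fun p => m (P.ξ p)) t * (P.h₁ t * P.h₂ t)))
    (fun φ => ENNReal.ofReal (ω (P.ξ (φ, t)) ^ 2)) ENNReal.ofReal_ne_top

end RevolutionProfile

theorem lintegral_ofReal_two_pi {f : ℝ → ℝ} {k : ℝ}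
    (hf : Integrable f (volume.restrict (Ioc 0 (2 * Real.pi)))) (hk : 0 ≤ k) (h0 : ∀ φ, 0 ≤ f φ) :
    ∫⁻ φ in Icc 0 (2 * Real.pi), ENNReal.ofReal (k * f φ) =
      ENNReal.ofReal (k * ∫ φ in (0 : ℝ)..(2 * Real.pi), f φ) := by
  rw [intervalIntegral.integral_of_le Real.two_pi_pos.le, ← integral_const_mul,
    ofReal_integral_eq_lintegral_ofReal (hf.const_mul k) (ae_of_all _ fun φ => mul_nonneg hk (h0 φ)),
    restrict_Ioc_eq_restrict_Icc]

namespace RevolutionProfile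

variable {P : RevolutionProfile}

/-- The part of the energy density that is not affected by symmetrization. -/
noncomputable def restDensity (P : RevolutionProfile) (g : ℝ → ℝ) (a : E3 → E3) (M D : ℝ × ℝ → E3)
    (p : ℝ × ℝ) : ℝ :=
  P.h₁ p.2 / P.h₂ p.2 * ‖D p‖ ^ 2 + P.h₁ p.2 * P.h₂ p.2 * g (inner ℝ (M p) (a (P.ξ p)))

theorem restDensity_nonneg {g : ℝ → ℝ} (hg : ∀ s, 0 ≤ g s) (a : E3 → E3) (M D : ℝ × ℝ → E3)
    (p : ℝ × ℝ) : 0 ≤ P.restDensity g a M D p := by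
  have h1 := P.h₁_nonneg p.2
  have h2 : 0 ≤ P.h₂ p.2 := norm_nonneg _
  have h3 := hg (inner ℝ (M p) (a (P.ξ p)))
  unfold restDensity
  positivity

theorem ratio_nonneg (t : ℝ) : 0 ≤ P.h₂ t / P.h₁ t :=
  div_nonneg (norm_nonneg _) (P.h₁_nonneg t)

theorem aemeasurable_snd_real {f : ℝ → ℝ} (hf : AEMeasurable f (volume.restrict P.I)) :
    AEMeasurable (fun p : ℝ × ℝ => f p.2) (volume.restrict P.rect) :=
  (P.aestronglyMeasurable_snd hf.aestronglyMeasurable).aemeasurable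

theorem aemeasurable_restDensity {g : ℝ → ℝ} (hg : Continuous g) {a : E3 → E3}
    (ha : ContinuousOn a P.surface) {M D : ℝ × ℝ → E3}
    (hM : AEStronglyMeasurable M (volume.restrict P.rect))
    (hD : AEStronglyMeasurable D (volume.restrict P.rect)) :
    AEMeasurable (P.restDensity g a M D) (volume.restrict P.rect) := by
  have h1 : AEStronglyMeasurable (fun p => a (P.ξ p)) (volume.restrict P.rect) :=
    ((ha.comp (P.continuousOn_ξ.mono P.rect_subset)
      fun p hp => ⟨p, hp, rfl⟩).aestronglyMeasurable P.measurableSet_rect)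
  have h2 : AEMeasurable (fun p => inner ℝ (M p) (a (P.ξ p))) (volume.restrict P.rect) :=
    (hM.inner h1).aemeasurable
  exact ((aemeasurable_snd_real (P.aemeasurable_h₁.div P.aemeasurable_h₂)).mul
    (hD.norm.aemeasurable.pow_const 2)).add
    ((aemeasurable_snd_real (P.aemeasurable_h₁.mul P.aemeasurable_h₂)).mul
      (hg.measurable.comp_aemeasurable h2))

/-- The energy of the equivariant map generated by a meridian. -/
theorem curveEnergy_rot {σ : ℤ} {g : ℝ → ℝ} {a : E3 → E3}
    (has : TwistedSymmetric σ P.surface a) {M D : ℝ × ℝ → E3} {φ : ℝ} {V : ℝ → E3}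
    (hV : ∀ᵐ t ∂(volume.restrict P.I), M (φ, t) = V t) :
    P.curveEnergy g a (fun t => rot (-(σ * φ)) (V t)) (fun t => rot (-(σ * φ)) (D (φ, t))) =
      ∫⁻ t in P.I, ENNReal.ofReal (P.h₂ t / P.h₁ t * (M (φ, t) 0 ^ 2 + M (φ, t) 1 ^ 2) +
        P.restDensity g a M D (φ, t)) := by
  unfold curveEnergy
  refine lintegral_congr_ae ?_
  filter_upwards [hV, ae_restrict_mem measurableSet_Icc] with t ht hI
  have h1 : a (P.ξ (φ, t)) = rot (σ * φ) (a (P.γ t)) := has φ _ (P.γ_mem_surface hI)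
  have h2 : inner ℝ (rot (-(σ * φ)) (V t)) (a (P.γ t)) = inner ℝ (V t) (a (P.ξ (φ, t))) := by
    rw [h1, ← inner_rot (σ * φ), rot_rot_neg]
  simp only [curveDensity, restDensity, h2, hor_sq_rot, norm_rot, ht]
  congr 1
  ring

section Comparison

variable {ω : E3 → ℝ} {g : ℝ → ℝ} {a m : E3 → E3} {G : ℝ × ℝ → (E3 →L[ℝ] E3)} {Φ D : ℝ × ℝ → E3}

/-- The terms are grouped so that the last one also occurs in `lintegral_slice_eq`; what remains to
be compared is the φ-derivative together with the penalty against the zeroth-order term h₂/h₁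
|M_⊥|². -/
theorem energy_eq_lintegral (hω : Measurable (P.surface.domRestrict ω)) (hg : Continuous g)
    (hg0 : ∀ s, 0 ≤ g s) (ha : ContinuousOn a P.surface)
    (h : P.IsWeakField (fun p => m (P.ξ p)) Φ D)
    (hdir : P.dirichlet m = ∫⁻ p in P.rect, ENNReal.ofReal (P.fieldDensity Φ D p)) :
    P.energy ω g a m = ∫⁻ t in P.I,
      (((∫⁻ φ in Icc 0 (2 * Real.pi), ENNReal.ofReal (P.h₂ t / P.h₁ t * ‖Φ (φ, t)‖ ^ 2)) +
        ENNReal.ofReal ((2 * Real.pi)⁻¹ ^ 2 * circleSq (fun p => m (P.ξ p)) t *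
          (P.h₁ t * P.h₂ t)) * P.circWeight ω t ^ 2) +
        ∫⁻ φ in Icc 0 (2 * Real.pi), ENNReal.ofReal
          (P.restDensity g a (fun p => m (P.ξ p)) D (φ, t))) := by
  have m1 : AEMeasurable (fun p => ENNReal.ofReal (P.h₂ p.2 / P.h₁ p.2 * ‖Φ p‖ ^ 2))
      (volume.restrict P.rect) :=
    ((aemeasurable_snd_real (P.aemeasurable_h₂.div P.aemeasurable_h₁)).mul
      (h.meas_φ.norm.aemeasurable.pow_const 2)).ennreal_ofReal
  have m2 : AEMeasurable (fun p => ENNReal.ofReal (P.h₁ p.2 / P.h₂ p.2 * ‖D p‖ ^ 2))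
      (volume.restrict P.rect) :=
    ((aemeasurable_snd_real (P.aemeasurable_h₁.div P.aemeasurable_h₂)).mul
      (h.meas_t.norm.aemeasurable.pow_const 2)).ennreal_ofReal
  have m3 : AEMeasurable (fun p => ENNReal.ofReal (P.restDensity g a (fun p => m (P.ξ p)) D p))
      (volume.restrict P.rect) := (aemeasurable_restDensity hg ha h.meas h.meas_t).ennreal_ofReal
  have m1' := m1
  rw [P.restrict_rect] at m1'
  have m1'' : AEMeasurable (fun t => ∫⁻ φ in Icc 0 (2 * Real.pi),
      ENNReal.ofReal (P.h₂ t / P.h₁ t * ‖Φ (φ, t)‖ ^ 2)) (volume.restrict P.I) :=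
    m1'.prod_swap.lintegral_prod_right'
  have m4 : AEMeasurable (fun t => ENNReal.ofReal ((2 * Real.pi)⁻¹ ^ 2 *
      circleSq (fun p => m (P.ξ p)) t * (P.h₁ t * P.h₂ t)) * P.circWeight ω t ^ 2)
      (volume.restrict P.I) :=
    ((((aemeasurable_circleSq h.meas).const_mul _).mul
      (P.aemeasurable_h₁.mul P.aemeasurable_h₂)).ennreal_ofReal).mul
        (aemeasurable_circWeight_sq hω)
  have hda : P.dirichlet m + P.anisotropy g a m =
      (∫⁻ p in P.rect, ENNReal.ofReal (P.h₂ p.2 / P.h₁ p.2 * ‖Φ p‖ ^ 2)) +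
        ∫⁻ p in P.rect, ENNReal.ofReal (P.restDensity g a (fun p => m (P.ξ p)) D p) := by
    have e1 : P.dirichlet m = (∫⁻ p in P.rect, ENNReal.ofReal (P.h₂ p.2 / P.h₁ p.2 * ‖Φ p‖ ^ 2)) +
        ∫⁻ p in P.rect, ENNReal.ofReal (P.h₁ p.2 / P.h₂ p.2 * ‖D p‖ ^ 2) := by
      rw [hdir, ← lintegral_add_left' m1]
      refine lintegral_congr fun p => ?_
      have h2 : 0 ≤ P.h₂ p.2 := norm_nonneg _
      have h1 := P.h₁_nonneg p.2
      rw [← ENNReal.ofReal_add (by positivity) (by positivity)]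
      rfl
    rw [e1, add_assoc]
    congr 1
    unfold anisotropy surfInt
    rw [← lintegral_add_left' m2]
    refine lintegral_congr fun p => ?_
    have h2 : 0 ≤ P.h₂ p.2 := norm_nonneg _
    have h1 := P.h₁_nonneg p.2
    have h3 := hg0 (inner ℝ (m (P.ξ p)) (a (P.ξ p)))
    rw [← ENNReal.ofReal_mul h3, ← ENNReal.ofReal_add (by positivity) (by positivity)]
    congr 1
    unfold restDensity
    ring
  rw [lintegral_add_left' (m1''.fun_add m4), lintegral_add_left' m1'', energy, hda,
    penalty_eq hω h.integrable, P.lintegral_rect m1, P.lintegral_rect m3]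
  ring

theorem lintegral_slice_eq (hg : Continuous g) (hg0 : ∀ s, 0 ≤ g s) (ha : ContinuousOn a P.surface)
    {M : ℝ × ℝ → E3} (h : P.IsWeakField M Φ D) :
    ∫⁻ φ in Icc 0 (2 * Real.pi), ∫⁻ t in P.I, ENNReal.ofReal
        (P.h₂ t / P.h₁ t * (M (φ, t) 0 ^ 2 + M (φ, t) 1 ^ 2) + P.restDensity g a M D (φ, t)) =
      ∫⁻ t in P.I,
        ((∫⁻ φ in Icc 0 (2 * Real.pi),
          ENNReal.ofReal (P.h₂ t / P.h₁ t * (M (φ, t) 0 ^ 2 + M (φ, t) 1 ^ 2))) +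
        ∫⁻ φ in Icc 0 (2 * Real.pi), ENNReal.ofReal (P.restDensity g a M D (φ, t))) := by
  have hc : ∀ i, AEMeasurable (fun p => M p i) (volume.restrict P.rect) := fun i =>
    ((continuous_apply_E3 i).comp_aestronglyMeasurable h.meas).aemeasurable
  have m1 : AEMeasurable (fun p => ENNReal.ofReal (P.h₂ p.2 / P.h₁ p.2 * (M p 0 ^ 2 + M p 1 ^ 2)))
      (volume.restrict P.rect) :=
    ((aemeasurable_snd_real (P.aemeasurable_h₂.div P.aemeasurable_h₁)).mul
      (((hc 0).pow_const 2).add ((hc 1).pow_const 2))).ennreal_ofReal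
  have m3 : AEMeasurable (fun p => ENNReal.ofReal (P.restDensity g a M D p))
      (volume.restrict P.rect) := (aemeasurable_restDensity hg ha h.meas h.meas_t).ennreal_ofReal
  have m1' := m1
  rw [P.restrict_rect] at m1'
  have m1'' : AEMeasurable (fun t => ∫⁻ φ in Icc 0 (2 * Real.pi),
      ENNReal.ofReal (P.h₂ t / P.h₁ t * (M (φ, t) 0 ^ 2 + M (φ, t) 1 ^ 2))) (volume.restrict P.I) :=
    m1'.prod_swap.lintegral_prod_right'
  have hsum : ∀ p : ℝ × ℝ, ENNReal.ofReal
      (P.h₂ p.2 / P.h₁ p.2 * (M p 0 ^ 2 + M p 1 ^ 2) + P.restDensity g a M D p) =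
      ENNReal.ofReal (P.h₂ p.2 / P.h₁ p.2 * (M p 0 ^ 2 + M p 1 ^ 2)) +
        ENNReal.ofReal (P.restDensity g a M D p) := fun p =>
    ENNReal.ofReal_add (mul_nonneg (ratio_nonneg _) (by positivity)) (restDensity_nonneg hg0 _ _ _ _)
  rw [lintegral_add_left' m1'', ← P.lintegral_rect m1, ← P.lintegral_rect m3,
    ← lintegral_add_left' m1, P.lintegral_rect' (m1.fun_add m3)]
  exact lintegral_congr fun φ => lintegral_congr fun t => hsum (φ, t)

/-- Symmetrizing along meridians does not increase the energy on average, and a field for which it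
does not decrease it either consists of first modes. -/
theorem lintegral_slice_le (hω : Measurable (P.surface.domRestrict ω)) (hg : Continuous g)
    (hg0 : ∀ s, 0 ≤ g s) (ha : ContinuousOn a P.surface)
    (hW : ∀ t ∈ P.I, 0 < P.h₁ t →
      ENNReal.ofReal (Real.sqrt (2 * Real.pi)) < ENNReal.ofReal (P.h₁ t) * P.circWeight ω t)
    (h : P.IsWeakField (fun p => m (P.ξ p)) Φ D)
    (hdir : P.dirichlet m = ∫⁻ p in P.rect, ENNReal.ofReal (P.fieldDensity Φ D p)) :
    (∫⁻ φ in Icc 0 (2 * Real.pi), ∫⁻ t in P.I, ENNReal.ofReal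
        (P.h₂ t / P.h₁ t * (m (P.ξ (φ, t)) 0 ^ 2 + m (P.ξ (φ, t)) 1 ^ 2) +
          P.restDensity g a (fun p => m (P.ξ p)) D (φ, t)) ≤ P.energy ω g a m) ∧
      (P.energy ω g a m < ∞ → P.energy ω g a m ≤
        ∫⁻ φ in Icc 0 (2 * Real.pi), ∫⁻ t in P.I, ENNReal.ofReal
        (P.h₂ t / P.h₁ t * (m (P.ξ (φ, t)) 0 ^ 2 + m (P.ξ (φ, t)) 1 ^ 2) +
          P.restDensity g a (fun p => m (P.ξ p)) D (φ, t)) →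
        ∀ᵐ t ∂(volume.restrict P.I), circleSq (fun p => m (P.ξ p)) t = 0 ∧
          ∀ᵐ φ ∂(volume.restrict (Ioc 0 (2 * Real.pi))),
            m (P.ξ (φ, t)) 0 = cosCoeff (fun s => m (P.ξ (s, t)) 0) * Real.cos φ +
              sinCoeff (fun s => m (P.ξ (s, t)) 0) * Real.sin φ ∧
            m (P.ξ (φ, t)) 1 = cosCoeff (fun s => m (P.ξ (s, t)) 1) * Real.cos φ +
              sinCoeff (fun s => m (P.ξ (s, t)) 1) * Real.sin φ ∧
            m (P.ξ (φ, t)) 2 = meanCoeff fun s => m (P.ξ (s, t)) 2) := by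
  rw [lintegral_slice_eq hg hg0 ha h, energy_eq_lintegral hω hg hg0 ha h hdir]
  set M : ℝ × ℝ → E3 := fun p => m (P.ξ p) with hM
  set R : ℝ → ℝ≥0∞ := fun t => ∫⁻ φ in Icc 0 (2 * Real.pi),
    ENNReal.ofReal (P.restDensity g a M D (φ, t)) with hR
  have hcmp : ∀ᵐ t ∂(volume.restrict P.I),
      ((∫⁻ φ in Icc 0 (2 * Real.pi),
          ENNReal.ofReal (P.h₂ t / P.h₁ t * (M (φ, t) 0 ^ 2 + M (φ, t) 1 ^ 2))) ≤
        (∫⁻ φ in Icc 0 (2 * Real.pi), ENNReal.ofReal (P.h₂ t / P.h₁ t * ‖Φ (φ, t)‖ ^ 2)) +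
        ENNReal.ofReal ((2 * Real.pi)⁻¹ ^ 2 * circleSq M t *
          (P.h₁ t * P.h₂ t)) * P.circWeight ω t ^ 2) ∧
      ((∫⁻ φ in Icc 0 (2 * Real.pi),
          ENNReal.ofReal (P.h₂ t / P.h₁ t * (M (φ, t) 0 ^ 2 + M (φ, t) 1 ^ 2))) =
        (∫⁻ φ in Icc 0 (2 * Real.pi), ENNReal.ofReal (P.h₂ t / P.h₁ t * ‖Φ (φ, t)‖ ^ 2)) +
        ENNReal.ofReal ((2 * Real.pi)⁻¹ ^ 2 * circleSq M t *
          (P.h₁ t * P.h₂ t)) * P.circWeight ω t ^ 2 → circleSq M t = 0 ∧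
          ∀ᵐ φ ∂(volume.restrict (Ioc 0 (2 * Real.pi))),
            M (φ, t) 0 = cosCoeff (fun s => M (s, t) 0) * Real.cos φ +
              sinCoeff (fun s => M (s, t) 0) * Real.sin φ ∧
            M (φ, t) 1 = cosCoeff (fun s => M (s, t) 1) * Real.cos φ +
              sinCoeff (fun s => M (s, t) 1) * Real.sin φ ∧
            M (φ, t) 2 = meanCoeff fun s => M (s, t) 2) := by
    filter_upwards [P.ae_mem_Ioo, ae_all_iff.2 fun i => ae_memLp_slice (h.memLp.apply_E3 i),
      ae_all_iff.2 fun i => ae_memLp_slice (h.memLp_φ.apply_E3 i),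
      ae_all_iff.2 fun i => h.ae_isPeriodicWeakDeriv i] with t ht k1 k2 k3
    have hI := Ioo_subset_Icc_self ht
    have hx := P.h₁_pos ht
    have hh := P.h₂_pos hI
    have i0 := (k1 0).integrable_sq
    have i1 := (k1 1).integrable_sq
    have iΦ : Integrable (fun φ => ‖Φ (φ, t)‖ ^ 2) (volume.restrict (Ioc 0 (2 * Real.pi))) := by
      simp only [norm_sq_eq_coords]
      exact ((k2 0).integrable_sq.add (k2 1).integrable_sq).add (k2 2).integrable_sq
    have eA : ∫⁻ φ in Icc 0 (2 * Real.pi),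
        ENNReal.ofReal (P.h₂ t / P.h₁ t * (M (φ, t) 0 ^ 2 + M (φ, t) 1 ^ 2)) =
        ENNReal.ofReal (P.h₂ t / P.h₁ t * ((∫ φ in (0 : ℝ)..(2 * Real.pi), M (φ, t) 0 ^ 2) +
          ∫ φ in (0 : ℝ)..(2 * Real.pi), M (φ, t) 1 ^ 2)) := by
      rw [lintegral_ofReal_two_pi (f := fun φ => M (φ, t) 0 ^ 2 + M (φ, t) 1 ^ 2) (i0.add i1)
        (ratio_nonneg t) (fun _ => by positivity), intervalIntegral.integral_add
        ((intervalIntegrable_iff_integrableOn_Ioc_of_le Real.two_pi_pos.le).2 i0)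
        ((intervalIntegrable_iff_integrableOn_Ioc_of_le Real.two_pi_pos.le).2 i1)]
    have eB : ∫⁻ φ in Icc 0 (2 * Real.pi), ENNReal.ofReal (P.h₂ t / P.h₁ t * ‖Φ (φ, t)‖ ^ 2) =
        ENNReal.ofReal (P.h₂ t / P.h₁ t * ∫ φ in (0 : ℝ)..(2 * Real.pi), ‖Φ (φ, t)‖ ^ 2) :=
      lintegral_ofReal_two_pi iΦ (ratio_nonneg t) fun _ => by positivity
    have nn : ∀ f : ℝ → ℝ, 0 ≤ ∫ φ in (0 : ℝ)..(2 * Real.pi), f φ ^ 2 := fun f =>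
      intervalIntegral.integral_nonneg Real.two_pi_pos.le fun _ _ => sq_nonneg _
    obtain ⟨c1, c2⟩ := ofReal_add_mul_compare hx hh (circleSq_nonneg M t)
      (nn fun φ => ‖Φ (φ, t)‖) (add_nonneg (nn fun φ => M (φ, t) 0) (nn fun φ => M (φ, t) 1))
      (integral_horizontal_sq_le (u := fun φ => M (φ, t)) (p := fun φ => Φ (φ, t)) k1 k2 k3)
      (hW t hI hx)
    rw [eA, eB]
    refine ⟨c1, fun he => ?_⟩
    obtain ⟨n1, n2⟩ := c2 he
    refine ⟨n1, ?_⟩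
    unfold circleSq at n1
    have z0 : ∫ φ in (0 : ℝ)..(2 * Real.pi), M (φ, t) 0 = 0 := by
      nlinarith [sq_nonneg (∫ φ in (0 : ℝ)..(2 * Real.pi), M (φ, t) 1)]
    have z1 : ∫ φ in (0 : ℝ)..(2 * Real.pi), M (φ, t) 1 = 0 := by
      nlinarith [sq_nonneg (∫ φ in (0 : ℝ)..(2 * Real.pi), M (φ, t) 0)]
    exact ae_eq_modes_of_integral_sq_eq (u := fun φ => M (φ, t)) (p := fun φ => Φ (φ, t))
      k1 k2 k3 z0 z1 n2
  refine ⟨lintegral_mono_ae (hcmp.mono fun t ht => add_le_add_left ht.1 _), fun hfin hle => ?_⟩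
  have m1 : AEMeasurable (fun p => ENNReal.ofReal (P.h₂ p.2 / P.h₁ p.2 * ‖Φ p‖ ^ 2))
      (volume.restrict P.rect) :=
    ((aemeasurable_snd_real (P.aemeasurable_h₂.div P.aemeasurable_h₁)).mul
      (h.meas_φ.norm.aemeasurable.pow_const 2)).ennreal_ofReal
  have m3 : AEMeasurable (fun p => ENNReal.ofReal (P.restDensity g a M D p))
      (volume.restrict P.rect) := (aemeasurable_restDensity hg ha h.meas h.meas_t).ennreal_ofReal
  have m4 : AEMeasurable (fun t => ENNReal.ofReal ((2 * Real.pi)⁻¹ ^ 2 *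
      circleSq M t * (P.h₁ t * P.h₂ t)) * P.circWeight ω t ^ 2)
      (volume.restrict P.I) :=
    ((((aemeasurable_circleSq h.meas).const_mul _).mul
      (P.aemeasurable_h₁.mul P.aemeasurable_h₂)).ennreal_ofReal).mul
        (aemeasurable_circWeight_sq hω)
  rw [P.restrict_rect] at m1 m3
  have m1'' : AEMeasurable (fun t => ∫⁻ φ in Icc 0 (2 * Real.pi),
      ENNReal.ofReal (P.h₂ t / P.h₁ t * ‖Φ (φ, t)‖ ^ 2)) (volume.restrict P.I) :=
    m1.prod_swap.lintegral_prod_right'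
  have m3'' : AEMeasurable R (volume.restrict P.I) := m3.prod_swap.lintegral_prod_right'
  -- The common part must be finite before it can be cancelled from the equality of densities.
  have hRfin : ∀ᵐ t ∂(volume.restrict P.I), R t < ∞ := by
    rw [lintegral_add_left' (m1''.fun_add m4)] at hfin
    exact ae_lt_top' m3'' (ENNReal.add_lt_top.1 hfin).2.ne
  have hle' := lintegral_mono_ae (hcmp.mono fun t ht => add_le_add_left ht.1 (R t))
  -- The densities are ordered pointwise and their finite integrals in the opposite way, so they
  -- agree almost everywhere.
  have hae := ae_eq_of_ae_le_of_lintegral_le (hcmp.mono fun t ht => add_le_add_left ht.1 (R t))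
    (hle'.trans_lt hfin).ne ((m1''.fun_add m4).fun_add m3'') hle
  filter_upwards [hcmp, hae, hRfin] with t q1 q2 q3
  exact q1.2 ((ENNReal.add_left_inj q3.ne).1 q2)

end Comparison

end RevolutionProfile

/-! ### Minimizers and their meridians -/

namespace RevolutionProfile

variable {P Q : RevolutionProfile}

theorem exists_h₁_le_mul_abs_sub (P : RevolutionProfile) : ∃ C, 0 < C ∧ ∀ s ∈ P.I, ∀ t ∈ P.I,
    |P.γ t 0 - P.γ s 0| ≤ C * |t - s| := by
  obtain ⟨c, C, hc, hC⟩ := P.exists_h₂_bounds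
  have ha : P.a ∈ P.I := ⟨le_rfl, P.a_lt_b.le⟩
  refine ⟨C, hc.trans_le ((hC _ ha).1.trans (hC _ ha).2), fun s hs t ht => ?_⟩
  have h1 : ‖P.γ t - P.γ s‖ ≤ C * ‖t - s‖ :=
    (convex_Icc P.a P.b).norm_image_sub_le_of_norm_hasDerivWithin_le
      (fun r hr => P.hasDerivWithinAt_γ hr) (fun r hr => (hC r hr).2) hs ht
  exact (abs_apply_le_norm (P.γ t - P.γ s) 0).trans h1

/-- The distance to the axis vanishes at least linearly, h₁(t) ≤ C |t - e|, while h₂ is bounded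
below; and 1/|t - e| is not integrable at e. -/
theorem lintegral_ratio_eq_top {r s e : ℝ} (hrs : r < s) (hsub : Icc r s ⊆ P.I)
    (he : e ∈ Icc r s) (h0 : P.h₁ e = 0) :
    ∫⁻ t in Icc r s, ENNReal.ofReal (P.h₂ t / P.h₁ t) = ∞ := by
  by_contra hne
  obtain ⟨c, _, hc, hc'⟩ := P.exists_h₂_bounds
  obtain ⟨C, hC, hC'⟩ := P.exists_h₁_le_mul_abs_sub
  have h1 : Integrable (fun t => P.h₂ t / P.h₁ t) (volume.restrict (Icc r s)) := by
    refine ⟨((P.aemeasurable_h₂.div P.aemeasurable_h₁).mono_measure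
      (Measure.restrict_mono hsub le_rfl)).aestronglyMeasurable, ?_⟩
    rw [hasFiniteIntegral_iff_ofReal (ae_of_all _ fun t => ratio_nonneg t)]
    exact Ne.lt_top hne
  have hγ0 : P.γ e 0 = 0 := abs_eq_zero.1 h0
  have h2 : Integrable (fun t => (t - e)⁻¹) (volume.restrict (Icc r s)) := by
    refine (h1.const_mul (C / c)).mono' (by fun_prop) ?_
    filter_upwards [ae_restrict_of_ae_restrict_of_subset hsub P.ae_mem_Ioo] with t ht
    have hI := Ioo_subset_Icc_self ht
    have hx := P.h₁_pos ht
    have k1 : P.h₁ t ≤ C * |t - e| := by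
      have := hC' e (hsub he) t hI
      rwa [hγ0, sub_zero] at this
    have k2 : 0 < |t - e| := by
      by_contra hcon
      nlinarith [abs_nonneg (t - e)]
    rw [norm_inv, Real.norm_eq_abs, div_mul_div_comm, inv_eq_one_div, div_le_div_iff₀ k2 (by positivity)]
    nlinarith [(hc' t hI).1, mul_pos hC k2]
  have h3 : IntervalIntegrable (fun t => (t - e)⁻¹) volume r s :=
    (intervalIntegrable_iff_integrableOn_Icc_of_le hrs.le).2 h2
  rcases intervalIntegrable_sub_inv_iff.1 h3 with h | h
  · exact hrs.ne h
  · rw [uIcc_of_le hrs.le] at h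
    exact h he

/-- If the compact target stayed away from the axis, |V_⊥|² would be bounded below and the energy
would dominate a multiple of the divergent integral of h₂/h₁. So the finite energy of one curve
already provides an admissible value at the pole. -/
theorem exists_axis_point {g : ℝ → ℝ} (hg0 : ∀ s, 0 ≤ g s) {a : E3 → E3} {V V' : ℝ → E3}
    (hVQ : ∀ t ∈ Ioo P.a P.b, V t ∈ Q.surface) (hfin : P.curveEnergy g a V V' < ∞) {e : ℝ}
    (he : e ∈ P.I) (h0 : P.h₁ e = 0) : ∃ q ∈ Q.surface, q 0 = 0 ∧ q 1 = 0 := by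
  by_contra hcon
  push Not at hcon
  have hpos : ∀ q ∈ Q.surface, 0 < q 0 ^ 2 + q 1 ^ 2 := by
    intro q hq
    by_contra hle
    have z0 : q 0 = 0 := by nlinarith [sq_nonneg (q 0), sq_nonneg (q 1)]
    have z1 : q 1 = 0 := by nlinarith [sq_nonneg (q 0), sq_nonneg (q 1)]
    exact hcon q hq z0 z1
  have hcont : Continuous fun q : E3 => q 0 ^ 2 + q 1 ^ 2 :=
    ((continuous_apply_E3 0).pow 2).add ((continuous_apply_E3 1).pow 2)
  obtain ⟨ε, hε, hεq⟩ := Q.isCompact_surface.exists_forall_le' hcont.continuousOn hpos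
  have hle : ∫⁻ t in P.I, ENNReal.ofReal (P.h₂ t / P.h₁ t) ≤
      ∫⁻ t in P.I, ENNReal.ofReal ε⁻¹ * ENNReal.ofReal
        (P.curveDensity V V' t + P.h₁ t * P.h₂ t * g (inner ℝ (V t) (a (P.γ t)))) := by
    refine lintegral_mono_ae ?_
    filter_upwards [P.ae_mem_Ioo] with t ht
    rw [← ENNReal.ofReal_mul (by positivity)]
    refine ENNReal.ofReal_le_ofReal ?_
    have h1 := ratio_nonneg (P := P) t
    have h2 : 0 ≤ P.h₂ t := norm_nonneg _
    have h3 := P.h₁_nonneg t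
    have h4 : 0 ≤ P.h₁ t / P.h₂ t * ‖V' t‖ ^ 2 := by positivity
    have h5 : 0 ≤ P.h₁ t * P.h₂ t * g (inner ℝ (V t) (a (P.γ t))) :=
      mul_nonneg (by positivity) (hg0 _)
    have h6 := mul_le_mul_of_nonneg_left (hεq _ (hVQ t ht)) h1
    rw [inv_mul_eq_div, le_div_iff₀ hε]
    unfold curveDensity
    linarith
  rw [I, lintegral_ratio_eq_top P.a_lt_b subset_rfl he h0, lintegral_const_mul' _ _ ENNReal.ofReal_ne_top] at hle
  exact (ENNReal.mul_lt_top ENNReal.ofReal_lt_top hfin).not_ge hle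

/-- For a minimizer, almost every meridian generates an equivariant minimizer, and the field
consists of first modes on almost every circle of latitude. -/
theorem IsMinimizer.exists_slices {σ : ℤ} (hσ : (σ : ℝ) ^ 2 = 1) {ω : E3 → ℝ}
    (hω : Measurable (P.surface.domRestrict ω)) {g : ℝ → ℝ} (hg : Continuous g)
    (hg0 : ∀ s, 0 ≤ g s) {a : E3 → E3} (ha : ContinuousOn a P.surface)
    (has : TwistedSymmetric σ P.surface a)
    (hW : ∀ t ∈ P.I, 0 < P.h₁ t →
      ENNReal.ofReal (Real.sqrt (2 * Real.pi)) < ENNReal.ofReal (P.h₁ t) * P.circWeight ω t)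
    {m : E3 → E3} (hm : P.IsMinimizer Q.surface ω g a m) :
    ∃ D : ℝ × ℝ → E3,
      (∀ᵐ φ ∂(volume.restrict (Icc 0 (2 * Real.pi))), ∃ V,
        IsCurve P.a P.b (P.γ P.a = P.γ P.b) V (fun t => D (φ, t)) ∧
        (∀ t ∈ Ioo P.a P.b, V t ∈ Q.surface) ∧
        (∀ᵐ t ∂(volume.restrict P.I), m (P.ξ (φ, t)) = V t) ∧
        ENNReal.ofReal (2 * Real.pi) * P.curveEnergy g a (fun t => rot (-(σ * φ)) (V t))
          (fun t => rot (-(σ * φ)) (D (φ, t))) = P.energy ω g a m) ∧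
      ∀ᵐ t ∂(volume.restrict P.I), circleSq (fun p => m (P.ξ p)) t = 0 ∧
        ∀ᵐ φ ∂(volume.restrict (Ioc 0 (2 * Real.pi))),
          m (P.ξ (φ, t)) 0 = cosCoeff (fun s => m (P.ξ (s, t)) 0) * Real.cos φ +
            sinCoeff (fun s => m (P.ξ (s, t)) 0) * Real.sin φ ∧
          m (P.ξ (φ, t)) 1 = cosCoeff (fun s => m (P.ξ (s, t)) 1) * Real.cos φ +
            sinCoeff (fun s => m (P.ξ (s, t)) 1) * Real.sin φ ∧
          m (P.ξ (φ, t)) 2 = meanCoeff fun s => m (P.ξ (s, t)) 2 := by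
  obtain ⟨⟨hH, hQ⟩, hfin, hmin⟩ := hm
  obtain ⟨G, hG⟩ := hH.exists_grad
  obtain ⟨R, -, hR⟩ := Q.exists_surface_bound
  have hb : ∃ R, ∀ q ∈ P.surface, ‖m q‖ ≤ R := ⟨R, fun q hq => hR _ (hQ q hq)⟩
  have hF := IsWeakGrad.isWeakField P hH.measurable hb hG
  have hdir : P.dirichlet m = ∫⁻ p in P.rect, ENNReal.ofReal
      (P.fieldDensity (fun p => G p (P.tauφ p)) (fun p => G p (P.tauT p)) p) := by
    rw [P.dirichlet_eq_gradEnergy hH.measurable hb hG, P.gradEnergy_eq]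
  set D : ℝ × ℝ → E3 := fun p => G p (P.tauT p) with hD
  obtain ⟨hle, hmodes⟩ := lintegral_slice_le hω hg hg0 ha hW hF hdir
  set J : ℝ → ℝ≥0∞ := fun φ => ∫⁻ t in P.I, ENNReal.ofReal
    (P.h₂ t / P.h₁ t * (m (P.ξ (φ, t)) 0 ^ 2 + m (P.ξ (φ, t)) 1 ^ 2) +
      P.restDensity g a (fun p => m (P.ξ p)) D (φ, t)) with hJ
  have hslice : ∀ᵐ φ ∂(volume.restrict (Icc 0 (2 * Real.pi))), ∃ V,
      IsCurve P.a P.b (P.γ P.a = P.γ P.b) V (fun t => D (φ, t)) ∧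
      (∀ t ∈ Ioo P.a P.b, V t ∈ Q.surface) ∧
      (∀ᵐ t ∂(volume.restrict P.I), m (P.ξ (φ, t)) = V t) := by
    filter_upwards [hF.ae_exists_isCurve] with φ ⟨V, hV, hmV⟩
    refine ⟨V, hV, hV.mem_of_ae_mem Q.isCompact_surface.isClosed ?_, hmV⟩
    filter_upwards [hmV, ae_restrict_mem measurableSet_Icc] with t ht hI
    rw [← ht]
    exact hQ _ (P.ξ_mem_surface φ hI)
  have hJeq : ∀ (φ : ℝ) (V : ℝ → E3), (∀ᵐ t ∂(volume.restrict P.I), m (P.ξ (φ, t)) = V t) →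
      P.curveEnergy g a (fun t => rot (-(σ * φ)) (V t))
        (fun t => rot (-(σ * φ)) (D (φ, t))) = J φ := fun φ V hV =>
    curveEnergy_rot (M := fun p => m (P.ξ p)) has hV
  -- Minimality of m against the map generated by its own meridian; where `J` is infinite there is
  -- nothing to prove.
  have hlow : ∀ᵐ φ ∂(volume.restrict (Icc 0 (2 * Real.pi))),
      P.energy ω g a m ≤ ENNReal.ofReal (2 * Real.pi) * J φ := by
    filter_upwards [hslice] with φ ⟨V, hV, hVQ, hmV⟩
    rcases eq_or_ne (J φ) ∞ with htop | hne
    · rw [htop, ENNReal.mul_top (ENNReal.ofReal_pos.2 Real.two_pi_pos).ne']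
      exact le_top
    have hE := hJeq φ V hmV
    have hVQ' : ∀ t ∈ Ioo P.a P.b, rot (-(σ * φ)) (V t) ∈ Q.surface := fun t ht =>
      Q.rot_mem_surface _ (hVQ t ht)
    have hEfin : P.curveEnergy g a (fun t => rot (-(σ * φ)) (V t))
        (fun t => rot (-(σ * φ)) (D (φ, t))) < ∞ := by rw [hE]; exact hne.lt_top
    obtain ⟨u, hu, -, -, hue⟩ := P.exists_revolve Q hσ ω hg hg0 ha has
      (v := fun t => rot (-(σ * φ)) (m (P.ξ (φ, t)))) (V := fun t => rot (-(σ * φ)) (V t))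
      (V' := fun t => rot (-(σ * φ)) (D (φ, t)))
      (fun t ht _ => Q.rot_mem_surface _ (hQ _ (P.ξ_mem_surface φ ht)))
      (fun hl => by simp only [ξ, hl]) (hV.rotate _) hVQ'
      (by filter_upwards [hmV] with t ht using by rw [ht]) hEfin
      (fun t ht h0 => exists_axis_point hg0 hVQ' hEfin ht h0)
    rw [← hE]
    exact (hmin u hu).trans hue
  have hpi0 : ENNReal.ofReal (2 * Real.pi) ≠ 0 := (ENNReal.ofReal_pos.2 Real.two_pi_pos).ne'
  have hpit : ENNReal.ofReal (2 * Real.pi) ≠ ∞ := ENNReal.ofReal_ne_top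
  have hconst : ∫⁻ _ in Icc 0 (2 * Real.pi),
      (ENNReal.ofReal (2 * Real.pi))⁻¹ * P.energy ω g a m = P.energy ω g a m := by
    rw [setLIntegral_const, Real.volume_Icc, sub_zero, mul_comm, ← mul_assoc,
      ENNReal.mul_inv_cancel hpi0 hpit, one_mul]
  have hlow' : ∀ᵐ φ ∂(volume.restrict (Icc 0 (2 * Real.pi))),
      (ENNReal.ofReal (2 * Real.pi))⁻¹ * P.energy ω g a m ≤ J φ := by
    filter_upwards [hlow] with φ hφ
    calc (ENNReal.ofReal (2 * Real.pi))⁻¹ * P.energy ω g a m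
        ≤ (ENNReal.ofReal (2 * Real.pi))⁻¹ * (ENNReal.ofReal (2 * Real.pi) * J φ) := by gcongr
      _ = J φ := by rw [← mul_assoc, ENNReal.inv_mul_cancel hpi0 hpit, one_mul]
  have hge : P.energy ω g a m ≤ ∫⁻ φ in Icc 0 (2 * Real.pi), J φ := by
    rw [← hconst]
    exact lintegral_mono_ae hlow'
  have hJm : AEMeasurable J (volume.restrict (Icc 0 (2 * Real.pi))) := by
    have hc : ∀ i, AEMeasurable (fun p => m (P.ξ p) i) (volume.restrict P.rect) := fun i =>
      ((continuous_apply_E3 i).comp_aestronglyMeasurable hF.meas).aemeasurable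
    have h1 : AEMeasurable (fun p : ℝ × ℝ => ENNReal.ofReal
        (P.h₂ p.2 / P.h₁ p.2 * (m (P.ξ p) 0 ^ 2 + m (P.ξ p) 1 ^ 2) +
          P.restDensity g a (fun p => m (P.ξ p)) D p)) (volume.restrict P.rect) :=
      (((aemeasurable_snd_real (P.aemeasurable_h₂.div P.aemeasurable_h₁)).mul
        (((hc 0).pow_const 2).add ((hc 1).pow_const 2))).add
        (aemeasurable_restDensity hg ha hF.meas hF.meas_t)).ennreal_ofReal
    rw [P.restrict_rect] at h1
    exact h1.lintegral_prod_right'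
  -- `J` is at least E(m)/(2π) almost everywhere while its integral is at most E(m), so it is almost
  -- everywhere equal to that constant.
  have hJE := ae_eq_of_ae_le_of_lintegral_le hlow' (by rw [hconst]; exact hfin.ne) hJm
    (by rw [hconst]; exact hle)
  refine ⟨D, ?_, hmodes hfin hge⟩
  filter_upwards [hslice, hJE] with φ ⟨V, hV, hVQ, hmV⟩ he
  refine ⟨V, hV, hVQ, hmV, ?_⟩
  rw [hJeq φ V hmV, ← he, ← mul_assoc, ENNReal.mul_inv_cancel hpi0 hpit, one_mul]

end RevolutionProfile

/-! ### Minimal curves near a pole -/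

/-- A Hardy-type estimate: if the energy `F` with density `q h / x + r x / h` is nearly dominated
by `q`, and `q' ^ 2 ≤ 4 q r`, then `r / h` is integrable up to the zero of `x`. -/
theorem integral_div_le_of_energy_le {x x' h q q' r F f : ℝ → ℝ} {s T C : ℝ} (hsT : s ≤ T)
    (hC : 0 ≤ C) (hx : ∀ t ∈ Icc s T, 0 < x t) (hh : ∀ t ∈ Icc s T, 0 < h t)
    (hxc : ContinuousOn x (Icc s T)) (hx'c : ContinuousOn x' (Icc s T))
    (hhc : ContinuousOn h (Icc s T)) (hxd : ∀ t ∈ Ioo s T, HasDerivAt x (x' t) t)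
    (hx'h : ∀ t ∈ Icc s T, x' t ≤ h t) (hhx' : ∀ t ∈ Icc s T, h t ≤ 11 / 10 * x' t)
    (hq : ∀ t ∈ Icc s T, 0 ≤ q t) (hr : ∀ t ∈ Icc s T, 0 ≤ r t) (hqp : IsPrimitiveOn q q' s T)
    (hFp : IsPrimitiveOn F f s T)
    (hf : ∀ t ∈ Icc s T, f t = q t * h t / x t + r t * x t / h t)
    (hFle : ∀ t ∈ Icc s T, F t ≤ 11 / 10 * q t + C * x t ^ 2) (hqF : q s ≤ F s)
    (hqT : q T ≥ 0) (hq' : ∀ t ∈ Icc s T, q' t ^ 2 ≤ 4 * q t * r t) :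
    IntervalIntegrable r volume s T ∧
      ∫ t in s..T, r t / h t ≤ 2 * (F T / x T + C * x T) := by
  have hsm : s ∈ Icc s T := ⟨le_rfl, hsT⟩
  have hTm : T ∈ Icc s T := ⟨hsT, le_rfl⟩
  have hu : uIcc s T = Icc s T := uIcc_of_le hsT
  have hx0 : ∀ t ∈ Icc s T, x t ≠ 0 := fun t ht => (hx t ht).ne'
  have hh0 : ∀ t ∈ Icc s T, h t ≠ 0 := fun t ht => (hh t ht).ne'
  have hqc := hqp.continuousOn hsT
  have hFc := hFp.continuousOn hsT
  have hx2c : ContinuousOn (fun t => x t ^ 2) (Icc s T) := hxc.pow 2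
  have hx20 : ∀ t ∈ Icc s T, x t ^ 2 ≠ 0 := fun t ht => pow_ne_zero 2 (hx0 t ht)
  have hx'0 : ∀ t ∈ Icc s T, 0 ≤ x' t := fun t ht => by
    have := hh t ht; have := hhx' t ht; linarith
  have cI : ∀ {g : ℝ → ℝ}, ContinuousOn g (Icc s T) → IntervalIntegrable g volume s T :=
    fun hg => (by rwa [hu] : ContinuousOn _ (uIcc s T)).intervalIntegrable
  have hinv : IsPrimitiveOn (fun t => (x t)⁻¹) (fun t => -x' t / x t ^ 2) s T :=
    IsPrimitiveOn.of_hasDerivAt hsT (hxc.inv₀ hx0)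
      (fun t ht => (hxd t ht).inv (hx0 t (Ioo_subset_Icc_self ht)))
      (cI (hx'c.neg.div hx2c hx20))
  -- Solving the formula for `f` for `r` gives r = (f - q h/x) h/x.
  have hrI : IntervalIntegrable r volume s T := by
    have h1 : IntervalIntegrable (fun t => (f t - q t * h t / x t) * (h t / x t)) volume s T :=
      (hFp.1.sub (cI ((hqc.mul hhc).div hxc hx0))).mul_continuousOn
        (by rw [hu]; exact hhc.div hxc hx0)
    refine h1.congr fun t ht => ?_
    have ht' : t ∈ Icc s T := by rw [uIoc_of_le hsT] at ht; exact Ioc_subset_Icc_self ht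
    have e1 := hx0 t ht'
    have e2 := hh0 t ht'
    simp only [hf t ht']
    field_simp
    ring
  refine ⟨hrI, ?_⟩
  have iA : IntervalIntegrable (fun t => q t * h t / x t ^ 2) volume s T :=
    cI ((hqc.mul hhc).div hx2c hx20)
  have iB : IntervalIntegrable (fun t => r t / h t) volume s T := by
    simp only [div_eq_mul_inv]
    exact hrI.mul_continuousOn (by rw [hu]; exact hhc.inv₀ hh0)
  have iF : IntervalIntegrable (fun t => F t * x' t / x t ^ 2) volume s T :=
    cI ((hFc.mul hx'c).div hx2c hx20)
  have iQ : IntervalIntegrable (fun t => q t * x' t / x t ^ 2) volume s T :=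
    cI ((hqc.mul hx'c).div hx2c hx20)
  have iq' : IntervalIntegrable (fun t => q' t / x t) volume s T := by
    simp only [div_eq_mul_inv]
    exact hqp.1.mul_continuousOn (by rw [hu]; exact hxc.inv₀ hx0)
  have ix' : IntervalIntegrable x' volume s T := cI hx'c
  -- Integrating (F/x)' bounds `B` by A/10 plus boundary terms (`e1`, `e2`); integrating (q/x)'
  -- bounds `A` by a multiple of `B` (`e3` to `e5`).
  set A := ∫ t in s..T, q t * h t / x t ^ 2 with hA
  set B := ∫ t in s..T, r t / h t with hB
  have hApos : 0 ≤ A := intervalIntegral.integral_nonneg hsT fun t ht =>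
    div_nonneg (mul_nonneg (hq t ht) (hh t ht).le) (sq_nonneg _)
  have hxI : ∫ t in s..T, x' t = x T - x s :=
    (IsPrimitiveOn.of_hasDerivAt hsT hxc hxd ix').integral_eq hsT
  have e1 : A + B - ∫ t in s..T, F t * x' t / x t ^ 2 = F T / x T - F s / x s := by
    have key := (hFp.mul hsT hinv).integral_eq hsT
    rw [div_eq_mul_inv, div_eq_mul_inv, ← key, hA, hB, ← intervalIntegral.integral_add iA iB,
      ← intervalIntegral.integral_sub (iA.add iB) iF]
    refine intervalIntegral.integral_congr fun t ht => ?_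
    rw [hu] at ht
    have k1 := hx0 t ht
    have k2 := hh0 t ht
    simp only [hf t ht]
    field_simp
    ring
  have e2 : ∫ t in s..T, F t * x' t / x t ^ 2 ≤ 11 / 10 * A + C * (x T - x s) := by
    rw [hA, ← hxI, ← intervalIntegral.integral_const_mul, ← intervalIntegral.integral_const_mul,
      ← intervalIntegral.integral_add (iA.const_mul _) (ix'.const_mul _)]
    refine intervalIntegral.integral_mono_on hsT iF ((iA.const_mul _).add (ix'.const_mul _))
      fun t ht => ?_
    have k1 := hx t ht
    have k3 : 11 / 10 * (q t * h t / x t ^ 2) + C * x' t =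
        (11 / 10 * q t * h t + C * x t ^ 2 * x' t) / x t ^ 2 := by
      field_simp
    rw [k3]
    gcongr
    calc F t * x' t ≤ (11 / 10 * q t + C * x t ^ 2) * x' t :=
          mul_le_mul_of_nonneg_right (hFle t ht) (hx'0 t ht)
      _ = 11 / 10 * q t * x' t + C * x t ^ 2 * x' t := by ring
      _ ≤ _ := by
        have := mul_le_mul_of_nonneg_left (hx'h t ht) (hq t ht)
        linarith
  have e3 : ∫ t in s..T, q t * x' t / x t ^ 2 ≤ (∫ t in s..T, q' t / x t) + F s / x s := by
    have key := (hqp.mul hsT hinv).integral_eq hsT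
    have k4 : ∫ t in s..T, q' t * (x t)⁻¹ + q t * (-x' t / x t ^ 2) =
        (∫ t in s..T, q' t / x t) - ∫ t in s..T, q t * x' t / x t ^ 2 := by
      rw [← intervalIntegral.integral_sub iq' iQ]
      refine intervalIntegral.integral_congr fun t _ => ?_
      ring
    rw [k4] at key
    have k5 : q s * (x s)⁻¹ ≤ F s / x s := by
      rw [div_eq_mul_inv]
      exact mul_le_mul_of_nonneg_right hqF (inv_nonneg.2 (hx s hsm).le)
    have k6 : 0 ≤ q T * (x T)⁻¹ := mul_nonneg hqT (inv_nonneg.2 (hx T hTm).le)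
    linarith
  -- From q'² ≤ 4 q r by the arithmetic-geometric mean inequality. The weights 1/2 and 2 are chosen
  -- so that 11/10 times the coefficient of `A` stays below 1 and that part can be absorbed.
  have e4 : ∫ t in s..T, q' t / x t ≤ 1 / 2 * A + 2 * B := by
    rw [hA, hB, ← intervalIntegral.integral_const_mul, ← intervalIntegral.integral_const_mul,
      ← intervalIntegral.integral_add (iA.const_mul _) (iB.const_mul _)]
    refine intervalIntegral.integral_mono_on hsT iq' ((iA.const_mul _).add (iB.const_mul _))
      fun t ht => ?_
    have k1 := hx t ht
    have k2 := hh t ht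
    have k3 := hq t ht
    have k4 := hr t ht
    refine (abs_le_of_sq_le_sq' ?_ ?_).2
    · have k5 : (q' t / x t) ^ 2 ≤ 4 * (1 / 2 * (q t * h t / x t ^ 2)) * (2 * (r t / h t)) := by
        have : 4 * (1 / 2 * (q t * h t / x t ^ 2)) * (2 * (r t / h t)) =
            4 * q t * r t / x t ^ 2 := by
          field_simp
        rw [this, div_pow]
        gcongr
        exact hq' t ht
      nlinarith [sq_nonneg (1 / 2 * (q t * h t / x t ^ 2) - 2 * (r t / h t))]
    · positivity
  have e5 : A ≤ 11 / 10 * ∫ t in s..T, q t * x' t / x t ^ 2 := by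
    rw [hA, ← intervalIntegral.integral_const_mul]
    refine intervalIntegral.integral_mono_on hsT iA (iQ.const_mul _) fun t ht => ?_
    have k3 : 11 / 10 * (q t * x' t / x t ^ 2) = q t * (11 / 10 * x' t) / x t ^ 2 := by ring
    rw [k3]
    have := hq t ht
    have := hhx' t ht
    gcongr
  have hxs := hx s hsm
  have hFs : 0 ≤ F s / x s := div_nonneg ((hq s hsm).trans hqF) hxs.le
  have hCx : 0 ≤ C * x s := mul_nonneg hC hxs.le
  -- The bounds combine to A ≤ 44/9 B + 22/9 F(s)/x(s) and B ≤ A/10 + F(T)/x(T) - F(s)/x(s) + C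
  -- (x(T) - x(s)). Since 22/45 < 1/2, the part of `B` on the right is absorbed with the factor 2.
  -- The terms at `s` enter with negative sign and drop out, which makes the bound uniform as `s`
  -- approaches the pole.
  linarith

namespace RevolutionProfile

variable {P Q : RevolutionProfile}

theorem vel_ne_zero_of_pole {e : ℝ} (he : e ∈ Q.I) (h0 : Q.h₁ e = 0) : 0 < |Q.vel e 0| := by
  rw [← Q.norm_vel_of_pole he h0]
  exact norm_pos_iff.2 (Q.vel_ne_zero he)

/-- Near a pole the speed is almost controlled by the ratio of the two distances. -/
theorem exists_ball_pole (Q : RevolutionProfile) {e : ℝ} (he : e ∈ Q.I) (h0 : Q.h₁ e = 0)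
    {ε : ℝ} (hε : 0 < ε) :
    ∃ ρ, 0 < ρ ∧ ∀ τ ∈ Q.I, |τ - e| < ρ → ∀ τ' ∈ Q.I, |τ' - e| < ρ →
      ‖Q.vel τ'‖ * |τ - e| ≤ (1 + ε) * Q.h₁ τ := by
  set k := |Q.vel e 0| with hk
  have hkpos : 0 < k := vel_ne_zero_of_pole he h0
  -- Perpendicular contact makes the velocity at the pole purely radial, so that to first order the
  -- distance to the axis is the arc length from the pole.
  have hkn : ‖Q.vel e‖ = k := Q.norm_vel_of_pole he h0
  obtain ⟨δ, hδ, hδ1, hδε⟩ : ∃ δ : ℝ, 0 < δ ∧ δ < 1 ∧ (1 + δ) ≤ (1 + ε) * (1 - δ) := by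
    refine ⟨min (1 / 2) (ε / (2 + ε)), by positivity, (min_le_left _ _).trans_lt (by norm_num), ?_⟩
    have h1 : min (1 / 2) (ε / (2 + ε)) * (2 + ε) ≤ ε :=
      (le_div_iff₀ (by positivity)).1 (min_le_right _ _)
    nlinarith
  have h1 : ∀ᶠ τ in nhdsWithin e Q.I, ‖Q.vel τ‖ < (1 + δ) * k := by
    refine ((Q.continuousOn_vel e he).norm).eventually_lt continuousWithinAt_const ?_
    simp only [hkn]; nlinarith
  have hγ0 : Q.γ e 0 = 0 := abs_eq_zero.1 h0
  have h2 : ∀ᶠ τ in nhdsWithin e Q.I, (1 - δ) * k * |τ - e| ≤ Q.h₁ τ := by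
    have hd := (hasDerivWithinAt_apply (Q.hasDerivWithinAt_γ he) 0).isLittleO
    filter_upwards [hd.def (c := δ * k) (by positivity)] with τ hτ
    rw [hγ0, sub_zero, Real.norm_eq_abs, Real.norm_eq_abs, smul_eq_mul] at hτ
    have h3 : |(τ - e) * Q.vel e 0| = |τ - e| * k := abs_mul _ _
    have h4 := abs_sub_abs_le_abs_sub ((τ - e) * Q.vel e 0) (Q.γ τ 0)
    rw [abs_sub_comm, h3] at h4
    have h5 : Q.h₁ τ = |Q.γ τ 0| := rfl
    rw [h5]
    linarith
  obtain ⟨ρ, hρ, hρ'⟩ := Metric.mem_nhdsWithin_iff.1 (h1.and h2)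
  refine ⟨ρ, hρ, fun τ hτ hd τ' hτ' hd' => ?_⟩
  have k1 := (hρ' ⟨by rwa [Metric.mem_ball, Real.dist_eq], hτ⟩ : _ ∧ _).2
  have k2 := (hρ' ⟨by rwa [Metric.mem_ball, Real.dist_eq], hτ'⟩ : _ ∧ _).1
  calc ‖Q.vel τ'‖ * |τ - e| ≤ (1 + δ) * k * |τ - e| := by gcongr
    _ ≤ (1 + ε) * (1 - δ) * k * |τ - e| := by gcongr
    _ = (1 + ε) * ((1 - δ) * k * |τ - e|) := by ring
    _ ≤ _ := by gcongr

/-- Points of a surface of revolution close to the axis are joined to it by an arc of a meridian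
whose length is almost the distance. -/
theorem exists_path_to_axis (Q : RevolutionProfile) {ε : ℝ} (hε : 0 < ε) :
    ∃ η, 0 < η ∧ ∀ w ∈ Q.surface, w 0 ^ 2 + w 1 ^ 2 < η → ∃ Y Y' : ℝ → E3,
      Y 1 = w ∧ (∀ s ∈ Icc (0 : ℝ) 1, Y s ∈ Q.surface) ∧ ContinuousOn Y' (Icc 0 1) ∧
      (∀ s ∈ Icc (0 : ℝ) 1, HasDerivWithinAt Y (Y' s) (Icc 0 1) s) ∧ Y 0 0 = 0 ∧ Y 0 1 = 0 ∧
      ∀ s ∈ Icc (0 : ℝ) 1, ‖Y' s‖ ^ 2 ≤ (1 + ε) ^ 2 * (w 0 ^ 2 + w 1 ^ 2) := by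
  have hball : ∀ e, ∃ ρ, 0 < ρ ∧ (e ∈ Q.I → Q.h₁ e = 0 → ∀ τ ∈ Q.I, |τ - e| < ρ → ∀ τ' ∈ Q.I,
      |τ' - e| < ρ → ‖Q.vel τ'‖ * |τ - e| ≤ (1 + ε) * Q.h₁ τ) := by
    intro e
    by_cases h : e ∈ Q.I ∧ Q.h₁ e = 0
    · obtain ⟨ρ, hρ, h'⟩ := Q.exists_ball_pole h.1 h.2 hε
      exact ⟨ρ, hρ, fun _ _ => h'⟩
    · exact ⟨1, one_pos, fun h1 h2 => absurd ⟨h1, h2⟩ h⟩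
  choose ρ hρ hρ' using hball
  -- Away from the neighbourhoods `U` of the poles, compactness bounds h₁ below by some `κ`; a point
  -- at distance less than `κ` from the axis therefore has its parameter near a pole `e`, and the
  -- path is the meridian arc from `e` to it.
  set U : Set ℝ := ⋃ e ∈ {e | e ∈ Q.I ∧ Q.h₁ e = 0}, Metric.ball e (ρ e) with hU
  have hUo : IsOpen U := isOpen_biUnion fun _ _ => Metric.isOpen_ball
  have hK : IsCompact (Q.I \ U) := isCompact_Icc.diff hUo
  have hpos : ∀ τ ∈ Q.I \ U, 0 < Q.h₁ τ := by
    intro τ hτ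
    refine lt_of_le_of_ne (Q.h₁_nonneg τ) fun h0 => hτ.2 ?_
    exact mem_biUnion (x := τ) ⟨hτ.1, h0.symm⟩ (Metric.mem_ball_self (hρ τ))
  obtain ⟨κ, hκ, hκ'⟩ := hK.exists_forall_le' (Q.continuousOn_h₁.mono sdiff_subset) hpos
  refine ⟨κ ^ 2, by positivity, fun w hw hlt => ?_⟩
  obtain ⟨θ, τ, hτ, rfl⟩ := Q.mem_surface_iff.1 hw
  have hq : Q.ξ (θ, τ) 0 ^ 2 + Q.ξ (θ, τ) 1 ^ 2 = Q.h₁ τ ^ 2 := by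
    have h1 : Q.γ τ 1 = 0 := Q.in_plane τ hτ
    change rot θ (Q.γ τ) 0 ^ 2 + rot θ (Q.γ τ) 1 ^ 2 = _
    rw [hor_sq_rot, h1, h₁, sq_abs]
    ring
  rw [hq] at hlt ⊢
  have hτU : τ ∈ U := by
    by_contra hn
    have := hκ' τ ⟨hτ, hn⟩
    nlinarith
  obtain ⟨e, ⟨heI, he0⟩, heb⟩ := mem_iUnion₂.1 hτU
  rw [Metric.mem_ball, Real.dist_eq] at heb
  have hmaps : ∀ s ∈ Icc (0 : ℝ) 1, e + (τ - e) * s ∈ Q.I := by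
    intro s hs
    have := (convex_Icc Q.a Q.b) heI hτ (sub_nonneg.2 hs.2) hs.1 (by ring)
    have e1 : (1 - s) • e + s • τ = e + (τ - e) * s := by
      simp only [smul_eq_mul]
      ring
    rwa [e1] at this
  have hlin : ∀ s : ℝ, HasDerivAt (fun s : ℝ => e + (τ - e) * s) (τ - e) s := fun s => by
    simpa using ((hasDerivAt_id s).const_mul (τ - e)).const_add e
  refine ⟨fun s => rot θ (Q.γ (e + (τ - e) * s)), fun s => (τ - e) • rot θ (Q.vel (e + (τ - e) * s)),
    ?_, ?_, ?_, ?_, ?_, ?_, ?_⟩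
  · change rot θ (Q.γ (e + (τ - e) * 1)) = rot θ (Q.γ τ)
    rw [mul_one, add_sub_cancel]
  · exact fun s hs => Q.rot_mem_surface θ (Q.γ_mem_surface (hmaps s hs))
  · simp only [← rotL_apply]
    refine ContinuousOn.fun_const_smul ?_ _
    refine (rotL θ).continuous.comp_continuousOn (Q.continuousOn_vel.comp ?_ hmaps)
    fun_prop
  · intro s hs
    have h1 := (Q.hasDerivWithinAt_γ (hmaps s hs)).scomp s (hlin s).hasDerivWithinAt
      (hmaps : MapsTo (fun s : ℝ => e + (τ - e) * s) (Icc 0 1) Q.I)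
    have h2 := (rotL θ).hasFDerivAt.comp_hasDerivWithinAt s h1
    simp only [map_smul, rotL_apply] at h2
    refine h2.congr_of_eventuallyEq ?_ ?_
    · exact Filter.Eventually.of_forall fun r => (rotL_apply θ _).symm
    · exact (rotL_apply θ _).symm
  · have h1 : Q.γ e 1 = 0 := Q.in_plane e heI
    have h2 : Q.γ e 0 = 0 := abs_eq_zero.1 he0
    simp [h1, h2]
  · have h1 : Q.γ e 1 = 0 := Q.in_plane e heI
    have h2 : Q.γ e 0 = 0 := abs_eq_zero.1 he0
    simp [h1, h2]
  · intro s hs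
    have hd : |e + (τ - e) * s - e| < ρ e := by
      rw [add_sub_cancel_left, abs_mul, abs_of_nonneg hs.1]
      nlinarith [abs_nonneg (τ - e), hs.2]
    have h1 := hρ' e heI he0 τ hτ heb _ (hmaps s hs) hd
    rw [norm_smul, norm_rot, ← mul_pow, Real.norm_eq_abs, mul_comm]
    exact pow_le_pow_left₀ (by positivity) h1 2

theorem hasDerivWithinAt_γ_reflect (P : RevolutionProfile) {t : ℝ}
    (hm : P.a + P.b - t ∈ Icc P.a P.b) :
    HasDerivWithinAt (fun r => P.γ (P.a + P.b - r)) (-P.vel (P.a + P.b - t)) (Icc P.a P.b) t := by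
  have hd : HasDerivAt (fun r : ℝ => P.a + P.b - r) (-1) t := (hasDerivAt_id t).const_sub _
  have hmaps : MapsTo (fun r : ℝ => P.a + P.b - r) (Icc P.a P.b) P.I := fun r hr =>
    ⟨by simp only; linarith [hr.2], by simp only; linarith [hr.1]⟩
  have h1 := (P.hasDerivWithinAt_γ hm).scomp t hd.hasDerivWithinAt hmaps
  rw [neg_one_smul] at h1
  exact h1

/-- The profile with the opposite orientation. -/
def reverse (P : RevolutionProfile) : RevolutionProfile where
  a := P.a
  b := P.b
  γ := fun t => P.γ (P.a + P.b - t)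
  a_lt_b := P.a_lt_b
  contDiffOn := P.contDiffOn.comp (by fun_prop) fun t ht => ⟨by linarith [ht.2], by linarith [ht.1]⟩
  in_plane := fun t ht => P.in_plane _ ⟨by linarith [ht.2], by linarith [ht.1]⟩
  x_nonneg := fun t ht => P.x_nonneg _ ⟨by linarith [ht.2], by linarith [ht.1]⟩
  regular := fun t ht => by
    have hm : P.a + P.b - t ∈ Icc P.a P.b := ⟨by linarith [ht.2], by linarith [ht.1]⟩
    have h2 := (P.hasDerivWithinAt_γ_reflect hm).derivWithin (uniqueDiffOn_Icc P.a_lt_b t ht)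
    rw [h2, neg_ne_zero]
    exact P.vel_ne_zero hm
  simple := fun s hs t ht h => by
    have h1 := P.simple _ ⟨by linarith [hs.2], by linarith [hs.1]⟩ _
      ⟨by linarith [ht.2], by linarith [ht.1]⟩ h
    rcases h1 with h1 | ⟨h1, h2⟩ | ⟨h1, h2⟩
    · exact Or.inl (by linarith)
    · exact Or.inr (Or.inr ⟨by linarith, by linarith⟩)
    · exact Or.inr (Or.inl ⟨by linarith, by linarith⟩)
  perp_axis := fun t ht h0 => by
    have hm : P.a + P.b - t ∈ Icc P.a P.b := ⟨by linarith [ht.2], by linarith [ht.1]⟩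
    have h2 := (P.hasDerivWithinAt_γ_reflect hm).derivWithin (uniqueDiffOn_Icc P.a_lt_b t ht)
    rw [h2, PiLp.neg_apply, neg_eq_zero]
    exact P.perp_axis _ hm h0
  loop_off_axis := fun h => by
    simp only [add_sub_cancel_left, add_sub_cancel_right] at h ⊢
    rw [h]
    exact P.loop_off_axis h.symm

theorem vel_reverse {t : ℝ} (ht : t ∈ P.I) : P.reverse.vel t = -P.vel (P.a + P.b - t) := by
  have hm : P.a + P.b - t ∈ Icc P.a P.b := ⟨by linarith [ht.2], by linarith [ht.1]⟩
  exact (P.hasDerivWithinAt_γ_reflect hm).derivWithin (uniqueDiffOn_Icc P.a_lt_b t ht)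

theorem h₁_reverse (t : ℝ) : P.reverse.h₁ t = P.h₁ (P.a + P.b - t) := rfl

theorem h₂_reverse {t : ℝ} (ht : t ∈ P.I) : P.reverse.h₂ t = P.h₂ (P.a + P.b - t) := by
  rw [h₂_eq, h₂_eq, vel_reverse ht, norm_neg]

end RevolutionProfile

theorem IsCurve.comp_reflect {a b : ℝ} {v v' : ℝ → E3} (h : IsCurve a b False v v') :
    IsCurve a b False (fun t => v (a + b - t)) (fun t => -v' (a + b - t)) := by
  have hm : ∀ t ∈ Ioo a b, a + b - t ∈ Ioo a b := fun t ht =>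
    ⟨by linarith [ht.2], by linarith [ht.1]⟩
  refine ⟨fun i t ht => ?_, fun s hs t ht i => ?_, fun hf => hf.elim⟩
  · have hc : (a + b) - (t + b) / 2 ∈ Ioo a b := hm _ ⟨by linarith [ht.1, ht.2], by linarith [ht.1, ht.2]⟩
    have hd : (a + b) - (a + t) / 2 ∈ Ioo a b := hm _ ⟨by linarith [ht.1, ht.2], by linarith [ht.1, ht.2]⟩
    refine ⟨Icc ((a + t) / 2) ((t + b) / 2), mem_nhdsWithin_of_mem_nhds
      (Icc_mem_nhds (by linarith [ht.1]) (by linarith [ht.2])), ?_⟩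
    have h1 : IntegrableOn (fun t => v' t i) (Icc ((a + b) - (t + b) / 2) ((a + b) - (a + t) / 2)) :=
      (h.locInt i).integrableOn_compact_subset (fun r hr => ⟨hc.1.trans_le hr.1, hr.2.trans_lt hd.2⟩)
        isCompact_Icc
    have hle : (a + b) - (t + b) / 2 ≤ (a + b) - (a + t) / 2 := by linarith [ht.1, ht.2]
    have h2 := ((intervalIntegrable_iff_integrableOn_Icc_of_le hle).2 h1).comp_sub_left (a + b)
    rw [sub_sub_cancel, sub_sub_cancel] at h2
    exact ((intervalIntegrable_iff_integrableOn_Icc_of_le (by linarith [ht.1, ht.2])).1 h2.symm).neg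
  · simp only [PiLp.neg_apply]
    rw [h.ftc _ (hm s hs) _ (hm t ht) i, intervalIntegral.integral_neg,
      intervalIntegral.integral_comp_sub_left (fun r => v' r i), intervalIntegral.integral_symm]

theorem IsCurve.of_base {a b c : ℝ} {v v' : ℝ → E3} (hc : c ∈ Ioo a b)
    (hl : ∀ i, LocallyIntegrableOn (fun t => v' t i) (Ioo a b))
    (h : ∀ t ∈ Ioo a b, ∀ i, v t i - v c i = ∫ r in c..t, v' r i) : IsCurve a b False v v' := by
  refine ⟨hl, fun s hs t ht i => ?_, fun hf => hf.elim⟩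
  have hI : ∀ t ∈ Ioo a b, IntervalIntegrable (fun t => v' t i) volume c t := by
    intro t ht
    rw [intervalIntegrable_iff]
    refine ((hl i).integrableOn_compact_subset (t := uIcc c t) ?_ isCompact_uIcc).mono_set
      uIoc_subset_uIcc
    exact ordConnected_Ioo.uIcc_subset hc ht
  rw [← intervalIntegral.integral_interval_sub_left (hI t ht) (hI s hs), ← h t ht i, ← h s hs i]
  ring

/-- Replacing an initial piece of a curve. -/
theorem IsCurve.replace_left {a b c : ℝ} {v v' y y' : ℝ → E3} (h : IsCurve a b False v v')
    (hc : c ∈ Ioo a b) (hy : ∀ t ∈ Icc a c, HasDerivWithinAt y (y' t) (Icc a c) t)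
    (hy' : ContinuousOn y' (Icc a c)) (hyc : y c = v c) :
    IsCurve a b False (fun t => if t ≤ c then y t else v t)
      (fun t => if t ≤ c then y' t else v' t) := by
  have hyi : ∀ i, ContinuousOn (fun t => y' t i) (Icc a c) := fun i =>
    (continuous_apply_E3 i).comp_continuousOn hy'
  have hl : ∀ i, LocallyIntegrableOn (fun t => (if t ≤ c then y' t else v' t) i) (Ioo a b) := by
    intro i t ht
    refine ⟨Icc ((a + t) / 2) ((t + b) / 2), mem_nhdsWithin_of_mem_nhds
      (Icc_mem_nhds (by linarith [ht.1]) (by linarith [ht.2])), ?_⟩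
    have h1 : IntegrableOn (fun t => v' t i) (Icc ((a + t) / 2) ((t + b) / 2)) :=
      (h.locInt i).integrableOn_compact_subset (fun r hr =>
        ⟨by linarith [hr.1, ht.1], by linarith [hr.2, ht.2]⟩) isCompact_Icc
    have h2 : IntegrableOn (fun t => y' t i) (Icc a c) := (hyi i).integrableOn_Icc
    have h3 : IntegrableOn (fun t => (if t ≤ c then y' t else v' t) i) (Icc a c) :=
      h2.congr_fun (fun r hr => by simp only [if_pos hr.2]) measurableSet_Icc
    have h4 : IntegrableOn (fun t => (if t ≤ c then y' t else v' t) i)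
        (Icc ((a + t) / 2) ((t + b) / 2) ∩ Ioi c) :=
      (h1.mono_set inter_subset_left).congr_fun
        (fun r hr => by simp only [if_neg (not_le.2 (mem_Ioi.1 hr.2))]) (measurableSet_Icc.inter measurableSet_Ioi)
    refine (h3.union h4).mono_set fun r hr => ?_
    rcases le_or_gt r c with hrc | hrc
    · exact Or.inl ⟨by linarith [hr.1, ht.1], hrc⟩
    · exact Or.inr ⟨hr, hrc⟩
  refine IsCurve.of_base hc hl fun t ht i => ?_
  simp only [le_refl, if_true]
  rcases le_or_gt t c with htc | htc
  · simp only [if_pos htc]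
    have h1 : ∫ r in t..c, y' r i = y c i - y t i := by
      have hsub : Icc t c ⊆ Icc a c := Icc_subset_Icc ht.1.le le_rfl
      refine (IsPrimitiveOn.of_hasDerivAt htc (f := fun r => y r i) ?_ ?_ ?_).integral_eq htc
      · exact fun r hr => ((hasDerivWithinAt_apply (hy r (hsub hr)) i).continuousWithinAt).mono hsub
      · exact fun r hr => (hasDerivWithinAt_apply (hy r (hsub (Ioo_subset_Icc_self hr))) i).hasDerivAt
          (Icc_mem_nhds (ht.1.trans hr.1) hr.2)
      · exact ((hyi i).mono (by rw [uIcc_of_le htc]; exact hsub)).intervalIntegrable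
    rw [intervalIntegral.integral_symm, ← neg_sub, ← h1]
    congr 1
    refine intervalIntegral.integral_congr fun r hr => ?_
    rw [uIcc_of_le htc] at hr
    simp only [if_pos hr.2]
  · simp only [if_neg (not_le.2 htc)]
    rw [hyc, h.ftc c hc t ht i]
    refine intervalIntegral.integral_congr_ae (ae_of_all _ fun r hr => ?_)
    rw [uIoc_of_le htc.le] at hr
    simp only [if_neg (not_le.2 hr.1)]

namespace RevolutionProfile

variable {P Q : RevolutionProfile}

/-- A curve of minimal energy in a set, among all curves without boundary conditions. -/
def IsMinimalCurve (P : RevolutionProfile) (S : Set E3) (g : ℝ → ℝ) (a : E3 → E3)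
    (v v' : ℝ → E3) : Prop :=
  ∀ Y Y', IsCurve P.a P.b False Y Y' → (∀ t ∈ Ioo P.a P.b, Y t ∈ S) →
    P.curveEnergy g a v v' ≤ P.curveEnergy g a Y Y'

/-- The energy density of a curve. -/
noncomputable def totalDensity (P : RevolutionProfile) (g : ℝ → ℝ) (a : E3 → E3) (v v' : ℝ → E3)
    (t : ℝ) : ℝ :=
  P.curveDensity v v' t + P.h₁ t * P.h₂ t * g (inner ℝ (v t) (a (P.γ t)))

/-- Only the piece before `c` is replaced, and the finite energy of the rest cancels. The new piece
is free at the left end point; it has to match the old curve at `c` only. -/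
theorem IsMinimalCurve.lintegral_left_le {S : Set E3} {g : ℝ → ℝ} {a : E3 → E3}
    {v v' y y' : ℝ → E3} (hmin : P.IsMinimalCurve S g a v v') (hfin : P.curveEnergy g a v v' < ∞)
    (h : IsCurve P.a P.b False v v') (hv : ∀ t ∈ Ioo P.a P.b, v t ∈ S) {c : ℝ}
    (hc : c ∈ Ioo P.a P.b) (hy : ∀ t ∈ Icc P.a c, HasDerivWithinAt y (y' t) (Icc P.a c) t)
    (hy' : ContinuousOn y' (Icc P.a c)) (hyc : y c = v c) (hyS : ∀ t ∈ Icc P.a c, y t ∈ S) :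
    ∫⁻ t in Icc P.a c, ENNReal.ofReal (P.totalDensity g a v v' t) ≤
      ∫⁻ t in Icc P.a c, ENNReal.ofReal (P.totalDensity g a y y' t) := by
  have key := hmin _ _ (h.replace_left hc hy hy' hyc) fun t ht => by
    split_ifs with htc
    · exact hyS t ⟨ht.1.le, htc⟩
    · exact hv t ht
  have hun : P.I = Icc P.a c ∪ Ioc c P.b := (Icc_union_Ioc_eq_Icc hc.1.le hc.2.le).symm
  have hdis : Disjoint (Icc P.a c) (Ioc c P.b) :=
    disjoint_left.2 fun r hr hr' => (hr'.1.trans_le hr.2).false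
  unfold curveEnergy at key hfin
  rw [hun, lintegral_union measurableSet_Ioc hdis] at key hfin
  rw [lintegral_union measurableSet_Ioc hdis] at key
  have e1 : ∫⁻ t in Ioc c P.b, ENNReal.ofReal (P.curveDensity (fun t => if t ≤ c then y t else v t)
      (fun t => if t ≤ c then y' t else v' t) t + P.h₁ t * P.h₂ t *
        g (inner ℝ (if t ≤ c then y t else v t) (a (P.γ t)))) =
      ∫⁻ t in Ioc c P.b, ENNReal.ofReal (P.curveDensity v v' t + P.h₁ t * P.h₂ t *
        g (inner ℝ (v t) (a (P.γ t)))) := by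
    refine setLIntegral_congr_fun measurableSet_Ioc fun t ht => ?_
    simp only [curveDensity, if_neg (not_le.2 ht.1)]
  have e2 : ∫⁻ t in Icc P.a c, ENNReal.ofReal (P.curveDensity (fun t => if t ≤ c then y t else v t)
      (fun t => if t ≤ c then y' t else v' t) t + P.h₁ t * P.h₂ t *
        g (inner ℝ (if t ≤ c then y t else v t) (a (P.γ t)))) =
      ∫⁻ t in Icc P.a c, ENNReal.ofReal (P.totalDensity g a y y' t) := by
    refine setLIntegral_congr_fun measurableSet_Icc fun t ht => ?_
    simp only [totalDensity, curveDensity, if_pos ht.2]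
  rw [e1, e2] at key
  exact (ENNReal.add_le_add_iff_right (ENNReal.add_lt_top.1 hfin).2.ne).1 key

/-- The mean value inequality, starting from the point `Y 0` on the axis. -/
theorem hor_sq_path_le {Y Y' : ℝ → E3} {L : ℝ} (hL : 0 ≤ L)
    (hY : ∀ s ∈ Icc (0 : ℝ) 1, HasDerivWithinAt Y (Y' s) (Icc 0 1) s) (h0 : Y 0 0 = 0)
    (h1 : Y 0 1 = 0) (hY' : ∀ s ∈ Icc (0 : ℝ) 1, ‖Y' s‖ ^ 2 ≤ L) {s : ℝ} (hs : s ∈ Icc (0 : ℝ) 1) :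
    Y s 0 ^ 2 + Y s 1 ^ 2 ≤ L * s ^ 2 := by
  have h2 : ‖Y s - Y 0‖ ≤ Real.sqrt L * ‖s - 0‖ :=
    (convex_Icc (0 : ℝ) 1).norm_image_sub_le_of_norm_hasDerivWithin_le hY
      (fun r hr => Real.le_sqrt_of_sq_le (hY' r hr)) ⟨le_rfl, zero_le_one⟩ hs
  have h3 := pow_le_pow_left₀ (norm_nonneg _) h2 2
  rw [mul_pow, Real.sq_sqrt hL, sub_zero, Real.norm_eq_abs, sq_abs, norm_sq_eq_coords] at h3
  simp only [PiLp.sub_apply, h0, h1, sub_zero] at h3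
  nlinarith [sq_nonneg (Y s 2 - Y 0 2)]

/-- Comparison with the cone over the end point: near a pole the energy of a minimal curve is
almost dominated by the squared distance of its end point to the axis. -/
theorem IsMinimalCurve.lintegral_le_of_pole {g : ℝ → ℝ} (hg0 : ∀ s, 0 ≤ g s) {a : E3 → E3}
    {v v' : ℝ → E3} (hmin : P.IsMinimalCurve Q.surface g a v v')
    (hfin : P.curveEnergy g a v v' < ∞) (h : IsCurve P.a P.b False v v')
    (hv : ∀ t ∈ Ioo P.a P.b, v t ∈ Q.surface) (h0 : P.h₁ P.a = 0) {c Γ : ℝ}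
    (hΓ : ∀ w ∈ Q.surface, ∀ t ∈ P.I, g (inner ℝ w (a (P.γ t))) ≤ Γ)
    (hc : c ∈ Ioo P.a P.b) (hvel : ∀ t ∈ Icc P.a c, ‖P.vel t‖ ≤ 26 / 25 * P.vel t 0)
    {Y Y' : ℝ → E3} (hY1 : Y 1 = v c) (hYS : ∀ s ∈ Icc (0 : ℝ) 1, Y s ∈ Q.surface)
    (hY'c : ContinuousOn Y' (Icc 0 1))
    (hY : ∀ s ∈ Icc (0 : ℝ) 1, HasDerivWithinAt Y (Y' s) (Icc 0 1) s) (hY00 : Y 0 0 = 0)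
    (hY01 : Y 0 1 = 0)
    (hY' : ∀ s ∈ Icc (0 : ℝ) 1, ‖Y' s‖ ^ 2 ≤ (1 + 1 / 50) ^ 2 * (v c 0 ^ 2 + v c 1 ^ 2)) :
    ∫⁻ t in Icc P.a c, ENNReal.ofReal (P.totalDensity g a v v' t) ≤
      ENNReal.ofReal (11 / 10 * (v c 0 ^ 2 + v c 1 ^ 2) + Γ * P.γ c 0 ^ 2) := by
  set q := v c 0 ^ 2 + v c 1 ^ 2 with hq
  have hq0 : 0 ≤ q := by positivity
  set x : ℝ → ℝ := fun t => P.γ t 0 with hx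
  set x₀ := P.γ c 0 with hx₀
  have hsub : Icc P.a c ⊆ P.I := Icc_subset_Icc le_rfl hc.2.le
  have hx₀pos : 0 < x₀ := by rw [hx₀, ← P.h₁_eq (Ioo_subset_Icc_self hc)]; exact P.h₁_pos hc
  have hxa : x P.a = 0 := abs_eq_zero.1 h0
  have hvel0 : ∀ t ∈ Icc P.a c, 0 < P.vel t 0 := fun t ht => by
    have h1 := hvel t ht
    have h2 : 0 < ‖P.vel t‖ := norm_pos_iff.2 (P.vel_ne_zero (hsub ht))
    linarith
  have hxd : ∀ t ∈ Icc P.a c, HasDerivWithinAt x (P.vel t 0) (Icc P.a c) t := fun t ht =>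
    (hasDerivWithinAt_apply (P.hasDerivWithinAt_γ (hsub ht)) 0).mono hsub
  have hxc : ContinuousOn x (Icc P.a c) := fun t ht => (hxd t ht).continuousWithinAt
  have hx'c : ContinuousOn (fun t => P.vel t 0) (Icc P.a c) :=
    (continuous_apply_E3 0).comp_continuousOn (P.continuousOn_vel.mono hsub)
  have hmono : MonotoneOn x (Icc P.a c) :=
    monotoneOn_of_deriv_nonneg (convex_Icc _ _) hxc
      (fun t ht => ((hxd t (interior_subset ht)).hasDerivAt
        (by rw [interior_Icc] at ht; exact Icc_mem_nhds ht.1 ht.2)).differentiableAt.differentiableWithinAt)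
      fun t ht => by
        rw [((hxd t (interior_subset ht)).hasDerivAt
          (by rw [interior_Icc] at ht; exact Icc_mem_nhds ht.1 ht.2)).deriv]
        exact (hvel0 t (interior_subset ht)).le
  have hs : ∀ t ∈ Icc P.a c, x t / x₀ ∈ Icc (0 : ℝ) 1 := fun t ht => by
    have h1 := hmono ⟨le_rfl, hc.1.le⟩ ht ht.1
    have h2 := hmono ht ⟨hc.1.le, le_rfl⟩ ht.2
    rw [hxa] at h1
    exact ⟨div_nonneg h1 hx₀pos.le, (div_le_one hx₀pos).2 h2⟩
  -- The competitor runs along `Y` in proportion to the distance x(t) of the profile from the axis;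
  -- this parametrization makes its density at most a constant times x x'.
  have hyd : ∀ t ∈ Icc P.a c, HasDerivWithinAt (fun t => Y (x t / x₀))
      ((P.vel t 0 / x₀) • Y' (x t / x₀)) (Icc P.a c) t := fun t ht =>
    (hY _ (hs t ht)).scomp t ((hxd t ht).div_const x₀) hs
  have hyc' : ContinuousOn (fun t => (P.vel t 0 / x₀) • Y' (x t / x₀)) (Icc P.a c) :=
    (hx'c.div_const x₀).smul (hY'c.comp (hxc.div_const x₀) hs)
  refine (hmin.lintegral_left_le hfin h hv hc hyd hyc' ?_ fun t ht => hYS _ (hs t ht)).trans ?_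
  · change Y (x₀ / x₀) = v c
    rw [div_self hx₀pos.ne', hY1]
  have hΓ0 : 0 ≤ Γ := (hg0 _).trans (hΓ _ (hv c hc) c (Ioo_subset_Icc_self hc))
  -- Here 51/25 = 26/25 + 1: the angular term loses the factor 26/25 from the bound of the speed by
  -- the radial velocity, the meridional term loses nothing.
  set κ := 51 / 25 * (1 + 1 / 50) ^ 2 * q / x₀ ^ 2 + 26 / 25 * Γ with hκ
  have hκ0 : 0 ≤ κ := by positivity
  have hpt : ∀ t ∈ Ioc P.a c, P.totalDensity g a (fun t => Y (x t / x₀))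
      (fun t => (P.vel t 0 / x₀) • Y' (x t / x₀)) t ≤ κ * (x t * P.vel t 0) := by
    intro t ht
    have ht' : t ∈ Icc P.a c := Ioc_subset_Icc_self ht
    have hI := hsub ht'
    have htI : t ∈ Ioo P.a P.b := ⟨ht.1, ht.2.trans_lt hc.2⟩
    have e1 : P.h₁ t = x t := P.h₁_eq hI
    have hxt : 0 < x t := by rw [← e1]; exact P.h₁_pos htI
    have e2 : P.h₂ t = ‖P.vel t‖ := rfl
    have hh : 0 < ‖P.vel t‖ := norm_pos_iff.2 (P.vel_ne_zero hI)
    have k1 := hor_sq_path_le (L := (1 + 1 / 50) ^ 2 * q) (by positivity) hY hY00 hY01 hY' (hs t ht')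
    have k2 := hY' _ (hs t ht')
    have k3 := hΓ _ (hYS _ (hs t ht')) t hI
    have k4 := hvel t ht'
    have k5 := hvel0 t ht'
    have k6 : P.vel t 0 ≤ ‖P.vel t‖ := (le_abs_self _).trans (abs_apply_le_norm _ 0)
    unfold totalDensity curveDensity
    rw [e1, e2, norm_smul, mul_pow, Real.norm_eq_abs, sq_abs]
    have b1 : ‖P.vel t‖ / x t * (Y (x t / x₀) 0 ^ 2 + Y (x t / x₀) 1 ^ 2) ≤
        26 / 25 * ((1 + 1 / 50) ^ 2 * q / x₀ ^ 2) * (x t * P.vel t 0) := by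
      calc ‖P.vel t‖ / x t * (Y (x t / x₀) 0 ^ 2 + Y (x t / x₀) 1 ^ 2)
          ≤ ‖P.vel t‖ / x t * ((1 + 1 / 50) ^ 2 * q * (x t / x₀) ^ 2) := by gcongr
        _ = ((1 + 1 / 50) ^ 2 * q / x₀ ^ 2) * x t * ‖P.vel t‖ := by field_simp
        _ ≤ ((1 + 1 / 50) ^ 2 * q / x₀ ^ 2) * x t * (26 / 25 * P.vel t 0) := by gcongr
        _ = _ := by ring
    have b2 : x t / ‖P.vel t‖ * ((P.vel t 0 / x₀) ^ 2 * ‖Y' (x t / x₀)‖ ^ 2) ≤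
        ((1 + 1 / 50) ^ 2 * q / x₀ ^ 2) * (x t * P.vel t 0) := by
      calc x t / ‖P.vel t‖ * ((P.vel t 0 / x₀) ^ 2 * ‖Y' (x t / x₀)‖ ^ 2)
          ≤ x t / ‖P.vel t‖ * ((P.vel t 0 / x₀) ^ 2 * ((1 + 1 / 50) ^ 2 * q)) := by gcongr
        _ = ((1 + 1 / 50) ^ 2 * q / x₀ ^ 2) * x t * (P.vel t 0 * P.vel t 0 / ‖P.vel t‖) := by
            field_simp
        _ ≤ ((1 + 1 / 50) ^ 2 * q / x₀ ^ 2) * x t * P.vel t 0 := by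
            gcongr
            rw [div_le_iff₀ hh]
            gcongr
        _ = _ := by ring
    have b3 : x t * ‖P.vel t‖ * g (inner ℝ (Y (x t / x₀)) (a (P.γ t))) ≤
        26 / 25 * Γ * (x t * P.vel t 0) := by
      calc x t * ‖P.vel t‖ * g (inner ℝ (Y (x t / x₀)) (a (P.γ t)))
          ≤ x t * (26 / 25 * P.vel t 0) * Γ := by
            have := hg0 (inner ℝ (Y (x t / x₀)) (a (P.γ t)))
            gcongr
        _ = _ := by ring
    have b4 : κ * (x t * P.vel t 0) = 26 / 25 * ((1 + 1 / 50) ^ 2 * q / x₀ ^ 2) * (x t * P.vel t 0)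
        + ((1 + 1 / 50) ^ 2 * q / x₀ ^ 2) * (x t * P.vel t 0) + 26 / 25 * Γ * (x t * P.vel t 0) := by
      rw [hκ]; ring
    linarith
  have hint : IntervalIntegrable (fun t => x t * P.vel t 0) volume P.a c :=
    ((by rw [uIcc_of_le hc.1.le]; exact hxc.mul hx'c : ContinuousOn _ (uIcc P.a c))).intervalIntegrable
  have hval : ∫ t in P.a..c, x t * P.vel t 0 = x₀ ^ 2 / 2 := by
    have hp : IsPrimitiveOn (fun t => x t ^ 2 / 2) (fun t => x t * P.vel t 0) P.a c := by
      refine IsPrimitiveOn.of_hasDerivAt hc.1.le ((hxc.pow 2).div_const 2) (fun t ht => ?_) hint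
      have := ((hxd t (Ioo_subset_Icc_self ht)).hasDerivAt (Icc_mem_nhds ht.1 ht.2)).pow 2
      refine (this.div_const 2).congr_deriv ?_
      simp only [Nat.cast_ofNat, Nat.add_one_sub_one, pow_one]
      ring
    rw [hp.integral_eq hc.1.le, hxa]
    simp [hx, hx₀]
  rw [← restrict_Ioc_eq_restrict_Icc]
  calc ∫⁻ t in Ioc P.a c, ENNReal.ofReal (P.totalDensity g a (fun t => Y (x t / x₀))
        (fun t => (P.vel t 0 / x₀) • Y' (x t / x₀)) t)
      ≤ ∫⁻ t in Ioc P.a c, ENNReal.ofReal (κ * (x t * P.vel t 0)) :=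
        setLIntegral_mono' measurableSet_Ioc fun t ht => ENNReal.ofReal_le_ofReal (hpt t ht)
    _ = ENNReal.ofReal (∫ t in P.a..c, κ * (x t * P.vel t 0)) := by
        rw [intervalIntegral.integral_of_le hc.1.le, ofReal_integral_eq_lintegral_ofReal
          (hint.1.const_mul κ)]
        filter_upwards [ae_restrict_mem measurableSet_Ioc] with t ht
        have h1 := (hs t (Ioc_subset_Icc_self ht)).1
        have h2 : 0 ≤ x t := by
          have := mul_nonneg h1 hx₀pos.le
          rwa [div_mul_cancel₀ _ hx₀pos.ne'] at this
        exact mul_nonneg hκ0 (mul_nonneg h2 (hvel0 t (Ioc_subset_Icc_self ht)).le)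
    _ ≤ _ := by
        rw [intervalIntegral.integral_const_mul, hval]
        refine ENNReal.ofReal_le_ofReal ?_
        -- The integral of x x' halves the constant, and (51/50)³ < 11/10 closes the estimate.
        have e1 : κ * (x₀ ^ 2 / 2) = 51 / 50 * (1 + 1 / 50) ^ 2 * q + 13 / 25 * (Γ * x₀ ^ 2) := by
          rw [hκ]; field_simp; ring
        rw [e1]
        have e2 : 0 ≤ Γ * x₀ ^ 2 := by positivity
        nlinarith

end RevolutionProfile

/-! ### Finite Dirichlet integral up to the poles -/

namespace RevolutionProfile

variable {P Q : RevolutionProfile}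

theorem integrableOn_curveDensity {g : ℝ → ℝ} (hg0 : ∀ s, 0 ≤ g s) {a : E3 → E3}
    {v v' : ℝ → E3} {loop : Prop} (h : IsCurve P.a P.b loop v v')
    (hfin : P.curveEnergy g a v v' < ∞) : IntegrableOn (P.curveDensity v v') P.I := by
  refine ⟨(P.aemeasurable_curveDensity h.aestronglyMeasurable
    h.aestronglyMeasurable_deriv).aestronglyMeasurable, ?_⟩
  rw [hasFiniteIntegral_iff_ofReal (ae_of_all _ fun t => P.curveDensity_nonneg v v' t)]
  refine (lintegral_mono fun t => ENNReal.ofReal_le_ofReal ?_).trans_lt hfin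
  have h1 : 0 ≤ P.h₂ t := norm_nonneg _
  exact le_add_of_nonneg_right (mul_nonneg (mul_nonneg (P.h₁_nonneg t) h1) (hg0 _))

theorem _root_.sq_hor_inner_le (v w : E3) :
    (2 * (v 0 * w 0 + v 1 * w 1)) ^ 2 ≤ 4 * (v 0 ^ 2 + v 1 ^ 2) * ‖w‖ ^ 2 := by
  rw [norm_sq_eq_coords]
  nlinarith [sq_nonneg (v 0 * w 1 - v 1 * w 0), sq_nonneg (v 0 * w 2), sq_nonneg (v 1 * w 2)]

/-- Cauchy-Schwarz and the arithmetic-geometric mean inequality; the two weights in the density are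
reciprocal. The left side is the derivative of the squared distance to the axis. -/
theorem hor_inner_le_curveDensity (v v' : ℝ → E3) {t : ℝ} (ht : t ∈ Ioo P.a P.b) :
    2 * (v t 0 * v' t 0 + v t 1 * v' t 1) ≤ P.curveDensity v v' t := by
  have h1 := P.h₁_pos ht
  have h2 := P.h₂_pos (Ioo_subset_Icc_self ht)
  refine abs_le_of_sq_le_sq' ((sq_hor_inner_le (v t) (v' t)).trans ?_)
    (P.curveDensity_nonneg v v' t) |>.2
  have h3 : 4 * (v t 0 ^ 2 + v t 1 ^ 2) * ‖v' t‖ ^ 2 =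
      4 * (P.h₂ t / P.h₁ t * (v t 0 ^ 2 + v t 1 ^ 2)) * (P.h₁ t / P.h₂ t * ‖v' t‖ ^ 2) := by
    field_simp
  rw [h3, curveDensity]
  nlinarith [sq_nonneg (P.h₂ t / P.h₁ t * (v t 0 ^ 2 + v t 1 ^ 2) - P.h₁ t / P.h₂ t * ‖v' t‖ ^ 2)]

theorem isPrimitiveOn_hor_sq {loop : Prop} {v v' : ℝ → E3} {a b : ℝ} (h : IsCurve a b loop v v')
    {s t : ℝ} (hs : a < s) (hst : s ≤ t) (ht : t < b) :
    IsPrimitiveOn (fun r => v r 0 ^ 2 + v r 1 ^ 2)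
      (fun r => 2 * (v r 0 * v' r 0 + v r 1 * v' r 1)) s t := by
  have h0 := (h.isPrimitiveOn hs hst ht 0).mul hst (h.isPrimitiveOn hs hst ht 0)
  have h1 := (h.isPrimitiveOn hs hst ht 1).mul hst (h.isPrimitiveOn hs hst ht 1)
  have h2 := h0.add h1
  have e1 : (fun r => v r 0 * v r 0 + v r 1 * v r 1) = fun r => v r 0 ^ 2 + v r 1 ^ 2 := by
    funext r; ring
  have e2 : (fun r => v' r 0 * v r 0 + v r 0 * v' r 0 + (v' r 1 * v r 1 + v r 1 * v' r 1)) =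
      fun r => 2 * (v r 0 * v' r 0 + v r 1 * v' r 1) := by
    funext r; ring
  rwa [e1, e2] at h2

section Growth

variable {v v' : ℝ → E3}

/-- The squared distance to the axis grows at most as fast as the energy. -/
theorem hor_sq_sub_le {loop : Prop} (h : IsCurve P.a P.b loop v v')
    (hi : IntegrableOn (P.curveDensity v v') P.I) {s t : ℝ} (hs : P.a < s) (hst : s ≤ t)
    (ht : t < P.b) :
    (v t 0 ^ 2 + v t 1 ^ 2) - (v s 0 ^ 2 + v s 1 ^ 2) ≤ ∫ r in s..t, P.curveDensity v v' r := by
  have hp := isPrimitiveOn_hor_sq h hs hst ht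
  rw [← hp.integral_eq hst]
  refine intervalIntegral.integral_mono_on hst hp.1 ?_ fun r hr =>
    hor_inner_le_curveDensity v v' ⟨hs.trans_le hr.1, hr.2.trans_lt ht⟩
  rw [intervalIntegrable_iff_integrableOn_Icc_of_le hst]
  exact hi.mono_set (Icc_subset_Icc hs.le ht.le)

/-- Otherwise the growth bound keeps the squared distance to the axis above some κ > 0 down to the
pole, and the integrable density would dominate κ h₂/h₁, which is not integrable there. In effect
the curve starts on the axis. -/
theorem hor_sq_le_of_pole {loop : Prop} (h : IsCurve P.a P.b loop v v')
    (hi : IntegrableOn (P.curveDensity v v') P.I) (h0 : P.h₁ P.a = 0) {t : ℝ}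
    (ht : t ∈ Ioo P.a P.b) :
    v t 0 ^ 2 + v t 1 ^ 2 ≤ ∫ r in P.a..t, P.curveDensity v v' r := by
  by_contra! hcon
  set f := P.curveDensity v v' with hf
  set κ := v t 0 ^ 2 + v t 1 ^ 2 - ∫ r in P.a..t, f r with hκ
  have hκ0 : 0 < κ := sub_pos.2 hcon
  have hint : ∀ r ∈ Icc P.a t, IntervalIntegrable f volume P.a r := fun r hr => by
    rw [intervalIntegrable_iff_integrableOn_Icc_of_le hr.1]
    exact hi.mono_set (Icc_subset_Icc le_rfl (hr.2.trans ht.2.le))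
  have hlow : ∀ r ∈ Ioc P.a t, κ ≤ v r 0 ^ 2 + v r 1 ^ 2 := fun r hr => by
    have h1 := hor_sq_sub_le h hi hr.1 hr.2 ht.2
    have h2 : ∫ s in r..t, f s = (∫ s in P.a..t, f s) - ∫ s in P.a..r, f s :=
      (intervalIntegral.integral_interval_sub_left (hint t ⟨ht.1.le, le_rfl⟩)
        (hint r ⟨hr.1.le, hr.2⟩)).symm
    have h3 : 0 ≤ ∫ s in P.a..r, f s :=
      intervalIntegral.integral_nonneg hr.1.le fun s _ => P.curveDensity_nonneg v v' s
    linarith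
  have htop := lintegral_ratio_eq_top (P := P) ht.1 (Icc_subset_Icc le_rfl ht.2.le)
    ⟨le_rfl, ht.1.le⟩ h0
  have hfi : ∫⁻ r in Icc P.a t, ENNReal.ofReal (κ⁻¹ * f r) < ∞ :=
    ((hi.mono_set (Icc_subset_Icc le_rfl ht.2.le)).const_mul κ⁻¹).lintegral_lt_top
  refine hfi.not_ge (htop ▸ ?_)
  rw [← restrict_Ioc_eq_restrict_Icc]
  refine setLIntegral_mono' measurableSet_Ioc fun r hr => ENNReal.ofReal_le_ofReal ?_
  rw [inv_mul_eq_div, le_div_iff₀ hκ0]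
  have h1 := ratio_nonneg (P := P) r
  have h2 : 0 ≤ P.h₂ r := norm_nonneg _
  have h3 := P.h₁_nonneg r
  have h4 : 0 ≤ P.h₁ r / P.h₂ r * ‖v' r‖ ^ 2 := by positivity
  have h5 := mul_le_mul_of_nonneg_left (hlow r hr) h1
  rw [hf, curveDensity]
  linarith

/-- At the pole the speed equals the radial velocity, and both are continuous. The constant 26/25
leaves room for the factor 11/10 demanded by the Hardy-type estimate. -/
theorem exists_norm_vel_le_of_pole (h0 : P.h₁ P.a = 0) :
    ∃ T ∈ Ioo P.a P.b, ∀ t ∈ Icc P.a T, ‖P.vel t‖ ≤ 26 / 25 * P.vel t 0 := by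
  have ha : P.a ∈ P.I := ⟨le_rfl, P.a_lt_b.le⟩
  have hpos := P.vel_pos_of_pole h0
  have hn := P.norm_vel_of_pole ha h0
  rw [abs_of_pos hpos] at hn
  have hc : ContinuousWithinAt (fun t => 26 / 25 * P.vel t 0 - ‖P.vel t‖) P.I P.a :=
    ((continuousWithinAt_const.mul ((continuous_apply_E3 0).comp_continuousOn P.continuousOn_vel _ ha)).sub
      (P.continuousOn_vel _ ha).norm)
  have hev : ∀ᶠ t in nhdsWithin P.a P.I, 0 < 26 / 25 * P.vel t 0 - ‖P.vel t‖ :=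
    hc.eventually (lt_mem_nhds (by simp only [hn]; linarith))
  rw [I, nhdsWithin_Icc_eq_nhdsGE P.a_lt_b] at hev
  obtain ⟨u, hu, hu'⟩ := mem_nhdsGE_iff_exists_Icc_subset.1 hev
  refine ⟨min u ((P.a + P.b) / 2), ⟨lt_min hu (by linarith [P.a_lt_b]),
    (min_le_right _ _).trans_lt (by linarith [P.a_lt_b])⟩, fun t ht => ?_⟩
  have := hu' ⟨ht.1, ht.2.trans (min_le_left _ _)⟩
  simp only [mem_ofPred_eq] at this
  linarith

end Growth

/-- A minimal curve has finite Dirichlet integral up to a pole. -/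
theorem IsMinimalCurve.integrableOn_norm_sq_of_pole {g : ℝ → ℝ} (hg0 : ∀ s, 0 ≤ g s) {a : E3 → E3}
    {v v' : ℝ → E3} (hmin : P.IsMinimalCurve Q.surface g a v v')
    (hfin : P.curveEnergy g a v v' < ∞) (h : IsCurve P.a P.b False v v')
    (hv : ∀ t ∈ Ioo P.a P.b, v t ∈ Q.surface) (h0 : P.h₁ P.a = 0) {Γ : ℝ}
    (hΓ : ∀ w ∈ Q.surface, ∀ t ∈ P.I, g (inner ℝ w (a (P.γ t))) ≤ Γ) :
    ∃ T ∈ Ioo P.a P.b, IntegrableOn (fun t => ‖v' t‖ ^ 2) (Icc P.a T) := by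
  obtain ⟨T₁, hT₁, hvel⟩ := exists_norm_vel_le_of_pole h0
  obtain ⟨η, hη, hpath⟩ := Q.exists_path_to_axis (ε := 1 / 50) (by norm_num)
  have hi := integrableOn_curveDensity hg0 h hfin
  set f := P.curveDensity v v' with hf
  set F : ℝ → ℝ := fun t => ∫ r in P.a..t, f r with hF
  have hint : ∀ s ∈ P.I, ∀ t ∈ P.I, IntervalIntegrable f volume s t := fun s hs t ht => by
    rw [intervalIntegrable_iff]
    exact hi.mono_set (uIoc_subset_uIcc.trans (ordConnected_Icc.uIcc_subset hs ht))
  have ha : P.a ∈ P.I := ⟨le_rfl, P.a_lt_b.le⟩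
  have hb : P.b ∈ P.I := ⟨P.a_lt_b.le, le_rfl⟩
  have hFp : IsPrimitiveOn F f P.a P.b :=
    ⟨hint _ ha _ hb, fun t _ => by simp [hF]⟩
  have hFa : F P.a = 0 := by simp [hF]
  -- The squared distance to the axis is at most the energy `F`, which tends to zero at the pole; so
  -- near the pole the points of the curve are close enough to the axis for `hpath`.
  obtain ⟨T₂, hT₂, hFη⟩ : ∃ T, P.a < T ∧ ∀ t ∈ Icc P.a T, F t < η := by
    have hev : ∀ᶠ t in nhdsWithin P.a P.I, F t < η :=
      (hFp.continuousOn P.a_lt_b.le _ ha).eventually (gt_mem_nhds (by rw [hFa]; exact hη))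
    rw [I, nhdsWithin_Icc_eq_nhdsGE P.a_lt_b] at hev
    obtain ⟨u, hu, hu'⟩ := mem_nhdsGE_iff_exists_Icc_subset.1 hev
    exact ⟨u, hu, fun t ht => hu' ht⟩
  set T := min T₁ T₂ with hT
  have hTm : T ∈ Ioo P.a P.b := ⟨lt_min hT₁.1 hT₂, (min_le_left _ _).trans_lt hT₁.2⟩
  have hqF : ∀ t ∈ Ioo P.a P.b, v t 0 ^ 2 + v t 1 ^ 2 ≤ F t := fun t ht =>
    hor_sq_le_of_pole h hi h0 ht
  have hΓ0 : 0 ≤ Γ := (hg0 _).trans (hΓ _ (hv _ hTm) P.a ha)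
  have hFle : ∀ c ∈ Ioc P.a T, F c ≤ 11 / 10 * (v c 0 ^ 2 + v c 1 ^ 2) + Γ * P.γ c 0 ^ 2 := by
    intro c hc
    have hcm : c ∈ Ioo P.a P.b := ⟨hc.1, hc.2.trans_lt hTm.2⟩
    obtain ⟨Y, Y', hY1, hYS, hY'c, hY, hY00, hY01, hY'⟩ := hpath (v c) (hv c hcm)
      ((hqF c hcm).trans_lt (hFη c ⟨hc.1.le, hc.2.trans (min_le_right _ _)⟩))
    have key := hmin.lintegral_le_of_pole hg0 hfin h hv h0 hΓ hcm
      (fun t ht => hvel t ⟨ht.1, ht.2.trans (hc.2.trans (min_le_left _ _))⟩) hY1 hYS hY'c hY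
      hY00 hY01 hY'
    have h1 : ∫⁻ t in Icc P.a c, ENNReal.ofReal (f t) ≤
        ∫⁻ t in Icc P.a c, ENNReal.ofReal (P.totalDensity g a v v' t) := by
      refine lintegral_mono fun t => ENNReal.ofReal_le_ofReal ?_
      have h1 : 0 ≤ P.h₂ t := norm_nonneg _
      exact le_add_of_nonneg_right (mul_nonneg (mul_nonneg (P.h₁_nonneg t) h1) (hg0 _))
    have h2 : ENNReal.ofReal (F c) = ∫⁻ t in Icc P.a c, ENNReal.ofReal (f t) := by
      rw [hF]
      simp only
      rw [intervalIntegral.integral_of_le hc.1.le, ofReal_integral_eq_lintegral_ofReal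
        ((hint _ ha _ (Ioo_subset_Icc_self hcm)).1) (ae_of_all _ fun t => P.curveDensity_nonneg v v' t),
        restrict_Ioc_eq_restrict_Icc]
    refine (ENNReal.ofReal_le_ofReal_iff ?_).1 (h2.trans_le (h1.trans key))
    positivity
  have hsubI : Icc P.a T ⊆ P.I := Icc_subset_Icc le_rfl hTm.2.le
  have hmain : ∀ s ∈ Ioc P.a T, IntervalIntegrable (fun t => ‖v' t‖ ^ 2) volume s T ∧
      ∫ t in s..T, ‖v' t‖ ^ 2 / ‖P.vel t‖ ≤ 2 * (F T / P.γ T 0 + Γ * P.γ T 0) := by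
    intro s hs
    have hsT := hs.2
    have hm : ∀ t ∈ Icc s T, t ∈ Ioo P.a P.b := fun t ht =>
      ⟨hs.1.trans_le ht.1, ht.2.trans_lt hTm.2⟩
    have hsub : Icc s T ⊆ P.I := fun t ht => Ioo_subset_Icc_self (hm t ht)
    have hx : ∀ t ∈ Icc s T, 0 < P.γ t 0 := fun t ht => by
      rw [← P.h₁_eq (hsub ht)]; exact P.h₁_pos (hm t ht)
    have hvc := P.continuousOn_vel.mono hsub
    refine integral_div_le_of_energy_le (x := fun t => P.γ t 0) (x' := fun t => P.vel t 0)
      (h := fun t => ‖P.vel t‖) (q := fun t => v t 0 ^ 2 + v t 1 ^ 2)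
      (q' := fun t => 2 * (v t 0 * v' t 0 + v t 1 * v' t 1)) (r := fun t => ‖v' t‖ ^ 2) (F := F)
      (f := f) hsT hΓ0 hx (fun t ht => norm_pos_iff.2 (P.vel_ne_zero (hsub ht)))
      ((continuous_apply_E3 0).comp_continuousOn (P.continuousOn_γ.mono hsub))
      ((continuous_apply_E3 0).comp_continuousOn hvc) hvc.norm
      (fun t ht => hasDerivAt_apply (P.hasDerivAt_γ (hm t (Ioo_subset_Icc_self ht))) 0)
      (fun t _ => (le_abs_self _).trans (abs_apply_le_norm _ 0)) (fun t ht => ?_)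
      (fun t _ => by positivity) (fun t _ => by positivity)
      (isPrimitiveOn_hor_sq h hs.1 hsT hTm.2) (hFp.mono hs.1.le hsT hTm.2.le) (fun t ht => ?_)
      (fun t ht => hFle t ⟨hs.1.trans_le ht.1, ht.2⟩) (hqF s (hm s ⟨le_rfl, hsT⟩))
      (by positivity) (fun t _ => sq_hor_inner_le _ _)
    · have h1 := hvel t ⟨(hm t ht).1.le, ht.2.trans (min_le_left _ _)⟩
      have h2 := norm_nonneg (P.vel t)
      linarith
    · rw [hf, curveDensity, P.h₁_eq (hsub ht), P.h₂_eq]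
      ring
  obtain ⟨c₂, C₂, hc₂, hC₂⟩ := P.exists_h₂_bounds
  -- The bound in `hmain` does not depend on `s`, so `s` may tend to the pole.
  have hdiv : IntegrableOn (fun t => ‖v' t‖ ^ 2 / ‖P.vel t‖) (Ioc P.a T) := by
    have hloc : ∀ s ∈ Ioc P.a T, IntegrableOn (fun t => ‖v' t‖ ^ 2 / ‖P.vel t‖) (Ioc s T) := by
      intro s hs
      have hsub : Icc s T ⊆ P.I := (Icc_subset_Icc hs.1.le le_rfl).trans hsubI
      have h1 := (hmain s hs).1.mul_continuousOn (g := fun t => ‖P.vel t‖⁻¹)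
        (by
          rw [uIcc_of_le hs.2]
          exact (P.continuousOn_vel.mono hsub).norm.inv₀
            fun t ht => norm_ne_zero_iff.2 (P.vel_ne_zero (hsub ht)))
      simpa only [div_eq_mul_inv] using (intervalIntegrable_iff_integrableOn_Ioc_of_le hs.2).1 h1
    have hseq : ∀ n : ℕ, P.a + (T - P.a) * (1 / ((n : ℝ) + 1)) ∈ Ioc P.a T := fun n => by
      have h1 : 0 < 1 / ((n : ℝ) + 1) := by positivity
      have h2 : 1 / ((n : ℝ) + 1) ≤ 1 := by
        rw [div_le_one (by positivity)]; linarith [Nat.cast_nonneg (α := ℝ) n]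
      have h3 : 0 < T - P.a := sub_pos.2 hTm.1
      exact ⟨by nlinarith, by nlinarith⟩
    refine integrableOn_Ioc_of_intervalIntegral_norm_bounded_left (l := Filter.atTop)
      (a := fun n : ℕ => P.a + (T - P.a) * (1 / ((n : ℝ) + 1)))
      (I := 2 * (F T / P.γ T 0 + Γ * P.γ T 0)) (fun n => hloc _ (hseq n)) ?_
      (Filter.Eventually.of_forall fun n => ?_)
    · have h1 := (tendsto_one_div_add_atTop_nhds_zero_nat (𝕜 := ℝ)).const_mul (T - P.a)
      simpa using h1.const_add P.a
    · rw [← intervalIntegral.integral_of_le (hseq n).2]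
      refine le_trans (le_of_eq ?_) (hmain _ (hseq n)).2
      refine intervalIntegral.integral_congr fun t _ => ?_
      exact Real.norm_of_nonneg (by positivity)
  refine ⟨T, hTm, ?_⟩
  rw [integrableOn_Icc_iff_integrableOn_Ioc]
  refine (hdiv.const_mul C₂).mono' ?_ ?_
  · exact (h.aestronglyMeasurable_deriv.mono_measure (Measure.restrict_mono
      (Ioc_subset_Icc_self.trans hsubI) le_rfl)).norm.pow 2
  · filter_upwards [ae_restrict_mem measurableSet_Ioc] with t ht
    have hI := hsubI (Ioc_subset_Icc_self ht)
    have h1 : 0 < ‖P.vel t‖ := norm_pos_iff.2 (P.vel_ne_zero hI)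
    have h2 : ‖P.vel t‖ ≤ C₂ := (hC₂ t hI).2
    rw [Real.norm_of_nonneg (by positivity), mul_div_assoc', le_div_iff₀ h1, mul_comm]
    gcongr

end RevolutionProfile

/-! ### Reversal of orientation and both ends of the interval -/

theorem IsCurve.weaken {a b : ℝ} {loop : Prop} {v v' : ℝ → E3} (h : IsCurve a b loop v v') :
    IsCurve a b False v v' := ⟨h.locInt, h.ftc, fun hf => hf.elim⟩

theorem IsCurve.of_not_loop {a b : ℝ} {loop : Prop} {v v' : ℝ → E3} (h : IsCurve a b False v v')
    (hl : ¬loop) : IsCurve a b loop v v' := ⟨h.locInt, h.ftc, fun hf => (hl hf).elim⟩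

theorem setLIntegral_Icc_reflect (a b : ℝ) (f : ℝ → ℝ≥0∞) :
    ∫⁻ t in Icc a b, f (a + b - t) = ∫⁻ t in Icc a b, f t := by
  have h := (Measure.measurePreserving_sub_left (volume : Measure ℝ) (a + b)).setLIntegral_comp_preimage_emb
    (MeasurableEquiv.subLeft (a + b)).measurableEmbedding f (Icc a b)
  rw [← h]
  congr 2
  ext t
  simp only [mem_preimage, mem_Icc]
  constructor <;> intro h <;> constructor <;> linarith [h.1, h.2]

namespace RevolutionProfile

variable {P Q : RevolutionProfile}

theorem curveEnergy_reverse (g : ℝ → ℝ) (a : E3 → E3) (v v' : ℝ → E3) :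
    P.reverse.curveEnergy g a (fun t => v (P.a + P.b - t)) (fun t => -v' (P.a + P.b - t)) =
      P.curveEnergy g a v v' := by
  unfold curveEnergy
  have h := setLIntegral_Icc_reflect P.a P.b fun t => ENNReal.ofReal
    (P.curveDensity v v' t + P.h₁ t * P.h₂ t * g (inner ℝ (v t) (a (P.γ t))))
  refine Eq.trans (setLIntegral_congr_fun measurableSet_Icc fun t ht => ?_) h
  have e : P.reverse.γ t = P.γ (P.a + P.b - t) := rfl
  simp only [curveDensity, h₁_reverse, h₂_reverse (P := P) ht, norm_neg, e]

theorem IsMinimalCurve.reverse {S : Set E3} {g : ℝ → ℝ} {a : E3 → E3} {v v' : ℝ → E3}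
    (h : P.IsMinimalCurve S g a v v') : P.reverse.IsMinimalCurve S g a
      (fun t => v (P.a + P.b - t)) (fun t => -v' (P.a + P.b - t)) := by
  intro Y Y' hY hYS
  rw [curveEnergy_reverse]
  have h1 := h _ _ (IsCurve.comp_reflect (a := P.a) (b := P.b) hY) fun t ht => hYS _
    ⟨by change P.a < _; linarith [ht.2], by change _ < P.b; linarith [ht.1]⟩
  have h2 := curveEnergy_reverse (P := P) g a (fun t => Y (P.a + P.b - t))
    (fun t => -Y' (P.a + P.b - t))
  simp only [sub_sub_cancel, neg_neg] at h2
  exact h1.trans_eq h2.symm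

theorem IsMinimalCurve.integrableOn_norm_sq_of_pole_right {g : ℝ → ℝ} (hg0 : ∀ s, 0 ≤ g s)
    {a : E3 → E3} {v v' : ℝ → E3} (hmin : P.IsMinimalCurve Q.surface g a v v')
    (hfin : P.curveEnergy g a v v' < ∞) (h : IsCurve P.a P.b False v v')
    (hv : ∀ t ∈ Ioo P.a P.b, v t ∈ Q.surface) (h0 : P.h₁ P.b = 0) {Γ : ℝ}
    (hΓ : ∀ w ∈ Q.surface, ∀ t ∈ P.I, g (inner ℝ w (a (P.γ t))) ≤ Γ) :
    ∃ T ∈ Ioo P.a P.b, IntegrableOn (fun t => ‖v' t‖ ^ 2) (Icc T P.b) := by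
  obtain ⟨T, hT, hi⟩ := hmin.reverse.integrableOn_norm_sq_of_pole hg0
    (by rw [curveEnergy_reverse]; exact hfin) h.comp_reflect
    (fun t ht => hv _ ⟨by have : t < P.b := ht.2; linarith, by have : P.a < t := ht.1; linarith⟩)
    (by rw [h₁_reverse]; simpa [RevolutionProfile.reverse] using h0) (Γ := Γ)
    (fun w hw t ht => hΓ w hw _ ⟨by have : t ≤ P.b := ht.2; linarith,
      by have : P.a ≤ t := ht.1; linarith⟩)
  have hT1 : P.a < T := hT.1
  have hT2 : T < P.b := hT.2
  refine ⟨P.a + P.b - T, ⟨by linarith, by linarith⟩, ?_⟩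
  have h1 := ((intervalIntegrable_iff_integrableOn_Icc_of_le hT1.le).2 hi).comp_sub_left (P.a + P.b)
  rw [add_sub_cancel_left] at h1
  have h2 := (intervalIntegrable_iff_integrableOn_Icc_of_le (by linarith)).1 h1.symm
  simpa only [sub_sub_cancel, norm_neg] using h2

/-- Where h₁ is bounded below, finite energy suffices; minimality is needed at poles only. -/
theorem integrableOn_norm_sq_deriv {g : ℝ → ℝ} (hg0 : ∀ s, 0 ≤ g s) {a : E3 → E3}
    {v v' : ℝ → E3} {loop : Prop} (h : IsCurve P.a P.b loop v v')
    (hfin : P.curveEnergy g a v v' < ∞) {c d : ℝ} (hcd : Icc c d ⊆ P.I)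
    (hpos : ∀ t ∈ Icc c d, 0 < P.h₁ t) : IntegrableOn (fun t => ‖v' t‖ ^ 2) (Icc c d) := by
  obtain ⟨μ, hμ, hμ'⟩ := isCompact_Icc.exists_forall_le' (P.continuousOn_h₁.mono hcd) hpos
  obtain ⟨_, C, _, hC⟩ := P.exists_h₂_bounds
  refine (((integrableOn_curveDensity hg0 h hfin).mono_set hcd).const_mul (C / μ)).mono' ?_ ?_
  · exact (h.aestronglyMeasurable_deriv.mono_measure (Measure.restrict_mono hcd le_rfl)).norm.pow 2
  · filter_upwards [ae_restrict_mem measurableSet_Icc] with t ht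
    have h1 := hμ' t ht
    have h2 := P.h₂_pos (hcd ht)
    have h3 := (hC t (hcd ht)).2
    have h4 := hpos t ht
    have h5 : 1 ≤ C / μ * (P.h₁ t / P.h₂ t) := by
      rw [div_mul_div_comm, one_le_div (by positivity)]
      nlinarith
    have h6 : 0 ≤ P.h₂ t / P.h₁ t * (v t 0 ^ 2 + v t 1 ^ 2) := by positivity
    have h7 : 0 ≤ C / μ := div_nonneg (h2.le.trans h3) hμ.le
    rw [Real.norm_of_nonneg (by positivity), curveDensity]
    nlinarith [mul_le_mul_of_nonneg_right h5 (sq_nonneg ‖v' t‖), mul_nonneg h7 h6]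

/-- Minimal curves have finite Dirichlet integral, even up to the poles. -/
theorem integrableOn_norm_sq_of_minimal {g : ℝ → ℝ} (hg0 : ∀ s, 0 ≤ g s) {a : E3 → E3}
    {v v' : ℝ → E3} {loop : Prop} (h : IsCurve P.a P.b loop v v')
    (hv : ∀ t ∈ Ioo P.a P.b, v t ∈ Q.surface) (hfin : P.curveEnergy g a v v' < ∞) {Γ : ℝ}
    (hΓ : ∀ w ∈ Q.surface, ∀ t ∈ P.I, g (inner ℝ w (a (P.γ t))) ≤ Γ)
    (hmin : (∃ t ∈ P.I, P.h₁ t = 0) → P.IsMinimalCurve Q.surface g a v v') :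
    IntegrableOn (fun t => ‖v' t‖ ^ 2) P.I := by
  have hab := P.a_lt_b
  have ha : P.a ∈ P.I := ⟨le_rfl, hab.le⟩
  have hb : P.b ∈ P.I := ⟨hab.le, le_rfl⟩
  obtain ⟨T, hT, hTi⟩ : ∃ T ∈ Ioo P.a P.b, IntegrableOn (fun t => ‖v' t‖ ^ 2) (Icc P.a T) := by
    rcases (P.h₁_nonneg P.a).eq_or_lt with h0 | h0
    · exact (hmin ⟨_, ha, h0.symm⟩).integrableOn_norm_sq_of_pole hg0 hfin h.weaken hv h0.symm hΓ
    · refine ⟨(P.a + P.b) / 2, ⟨by linarith, by linarith⟩, integrableOn_norm_sq_deriv hg0 h hfin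
        (Icc_subset_Icc le_rfl (by linarith)) fun t ht => ?_⟩
      rcases ht.1.eq_or_lt with e | e
      · rwa [← e]
      · exact P.h₁_pos ⟨e, by linarith [ht.2]⟩
  obtain ⟨S, hS, hSi⟩ : ∃ S ∈ Ioo P.a P.b, IntegrableOn (fun t => ‖v' t‖ ^ 2) (Icc S P.b) := by
    rcases (P.h₁_nonneg P.b).eq_or_lt with h0 | h0
    · exact (hmin ⟨_, hb, h0.symm⟩).integrableOn_norm_sq_of_pole_right hg0 hfin h.weaken hv
        h0.symm hΓ
    · refine ⟨(P.a + P.b) / 2, ⟨by linarith, by linarith⟩, integrableOn_norm_sq_deriv hg0 h hfin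
        (Icc_subset_Icc (by linarith) le_rfl) fun t ht => ?_⟩
      rcases ht.2.eq_or_lt with e | e
      · rwa [e]
      · exact P.h₁_pos ⟨by linarith [ht.1], e⟩
  have hm : ∀ t ∈ Icc T S, t ∈ Ioo P.a P.b := fun t ht =>
    ⟨hT.1.trans_le ht.1, ht.2.trans_lt hS.2⟩
  have hTS : IntegrableOn (fun t => ‖v' t‖ ^ 2) (Icc T S) :=
    integrableOn_norm_sq_deriv hg0 h hfin (fun t ht => Ioo_subset_Icc_self (hm t ht))
      fun t ht => P.h₁_pos (hm t ht)
  refine ((hTi.union hTS).union hSi).mono_set fun t ht => ?_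
  rcases le_total t T with e | e
  · exact Or.inl (Or.inl ⟨ht.1, e⟩)
  · rcases le_total t S with e' | e'
    · exact Or.inl (Or.inr ⟨e, e'⟩)
    · exact Or.inr ⟨e', ht.2⟩

/-- Every curve in T of finite energy generates an admissible equivariant map. A profile with a pole
is not a loop, so no closing condition restricts the competing curves. -/
theorem IsMinimizer.isMinimalCurve {σ : ℤ} (hσ : (σ : ℝ) ^ 2 = 1) {ω : E3 → ℝ} {g : ℝ → ℝ}
    (hg : Continuous g) (hg0 : ∀ s, 0 ≤ g s) {a : E3 → E3} (ha : ContinuousOn a P.surface)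
    (has : TwistedSymmetric σ P.surface a) {m : E3 → E3} (hm : P.IsMinimizer Q.surface ω g a m)
    {v v' : ℝ → E3} (he : ENNReal.ofReal (2 * Real.pi) * P.curveEnergy g a v v' = P.energy ω g a m)
    (hpole : ∃ t ∈ P.I, P.h₁ t = 0) : P.IsMinimalCurve Q.surface g a v v' := by
  intro Y Y' hY hYS
  rcases eq_or_ne (P.curveEnergy g a Y Y') ∞ with htop | hne
  · rw [htop]; exact le_top
  obtain ⟨e, heI, he0⟩ := hpole
  have hl := P.not_loop_of_pole heI he0
  have hmid : (P.a + P.b) / 2 ∈ Ioo P.a P.b :=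
    ⟨by linarith [P.a_lt_b], by linarith [P.a_lt_b]⟩
  classical
  obtain ⟨u, hu, -, -, hue⟩ := P.exists_revolve Q hσ ω hg hg0 ha has
    -- The competing curve is known to lie in T on the open interval only; an end point off the axis
    -- still needs a value there, and any will do.
    (v := fun t => if t ∈ Ioo P.a P.b then Y t else Y ((P.a + P.b) / 2)) (V := Y) (V' := Y')
    (fun t _ _ => by
      split_ifs with h
      exacts [hYS t h, hYS _ hmid])
    (fun h => absurd h hl) (hY.of_not_loop hl) hYS
    (by filter_upwards [P.ae_mem_Ioo] with t ht using if_pos ht) hne.lt_top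
    fun t ht h0 => exists_axis_point hg0 hYS hne.lt_top ht h0
  have h1 := (hm.2.2 u hu).trans hue
  rw [← he] at h1
  exact (ENNReal.mul_le_mul_iff_right (ENNReal.ofReal_pos.2 Real.two_pi_pos).ne'
    ENNReal.ofReal_ne_top).1 h1

theorem exists_anisotropy_bound (P Q : RevolutionProfile) {g : ℝ → ℝ} (hg : Continuous g)
    {a : E3 → E3} (ha : ContinuousOn a P.surface) :
    ∃ Γ, ∀ w ∈ Q.surface, ∀ t ∈ P.I, g (inner ℝ w (a (P.γ t))) ≤ Γ := by
  have hc : ContinuousOn (fun q : E3 × E3 => g (inner ℝ q.1 (a q.2))) (Q.surface ×ˢ P.surface) :=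
    hg.comp_continuousOn (continuousOn_fst.inner (ha.comp continuousOn_snd fun q hq => hq.2))
  obtain ⟨Γ, hΓ⟩ := (Q.isCompact_surface.prod P.isCompact_surface).bddAbove_image hc
  exact ⟨Γ, fun w hw t ht => hΓ ⟨(w, P.γ t), ⟨hw, P.γ_mem_surface ht⟩, rfl⟩⟩

end RevolutionProfile

/-! ### Sobolev functions on an interval -/

namespace MemH1Interval

variable {a b : ℝ} {F G : Type*} [NormedAddCommGroup F] [NormedSpace ℝ F] [NormedAddCommGroup G]
  [NormedSpace ℝ G] {f g : ℝ → F}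

theorem congr_ae (h : MemH1Interval a b f) (he : f =ᵐ[volume.restrict (Icc a b)] g) :
    MemH1Interval a b g := by
  obtain ⟨h1, f', h2, h3⟩ := h
  refine ⟨h1.ae_eq he, f', h2, fun χ hχ hc hs => ?_⟩
  rw [← h3 χ hχ hc hs]
  refine integral_congr_ae ?_
  filter_upwards [he] with t ht
  rw [ht]

theorem _root_.integrableOn_bump_smul {χ : ℝ → ℝ} (hχ : Continuous χ) (hc : HasCompactSupport χ)
    (hf : MemLp f 2 (volume.restrict (Icc a b))) : Integrable (fun t => χ t • f t)
      (volume.restrict (Icc a b)) := by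
  obtain ⟨C, hC⟩ := hχ.bounded_above_of_compact_support hc
  exact (hf.integrable one_le_two).bdd_smul C hχ.aestronglyMeasurable (ae_of_all _ hC)

theorem add (hf : MemH1Interval a b f) (hg : MemH1Interval a b g) :
    MemH1Interval a b (fun t => f t + g t) := by
  obtain ⟨h1, f', h2, h3⟩ := hf
  obtain ⟨k1, g', k2, k3⟩ := hg
  refine ⟨h1.add k1, fun t => f' t + g' t, h2.add k2, fun χ hχ hc hs => ?_⟩
  have hχ' := hχ.continuous_deriv (by simp)
  simp only [smul_add]
  rw [integral_add (integrableOn_bump_smul hχ' hc.deriv h1) (integrableOn_bump_smul hχ' hc.deriv k1),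
    integral_add (integrableOn_bump_smul hχ.continuous hc h2)
      (integrableOn_bump_smul hχ.continuous hc k2), h3 χ hχ hc hs, k3 χ hχ hc hs, neg_add]

theorem clm [CompleteSpace F] [CompleteSpace G] (hf : MemH1Interval a b f) (L : F →L[ℝ] G) :
    MemH1Interval a b (fun t => L (f t)) := by
  obtain ⟨h1, f', h2, h3⟩ := hf
  refine ⟨L.comp_memLp' h1, fun t => L (f' t), L.comp_memLp' h2, fun χ hχ hc hs => ?_⟩
  have hχ' := hχ.continuous_deriv (by simp)
  simp only [← map_smul]
  rw [L.integral_comp_comm (integrableOn_bump_smul hχ' hc.deriv h1),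
    L.integral_comp_comm (integrableOn_bump_smul hχ.continuous hc h2), h3 χ hχ hc hs, map_neg]

theorem of_isCurve {v v' : ℝ → E3} {loop : Prop} (h : IsCurve a b loop v v') (hab : a < b)
    {R : ℝ} (hR : ∀ t ∈ Ioo a b, ‖v t‖ ≤ R) (hv' : IntegrableOn (fun t => ‖v' t‖ ^ 2) (Icc a b)) :
    MemH1Interval a b v := by
  have h1 : MemLp v 2 (volume.restrict (Icc a b)) := by
    refine MemLp.of_bound h.aestronglyMeasurable R ?_
    rw [← restrict_Ioo_eq_restrict_Icc]
    filter_upwards [ae_restrict_mem measurableSet_Ioo] with t ht using hR t ht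
  have h2 : MemLp v' 2 (volume.restrict (Icc a b)) :=
    (memLp_two_iff_integrable_sq_norm h.aestronglyMeasurable_deriv).2 hv'
  refine ⟨h1, v', h2, fun χ hχ hc hs => ?_⟩
  exact h.integral_deriv_smul hab ((IsBump.of_tsupport hχ hc hs).isTest1 loop)
    (integrableOn_bump_smul (hχ.continuous_deriv (by simp)) hc.deriv h1)
    (integrableOn_bump_smul hχ.continuous hc h2)

end MemH1Interval

/-! ### Recovering the first modes -/

/-- The first two coordinates. -/
noncomputable def horProj : E3 →L[ℝ] E2 :=
  LinearMap.toContinuousLinearMap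
    { toFun := fun v => !₂[v 0, v 1]
      map_add' := fun v w => by ext i; fin_cases i <;> simp
      map_smul' := fun c v => by ext i; fin_cases i <;> simp }

@[simp] theorem horProj_apply (v : E3) : horProj v = !₂[v 0, v 1] := rfl

namespace RevolutionProfile

variable {P Q : RevolutionProfile}

theorem aemeasurable_coeff {M : ℝ × ℝ → E3} (hM : AEStronglyMeasurable M (volume.restrict P.rect))
    {e : ℝ → ℝ} (he : Continuous e) (c : ℝ) (i : Fin 3) :
    AEMeasurable (fun t => c * ∫ s in (0 : ℝ)..(2 * Real.pi), e s * M (s, t) i)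
      (volume.restrict P.I) := by
  have h1 : AEStronglyMeasurable (fun p : ℝ × ℝ => e p.1 * M p i) (volume.restrict P.rect) :=
    (he.comp continuous_fst).aestronglyMeasurable.mul
      ((continuous_apply_E3 i).comp_aestronglyMeasurable hM)
  rw [P.restrict_rect] at h1
  have h2 := h1.prod_swap.integral_prod_right'.aemeasurable
  refine (h2.congr (ae_of_all _ fun t => ?_)).const_mul c
  exact integral_Icc_two_pi fun φ => e φ * M (φ, t) i

/-- The first modes of a field. -/
noncomputable def firstModes (α β : ℝ → E2) (η : ℝ → ℝ) (p : ℝ × ℝ) : E3 :=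
  Real.cos p.1 • horiz (α p.2) + Real.sin p.1 • horiz (β p.2) + η p.2 • e3

theorem firstModes_zero (α β : ℝ → E2) (η : ℝ → ℝ) (p : ℝ × ℝ) :
    firstModes α β η p 0 = α p.2 0 * Real.cos p.1 + β p.2 0 * Real.sin p.1 := by
  simp [firstModes, horiz, e3, mul_comm]

theorem firstModes_one (α β : ℝ → E2) (η : ℝ → ℝ) (p : ℝ × ℝ) :
    firstModes α β η p 1 = α p.2 1 * Real.cos p.1 + β p.2 1 * Real.sin p.1 := by
  simp [firstModes, horiz, e3, mul_comm]

theorem firstModes_two (α β : ℝ → E2) (η : ℝ → ℝ) (p : ℝ × ℝ) :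
    firstModes α β η p 2 = η p.2 := by
  simp [firstModes, horiz, e3]

theorem continuous_firstModes (α β : ℝ → E2) (η : ℝ → ℝ) (t : ℝ) :
    Continuous fun φ => firstModes α β η (φ, t) := by
  have h : ∀ v w z : E3, Continuous fun φ : ℝ => Real.cos φ • v + Real.sin φ • w + z := by fun_prop
  exact h (horiz (α t)) (horiz (β t)) (η t • e3)

theorem _root_.E3.ext {v w : E3} (h0 : v 0 = w 0) (h1 : v 1 = w 1) (h2 : v 2 = w 2) : v = w := by
  ext i
  fin_cases i
  exacts [h0, h1, h2]

/-- An iterated almost-everywhere statement yields one on the product only for measurable sets;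
measurability of both fields enters through the integral of the norm of their difference. -/
theorem ae_rect_of_ae_ae {M N : ℝ × ℝ → E3} (hM : AEStronglyMeasurable M (volume.restrict P.rect))
    (hN : AEStronglyMeasurable N (volume.restrict P.rect))
    (h : ∀ᵐ t ∂(volume.restrict P.I), ∀ᵐ φ ∂(volume.restrict (Icc 0 (2 * Real.pi))),
      M (φ, t) = N (φ, t)) : ∀ᵐ p ∂(volume.restrict P.rect), M p = N p := by
  have hm : AEMeasurable (fun p => ‖M p - N p‖ₑ) (volume.restrict P.rect) := (hM.sub hN).enorm
  have h0 : ∫⁻ p in P.rect, ‖M p - N p‖ₑ = 0 := by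
    rw [P.lintegral_rect hm]
    refine (lintegral_congr_ae (g := fun _ => 0) ?_).trans lintegral_zero
    filter_upwards [h] with t ht
    refine (lintegral_congr_ae (g := fun _ => 0) ?_).trans lintegral_zero
    filter_upwards [ht] with φ hφ
    rw [hφ, sub_self, enorm_zero]
  filter_upwards [(lintegral_eq_zero_iff' hm).1 h0] with p hp
  exact sub_eq_zero.1 (enorm_eq_zero.1 hp)

/-- Exceptions form an open set, which would have positive measure; closedness and periodicity take
care of the remaining angles. -/
theorem forall_mem_of_ae_mem {f : ℝ → E3} (hf : Continuous f)
    (hper : Function.Periodic f (2 * Real.pi)) {C : Set E3} (hC : IsClosed C)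
    (h : ∀ᵐ φ ∂(volume.restrict (Ioc 0 (2 * Real.pi))), f φ ∈ C) (φ : ℝ) : f φ ∈ C := by
  have h1 : Ioo 0 (2 * Real.pi) ⊆ f ⁻¹' C := by
    intro s hs
    by_contra hn
    have ho : IsOpen (Ioo 0 (2 * Real.pi) ∩ f ⁻¹' Cᶜ) := isOpen_Ioo.inter (hC.isOpen_compl.preimage hf)
    refine (ho.measure_pos volume ⟨s, hs, hn⟩).ne'
      (measure_mono_null ?_ (ae_iff.1 ((ae_restrict_iff' measurableSet_Ioc).1 h)))
    rintro r ⟨hr, hrC⟩ hr'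
    exact hrC (hr' (Ioo_subset_Ioc_self hr))
  have h2 : Icc 0 (2 * Real.pi) ⊆ f ⁻¹' C := by
    rw [← closure_Ioo Real.two_pi_pos.ne]
    exact (hC.preimage hf).closure_subset_iff.2 h1
  obtain ⟨s, hs, he⟩ := hper.exists_mem_Ico₀ Real.two_pi_pos φ
  rw [he]
  exact h2 (Ico_subset_Icc_self hs)

theorem exists_mem_of_ae {p : ℝ → Prop} (h : ∀ᵐ φ ∂(volume.restrict (Icc 0 (2 * Real.pi))), p φ)
    {c d : ℝ} (hc : 0 ≤ c) (hcd : c < d) (hd : d ≤ 2 * Real.pi) : ∃ φ ∈ Ioo c d, p φ := by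
  have h1 : ∀ᵐ φ ∂(volume.restrict (Ioo c d)), p φ := ae_restrict_of_ae_restrict_of_subset
    (Ioo_subset_Icc_self.trans (Icc_subset_Icc hc hd)) h
  have h2 : (volume.restrict (Ioo c d)) ≠ 0 := by
    rw [Ne, Measure.restrict_eq_zero, Real.volume_Ioo, ENNReal.ofReal_eq_zero, not_le]
    linarith
  have : (ae (volume.restrict (Ioo c d))).NeBot := ae_neBot.2 h2
  obtain ⟨φ, hφ, hφ'⟩ := (h1.and (ae_restrict_mem measurableSet_Ioo)).exists
  exact ⟨φ, hφ', hφ⟩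

section Minimizer

variable {σ : ℤ} {ω : E3 → ℝ} {g : ℝ → ℝ} {a m : E3 → E3}

theorem IsMinimizer.exists_twistedSymmetric (hσ : (σ : ℝ) ^ 2 = 1)
    (hω : Measurable (P.surface.domRestrict ω)) (hg : Continuous g) (hg0 : ∀ s, 0 ≤ g s)
    (ha : ContinuousOn a P.surface) (has : TwistedSymmetric σ P.surface a)
    (hW : ∀ t ∈ P.I, 0 < P.h₁ t →
      ENNReal.ofReal (Real.sqrt (2 * Real.pi)) < ENNReal.ofReal (P.h₁ t) * P.circWeight ω t)
    (hm : P.IsMinimizer Q.surface ω g a m) :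
    ∃ u, P.MemH1To Q.surface u ∧ TwistedSymmetric σ P.surface u ∧
      P.energy ω g a u = P.energy ω g a m ∧
      ∃ φ₀ ∈ Icc 0 (2 * Real.pi), ∀ φ : ℝ, ∀ t ∈ P.I, 0 < P.h₁ t →
        u (P.ξ (φ, t)) = rot (σ * φ) (rot (-(σ * φ₀)) (m (P.ξ (φ₀, t)))) := by
  obtain ⟨D, hD, -⟩ := hm.exists_slices hσ hω hg hg0 ha has hW
  obtain ⟨φ, hφ, V, hV, hVQ, hmV, hE⟩ := exists_mem_of_ae hD le_rfl Real.two_pi_pos le_rfl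
  have hVQ' : ∀ t ∈ Ioo P.a P.b, rot (-(σ * φ)) (V t) ∈ Q.surface := fun t ht =>
    Q.rot_mem_surface _ (hVQ t ht)
  have hfin : P.curveEnergy g a (fun t => rot (-(σ * φ)) (V t))
      (fun t => rot (-(σ * φ)) (D (φ, t))) < ∞ := by
    by_contra htop
    rw [not_lt_top_iff.1 htop, ENNReal.mul_top (ENNReal.ofReal_pos.2 Real.two_pi_pos).ne'] at hE
    exact hm.2.1.ne hE.symm
  obtain ⟨u, hu, hus, huv, hue⟩ := P.exists_revolve Q hσ ω hg hg0 ha has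
    (v := fun t => rot (-(σ * φ)) (m (P.ξ (φ, t)))) (V := fun t => rot (-(σ * φ)) (V t))
    (V' := fun t => rot (-(σ * φ)) (D (φ, t)))
    (fun t ht _ => Q.rot_mem_surface _ (hm.1.2 _ (P.ξ_mem_surface φ ht)))
    (fun hl => by simp only [ξ, hl]) (hV.rotate _) hVQ'
    (by filter_upwards [hmV] with t ht using by rw [ht]) hfin
    (fun t ht h0 => exists_axis_point hg0 hVQ' hfin ht h0)
  rw [hE] at hue
  exact ⟨u, hu, hus, le_antisymm hue (hm.2.2 u hu), φ, Ioo_subset_Icc_self hφ, huv⟩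

/-- The minimal curve is the meridian turned back by a fixed angle, and a constant rotation does not
change the norm of its derivative. -/
theorem IsMinimizer.ae_exists_memH1Interval (hσ : (σ : ℝ) ^ 2 = 1) (hg : Continuous g)
    (hg0 : ∀ s, 0 ≤ g s) (ha : ContinuousOn a P.surface) (has : TwistedSymmetric σ P.surface a)
    (hm : P.IsMinimizer Q.surface ω g a m) {D : ℝ × ℝ → E3}
    (hD : ∀ᵐ φ ∂(volume.restrict (Icc 0 (2 * Real.pi))), ∃ V,
        IsCurve P.a P.b (P.γ P.a = P.γ P.b) V (fun t => D (φ, t)) ∧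
        (∀ t ∈ Ioo P.a P.b, V t ∈ Q.surface) ∧
        (∀ᵐ t ∂(volume.restrict P.I), m (P.ξ (φ, t)) = V t) ∧
        ENNReal.ofReal (2 * Real.pi) * P.curveEnergy g a (fun t => rot (-(σ * φ)) (V t))
          (fun t => rot (-(σ * φ)) (D (φ, t))) = P.energy ω g a m) :
    ∀ᵐ φ ∂(volume.restrict (Icc 0 (2 * Real.pi))), ∃ V, MemH1Interval P.a P.b V ∧
      ∀ᵐ t ∂(volume.restrict P.I), m (P.ξ (φ, t)) = V t := by
  obtain ⟨Γ, hΓ⟩ := P.exists_anisotropy_bound Q hg ha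
  obtain ⟨R, -, hR⟩ := Q.exists_surface_bound
  filter_upwards [hD] with φ ⟨V, hV, hVQ, hmV, hE⟩
  refine ⟨V, ?_, hmV⟩
  have hfin : P.curveEnergy g a (fun t => rot (-(σ * φ)) (V t))
      (fun t => rot (-(σ * φ)) (D (φ, t))) < ∞ := by
    by_contra htop
    rw [not_lt_top_iff.1 htop, ENNReal.mul_top (ENNReal.ofReal_pos.2 Real.two_pi_pos).ne'] at hE
    exact hm.2.1.ne hE.symm
  have hi := integrableOn_norm_sq_of_minimal hg0 (hV.rotate (-(σ * φ)))
    (fun t ht => Q.rot_mem_surface _ (hVQ t ht)) hfin hΓ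
    (fun hp => hm.isMinimalCurve hσ hg hg0 ha has hE hp)
  simp only [norm_rot] at hi
  exact MemH1Interval.of_isCurve hV P.a_lt_b (fun t ht => hR _ (hVQ t ht)) hi

theorem IsMinimizer.exists_firstModes (hσ : (σ : ℝ) ^ 2 = 1)
    (hω : Measurable (P.surface.domRestrict ω)) (hg : Continuous g) (hg0 : ∀ s, 0 ≤ g s)
    (ha : ContinuousOn a P.surface) (has : TwistedSymmetric σ P.surface a)
    (hW : ∀ t ∈ P.I, 0 < P.h₁ t →
      ENNReal.ofReal (Real.sqrt (2 * Real.pi)) < ENNReal.ofReal (P.h₁ t) * P.circWeight ω t)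
    (hm : P.IsMinimizer Q.surface ω g a m) :
    (∃ (α β : ℝ → E2) (η : ℝ → ℝ),
      MemH1Interval P.a P.b α ∧ MemH1Interval P.a P.b β ∧ MemH1Interval P.a P.b η ∧
      (∀ᵐ p ∂(volume.restrict P.rect), m (P.ξ p) = firstModes α β η p) ∧
      (∀ᵐ t ∂(volume.restrict P.I), ∀ φ : ℝ, firstModes α β η (φ, t) ∈ Q.surface)) ∧
    P.AxiallyNullAverage m := by
  obtain ⟨D, hD, hmodes⟩ := hm.exists_slices hσ hω hg hg0 ha has hW
  have hM := hm.1.1.measurable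
  set C : Fin 3 → ℝ → ℝ := fun i t => cosCoeff fun s => m (P.ξ (s, t)) i with hC
  set S : Fin 3 → ℝ → ℝ := fun i t => sinCoeff fun s => m (P.ξ (s, t)) i with hS
  set η : ℝ → ℝ := fun t => meanCoeff fun s => m (P.ξ (s, t)) 2 with hη
  set α : ℝ → E2 := fun t => !₂[C 0 t, C 1 t] with hα
  set β : ℝ → E2 := fun t => !₂[S 0 t, S 1 t] with hβ
  have hCm : ∀ i, AEMeasurable (C i) (volume.restrict P.I) := fun i =>
    aemeasurable_coeff hM Real.continuous_cos _ i
  have hSm : ∀ i, AEMeasurable (S i) (volume.restrict P.I) := fun i =>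
    aemeasurable_coeff hM Real.continuous_sin _ i
  have hηm : AEMeasurable η (volume.restrict P.I) := by
    have h := aemeasurable_coeff hM (continuous_const (y := (1 : ℝ))) (2 * Real.pi)⁻¹ 2
    simp only [one_mul] at h
    exact h
  have hNm : AEStronglyMeasurable (firstModes α β η) (volume.restrict P.rect) := by
    have hc : ∀ i, AEMeasurable (fun p : ℝ × ℝ => C i p.2 * Real.cos p.1 + S i p.2 * Real.sin p.1)
        (volume.restrict P.rect) := fun i =>
      ((aemeasurable_snd_real (hCm i)).mul (Real.measurable_cos.comp measurable_fst).aemeasurable).add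
        ((aemeasurable_snd_real (hSm i)).mul (Real.measurable_sin.comp measurable_fst).aemeasurable)
    have h1 : AEMeasurable (fun p : ℝ × ℝ => fun i : Fin 3 => firstModes α β η p i)
        (volume.restrict P.rect) := by
      refine aemeasurable_pi_lambda _ fun i => ?_
      fin_cases i
      · exact (hc 0).congr (ae_of_all _ fun p => (firstModes_zero α β η p).symm)
      · exact (hc 1).congr (ae_of_all _ fun p => (firstModes_one α β η p).symm)
      · exact (aemeasurable_snd_real hηm).congr (ae_of_all _ fun p => (firstModes_two α β η p).symm)
    exact ((PiLp.continuous_toLp 2 _).measurable.comp_aemeasurable h1).aestronglyMeasurable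
  have hslice : ∀ᵐ t ∂(volume.restrict P.I), ∀ᵐ φ ∂(volume.restrict (Ioc 0 (2 * Real.pi))),
      m (P.ξ (φ, t)) = firstModes α β η (φ, t) := by
    filter_upwards [hmodes] with t ht
    filter_upwards [ht.2] with φ ⟨e0, e1, e2⟩
    refine E3.ext ?_ ?_ ?_
    · rw [e0, firstModes_zero]; rfl
    · rw [e1, firstModes_one]; rfl
    · rw [e2, firstModes_two]
  have hrect := ae_rect_of_ae_ae hM hNm
    (by filter_upwards [hslice] with t ht using ae_restrict_Icc_two_pi ht)
  have hgood := (hm.ae_exists_memH1Interval hσ hg hg0 ha has hD).and (ae_ae_of_ae_rect hrect)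
  have hpi := Real.pi_gt_three
  -- Two good angles in (0, 1) and (1, 2) differ by an amount between 0 and 2 < π, so that the
  -- linear system for the cosine and sine coefficients has the nonzero determinant sin(φ₂ - φ₁).
  obtain ⟨φ₁, hφ₁, ⟨V, hV, hmV⟩, hN₁⟩ := exists_mem_of_ae hgood le_rfl zero_lt_one (by linarith)
  obtain ⟨φ₂, hφ₂, ⟨V₂, hV₂, hmV₂⟩, hN₂⟩ := exists_mem_of_ae hgood zero_le_one one_lt_two (by linarith)
  have hsin : 0 < Real.sin (φ₂ - φ₁) :=
    Real.sin_pos_of_pos_of_lt_pi (by linarith [hφ₁.2, hφ₂.1]) (by linarith [hφ₁.1, hφ₂.2])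
  set d := Real.sin (φ₂ - φ₁) with hd
  have hd' : d = Real.sin φ₂ * Real.cos φ₁ - Real.cos φ₂ * Real.sin φ₁ := Real.sin_sub _ _
  refine ⟨⟨α, β, η, ?_, ?_, ?_, hrect, ?_⟩, ?_⟩
  -- Cramer's rule expresses the coefficients as fixed linear combinations of two meridians, both of
  -- class H¹.
  · refine ((hV.clm ((d⁻¹ * Real.sin φ₂) • horProj)).add
      (hV₂.clm ((-(d⁻¹ * Real.sin φ₁)) • horProj))).congr_ae ?_
    filter_upwards [hmV, hN₁, hmV₂, hN₂] with t e1 e2 e3 e4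
    rw [← e1, e2, ← e3, e4]
    ext i
    fin_cases i
    · simp [firstModes_zero]
      field_simp
      rw [hd']
      ring
    · simp [firstModes_one]
      field_simp
      rw [hd']
      ring
  · refine ((hV.clm ((-(d⁻¹ * Real.cos φ₂)) • horProj)).add
      (hV₂.clm ((d⁻¹ * Real.cos φ₁) • horProj))).congr_ae ?_
    filter_upwards [hmV, hN₁, hmV₂, hN₂] with t e1 e2 e3 e4
    rw [← e1, e2, ← e3, e4]
    ext i
    fin_cases i
    · simp [firstModes_zero]
      field_simp
      rw [hd']
      ring
    · simp [firstModes_one]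
      field_simp
      rw [hd']
      ring
  · refine (hV.clm (EuclideanSpace.proj (2 : Fin 3))).congr_ae ?_
    filter_upwards [hmV, hN₁] with t e1 e2
    rw [← e1, e2]
    exact firstModes_two α β η (φ₁, t)
  -- The trigonometric expression is continuous and periodic in φ and agrees with m for almost every
  -- φ; the target is closed.
  · filter_upwards [hslice, ae_restrict_mem measurableSet_Icc] with t ht hI
    refine forall_mem_of_ae_mem (continuous_firstModes α β η t) (fun φ => ?_)
      Q.isCompact_surface.isClosed ?_
    · simp only [firstModes, Real.cos_add_two_pi, Real.sin_add_two_pi]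
    · filter_upwards [ht] with φ hφ
      rw [← hφ]
      exact hm.1.2 _ (P.ξ_mem_surface φ hI)
  · unfold AxiallyNullAverage
    filter_upwards [hmodes, hslice] with t h1 h2
    have hi : IntervalIntegrable (fun φ => m (P.ξ (φ, t))) volume 0 (2 * Real.pi) := by
      refine ((continuous_firstModes α β η t).intervalIntegrable _ _).congr_ae ?_
      rw [uIoc_of_le Real.two_pi_pos.le]
      filter_upwards [h2] with φ hφ using hφ.symm
    have h3 := norm_sq_cross_circleAvg (P := P) (m := m) (p := (0, t)) hi
    have h4 : P.ξ (0, t) = P.γ t := rot_zero_angle _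
    rw [h1.1, mul_zero, h4] at h3
    exact norm_eq_zero.1 (pow_eq_zero_iff two_ne_zero |>.1 h3)

end Minimizer

end RevolutionProfile

/-! ### The theorem -/

theorem theorem1
    -- the profiles that generate the surfaces of revolution `S` and `T`
    (P Q : RevolutionProfile)
    (ω : E3 → ℝ) (hω_meas : Measurable (P.surface.domRestrict ω))
    (hω_nonneg : ∀ ξ ∈ P.surface, 0 ≤ ω ξ)
    (hω_sup : (⨆ t ∈ P.I, ENNReal.ofReal (P.h₁ t) * P.circWeight ω t) < ⊤)
    (g : ℝ → ℝ) (hg_lip : ∃ K, LipschitzWith K g) (hg_nonneg : ∀ s, 0 ≤ g s)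
    (a : E3 → E3) (ha_lip : ∃ K, LipschitzOnWith K a P.surface)
    -- `h₁ W > √(2π)` on all circles of latitude (at a pole `h₁` vanishes)
    (hW : ∀ t ∈ P.I, 0 < P.h₁ t →
      ENNReal.ofReal (Real.sqrt (2 * Real.pi)) < ENNReal.ofReal (P.h₁ t) * P.circWeight ω t) :
    (AxiallySymmetric P.surface a →
      ∀ m, P.IsMinimizer Q.surface ω g a m →
        ∃ u, P.MemH1To Q.surface u ∧ AxiallySymmetric P.surface u ∧
          P.energy ω g a u = P.energy ω g a m ∧
          ∃ φ₀ ∈ Set.Icc 0 (2 * Real.pi), ∀ φ : ℝ, ∀ t ∈ P.I, 0 < P.h₁ t →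
            u (P.ξ (φ, t)) = rot φ (rot (-φ₀) (m (P.ξ (φ₀, t))))) ∧
    (AxiallyAntisymmetric P.surface a →
      ∀ m, P.IsMinimizer Q.surface ω g a m →
        ∃ u, P.MemH1To Q.surface u ∧ AxiallyAntisymmetric P.surface u ∧
          P.energy ω g a u = P.energy ω g a m ∧
          ∃ φ₀ ∈ Set.Icc 0 (2 * Real.pi), ∀ φ : ℝ, ∀ t ∈ P.I, 0 < P.h₁ t →
            u (P.ξ (φ, t)) = rot (-φ) (rot φ₀ (m (P.ξ (φ₀, t))))) ∧
    (AxiallySymmetric P.surface a ∨ AxiallyAntisymmetric P.surface a →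
      ∀ m, P.IsMinimizer Q.surface ω g a m →
        (∃ (α β : ℝ → E2) (η : ℝ → ℝ),
          MemH1Interval P.a P.b α ∧ MemH1Interval P.a P.b β ∧ MemH1Interval P.a P.b η ∧
          (∀ᵐ p ∂(MeasureTheory.volume.restrict P.rect),
            m (P.ξ p) = Real.cos p.1 • horiz (α p.2) + Real.sin p.1 • horiz (β p.2)
              + η p.2 • e3) ∧
          (∀ᵐ t ∂(MeasureTheory.volume.restrict P.I), ∀ φ : ℝ,
            Real.cos φ • horiz (α t) + Real.sin φ • horiz (β t) + η t • e3 ∈ Q.surface)) ∧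
        P.AxiallyNullAverage m) := by
  obtain ⟨K, hK⟩ := hg_lip
  obtain ⟨L, hL⟩ := ha_lip
  have hg := hK.continuous
  have ha := hL.continuousOn
  -- Symmetry and antisymmetry are the twists 1 and -1. The common argument uses only that σ is an
  -- integer with σ² = 1.
  have hone : (((1 : ℤ) : ℝ)) ^ 2 = 1 := by norm_num
  have hneg : (((-1 : ℤ) : ℝ)) ^ 2 = 1 := by norm_num
  have hsym : ∀ u, TwistedSymmetric 1 P.surface u ↔ AxiallySymmetric P.surface u :=
    fun u => by simp [TwistedSymmetric, AxiallySymmetric]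
  have hanti : ∀ u, TwistedSymmetric (-1) P.surface u ↔
      AxiallyAntisymmetric P.surface u :=
    fun u => by simp [TwistedSymmetric, AxiallyAntisymmetric]
  refine ⟨fun has m hm => ?_, fun has m hm => ?_, fun has m hm => ?_⟩
  · obtain ⟨u, h1, h2, h3, φ₀, h4, h5⟩ := hm.exists_twistedSymmetric hone hω_meas hg hg_nonneg ha
      ((hsym a).2 has) hW
    refine ⟨u, h1, (hsym u).1 h2, h3, φ₀, h4, fun φ t ht h => ?_⟩
    rw [h5 φ t ht h]
    simp
  · obtain ⟨u, h1, h2, h3, φ₀, h4, h5⟩ := hm.exists_twistedSymmetric hneg hω_meas hg hg_nonneg ha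
      ((hanti a).2 has) hW
    refine ⟨u, h1, (hanti u).1 h2, h3, φ₀, h4, fun φ t ht h => ?_⟩
    rw [h5 φ t ht h]
    simp
  · rcases has with has | has
    · exact hm.exists_firstModes hone hω_meas hg hg_nonneg ha ((hsym a).2 has) hW
    · exact hm.exists_firstModes hneg hω_meas hg hg_nonneg ha ((hanti a).2 has) hW
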